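/- Let $n\ge 0$ and let $V=\mathbb{R}^{n+2}$ be Minkowski space with the form $\eta(x,y)=-x_0y_0+x_1y_1+\dots+x_{n+1}y_{n+1}$. Let $SO(V)$ be the group of linear automorphisms of $V$ of determinant $1$ that preserve $\eta$, let $SO^0(V)$ be its identity component, and let $L^{n+1}=\{x\in V:\eta(x,x)=-1,\ x_0>0\}$ be Lobachevskian space. A *connected subgroup* of $SO(V)$ means a connected, not necessarily closed, Lie subgroup, that is, a subgroup generated by the exponentials of the elements of a Lie subalgebra of $\mathfrak{so}(V)$. A *null basis* is a basis $p,e_1,\dots,e_n,q$ of $V$ in which $\eta$ has the Gram matrix $$\begin{pmatrix}0&0&1\\0&E_n&0\\1&0&0\end{pmatrix},$$ where $E_n$ is the identity matrix. Given such a basis, let $E=\mathrm{span}(e_1,\dots,e_n)$ and let $A,K,N\subset SO(V)$ be the subgroups whose matrices in this basis are $$A=\left\{\begin{pmatrix}a&0&0\\0&\mathrm{id}&0\\0&0&\frac1a\end{pmatrix}:a>0\right\},\quad K=\left\{\begin{pmatrix}1&0&0\\0&f&0\\0&0&1\end{pmatrix}:f\in SO(E)\right\},\quad N=\left\{\begin{pmatrix}1&-X^t&-\frac12X^tX\\0&\mathrm{id}&X\\0&0&1\end{pmatrix}:X\in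 E\right\}.$$ For a homomorphism $\Phi:A\to K$ put $A^\Phi=\{\Phi(a)\cdot a:a\in A\}$. Below, $\times$ and $\ltimes$ denote internal direct and semidirect products of subgroups, with $N$ normal. **Theorem.** (i) Let $G\subset SO(V)$ be a connected subgroup that acts transitively on $L^{n+1}$. Then $G=SO^0(V)$, or $G$ preserves an isotropic line $l\subset V$ and there is a null basis $p,e_1,\dots,e_n,q$ with $l=\mathbb{R}p$ such that, for this basis, $G$ is one of the following groups: (1) $(A\times H)\ltimes N$, where $H\subset K$ is a subgroup; (2) $(A^\Phi\times H)\ltimes N$, where $\Phi:A\to K$ is a nontrivial continuous homomorphism and $H\subset K$ is a subgroup. (ii) A subgroup $G\subset SO(V)$ is connected and acts simply transitively on $L^{n+1}$ if and only if there is a null basis for which $G=A\ltimes N$, or $G=A^\Phi\ltimes N$ for some nontrivial continuous homomorphism $\Phi:A\to K$. -/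

import Mathlib

open scoped Matrix

noncomputable section

namespace Lobachevsky

/-- The vector space `V = ℝ^{n+2}` with coordinates `x_0, x_1, …, x_{n+1}`. -/
abbrev V (n : ℕ) : Type := Fin (n + 2) → ℝ

/-- Real square matrices of size `n + 2`, that is, endomorphisms of `V`. -/
abbrev Mat (n : ℕ) : Type := Matrix (Fin (n + 2)) (Fin (n + 2)) ℝ

/-- The Gram matrix `diag(-1, 1, …, 1)` of the Minkowski metric. -/
def gram (n : ℕ) : Mat n := Matrix.diagonal (Fin.cons (-1) (fun _ => 1))

/-- The Minkowski metric `η(x, y) = - x_0 y_0 + x_1 y_1 + ⋯ + x_{n+1} y_{n+1}`. -/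
def eta (n : ℕ) : LinearMap.BilinForm ℝ (V n) := Matrix.toBilin' (gram n)

theorem eta_apply (n : ℕ) (x y : V n) :
    eta n x y = - (x 0 * y 0) + ∑ i : Fin (n + 1), x i.succ * y i.succ := by
  simp [eta, gram, Matrix.toBilin'_apply', Matrix.mulVec_diagonal, dotProduct,
    Fin.sum_univ_succ]

/-- Lobachevskian space `L^{n+1} = {x : η(x, x) = -1, x_0 > 0}` (vector model). -/
def lobSpace (n : ℕ) : Set (V n) := {x | eta n x x = -1 ∧ 0 < x 0}

/-- The group `SO(V)` of linear automorphisms of `V` that preserve `η` and have determinant 1.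
It carries the topology induced from `GL`. -/
def SO (n : ℕ) : Subgroup (GL (Fin (n + 2)) ℝ) where
  carrier := {g | (∀ x y : V n, eta n ((g : Mat n) *ᵥ x) ((g : Mat n) *ᵥ y) = eta n x y) ∧
    (g : Mat n).det = 1}
  one_mem' := by simp
  mul_mem' := by
    rintro g h ⟨hg, hg1⟩ ⟨hh, hh1⟩
    refine ⟨fun x y => ?_, by simp [hg1, hh1]⟩
    simp only [Units.val_mul, ← Matrix.mulVec_mulVec, hg, hh]
  inv_mem' := by
    rintro g ⟨hg, hg1⟩
    have key : ∀ x : V n, (g : Mat n) *ᵥ (((g⁻¹ : GL (Fin (n + 2)) ℝ) : Mat n) *ᵥ x) = x := by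
      intro x
      rw [Matrix.mulVec_mulVec, ← Units.val_mul, mul_inv_cancel, Units.val_one,
        Matrix.one_mulVec]
    refine ⟨fun x y => ?_, ?_⟩
    · rw [← hg, key, key]
    · have h : ((g : Mat n) * ((g⁻¹ : GL (Fin (n + 2)) ℝ) : Mat n)).det = 1 := by
        rw [← Units.val_mul, mul_inv_cancel, Units.val_one, Matrix.det_one]
      rwa [Matrix.det_mul, hg1, one_mul] at h

/-- The identity component `SO⁰(V)` of the topological group `SO(V)`. -/
def SO0 (n : ℕ) : Subgroup (SO n) := Subgroup.connectedComponentOfOne (SO n)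

variable {n : ℕ}

/-- The underlying matrix of an element of `SO(V)`. -/
def mat (g : SO n) : Mat n := ((g : GL (Fin (n + 2)) ℝ) : Mat n)

/-- The linear action of `SO(V)` on `V`. -/
def act (g : SO n) (x : V n) : V n := mat g *ᵥ x

theorem act_one (x : V n) : act (1 : SO n) x = x := by simp [act, mat]

theorem act_mul (g h : SO n) (x : V n) : act (g * h) x = act g (act h x) := by
  simp [act, mat, Matrix.mulVec_mulVec]

theorem act_inv_of (g : SO n) {x y : V n} (h : act g x = y) : act g⁻¹ y = x := by
  rw [← h, ← act_mul, inv_mul_cancel, act_one]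

theorem act_add (g : SO n) (x y : V n) : act g (x + y) = act g x + act g y := by
  simp [act, Matrix.mulVec_add]

theorem act_sub (g : SO n) (x y : V n) : act g (x - y) = act g x - act g y := by
  simp [act, Matrix.mulVec_sub]

theorem act_smul (g : SO n) (c : ℝ) (x : V n) : act g (c • x) = c • act g x := by
  simp [act, Matrix.mulVec_smul]

theorem act_sum (g : SO n) {ι : Type} (s : Finset ι) (f : ι → V n) :
    act g (∑ i ∈ s, f i) = ∑ i ∈ s, act g (f i) := by
  simp [act, Matrix.mulVec_sum]

/-- A connected (not necessarily closed) Lie subgroup of `SO(V)`: the subgroup generated by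
the exponentials of the elements of a Lie subalgebra `𝔤` of `𝔰𝔬(V)`, the Lie algebra of
`η`-skew-symmetric endomorphisms. -/
def IsConnectedLieSubgroup (G : Subgroup (SO n)) : Prop :=
  ∃ 𝔤 : Submodule ℝ (Mat n),
    (∀ X ∈ 𝔤, ∀ x y : V n, eta n (X *ᵥ x) y + eta n x (X *ᵥ y) = 0) ∧
    (∀ X ∈ 𝔤, ∀ Y ∈ 𝔤, X * Y - Y * X ∈ 𝔤) ∧
    G = Subgroup.closure {g : SO n | ∃ X ∈ 𝔤, mat g = NormedSpace.exp X}

/-- `G` acts on `L^{n+1}` and the action is transitive. -/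
def ActsTransitively (G : Subgroup (SO n)) : Prop :=
  (∀ g ∈ G, ∀ x ∈ lobSpace n, act g x ∈ lobSpace n) ∧
    ∀ x ∈ lobSpace n, ∀ y ∈ lobSpace n, ∃ g ∈ G, act g x = y

/-- `G` acts on `L^{n+1}` and the action is simply transitive. -/
def ActsSimplyTransitively (G : Subgroup (SO n)) : Prop :=
  (∀ g ∈ G, ∀ x ∈ lobSpace n, act g x ∈ lobSpace n) ∧
    ∀ x ∈ lobSpace n, ∀ y ∈ lobSpace n, ∃! g : SO n, g ∈ G ∧ act g x = y

/-- An isotropic line of `V`. -/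
def IsIsotropicLine (l : Submodule ℝ (V n)) : Prop :=
  ∃ v : V n, v ≠ 0 ∧ eta n v v = 0 ∧ l = Submodule.span ℝ {v}

/-- `G` preserves the subspace `l`. -/
def Preserves (G : Subgroup (SO n)) (l : Submodule ℝ (V n)) : Prop :=
  ∀ g ∈ G, ∀ x ∈ l, act g x ∈ l

/-- A basis `p, e_1, …, e_n, q` of `V` in which the Gram matrix of `η` is
`((0, 0, 1), (0, E_n, 0), (1, 0, 0))`. -/
structure NullBasis (n : ℕ) where
  /-- the underlying basis -/
  basis : Module.Basis (Unit ⊕ Fin n ⊕ Unit) ℝ (V n)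
  /-- the first vector `p` -/
  p : V n
  /-- the vectors `e_1, …, e_n` -/
  e : Fin n → V n
  /-- the last vector `q` -/
  q : V n
  basis_p : basis (Sum.inl ()) = p
  basis_e : ∀ i, basis (Sum.inr (Sum.inl i)) = e i
  basis_q : basis (Sum.inr (Sum.inr ())) = q
  eta_pp : eta n p p = 0
  eta_pe : ∀ i, eta n p (e i) = 0
  eta_pq : eta n p q = 1
  eta_ee : ∀ i j, eta n (e i) (e j) = if i = j then 1 else 0
  eta_eq : ∀ i, eta n (e i) q = 0
  eta_qq : eta n q q = 0

/-- Two linear automorphisms that agree on the basis are equal. -/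
theorem NullBasis.ext_act (b : NullBasis n) {g h : SO n} (hp : act g b.p = act h b.p)
    (he : ∀ i, act g (b.e i) = act h (b.e i)) (hq : act g b.q = act h b.q) : g = h := by
  have hm : Matrix.mulVecLin (mat g) = Matrix.mulVecLin (mat h) := by
    refine b.basis.ext fun i => ?_
    rcases i with _ | i | _
    · simpa [b.basis_p, act] using hp
    · simpa [b.basis_e, act] using he i
    · simpa [b.basis_q, act] using hq
  have hm2 : mat g = mat h := Matrix.toLin'.injective hm
  exact Subtype.ext (Units.ext hm2)

/-- The group `A` of the matrices `((a, 0, 0), (0, id, 0), (0, 0, 1/a))`, `a > 0`, with respect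
to the basis `p, e_1, …, e_n, q`. -/
def groupA (b : NullBasis n) : Subgroup (SO n) where
  carrier := {g | ∃ a : ℝ, 0 < a ∧ act g b.p = a • b.p ∧ (∀ i, act g (b.e i) = b.e i) ∧
    act g b.q = a⁻¹ • b.q}
  one_mem' := ⟨1, one_pos, by simp [act_one], by simp [act_one], by simp [act_one]⟩
  mul_mem' := by
    rintro g h ⟨a, ha, h1, h2, h3⟩ ⟨c, hc, k1, k2, k3⟩
    refine ⟨a * c, mul_pos ha hc, ?_, fun i => ?_, ?_⟩
    · rw [act_mul, k1, act_smul, h1, smul_smul, mul_comm]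
    · rw [act_mul, k2, h2]
    · rw [act_mul, k3, act_smul, h3, smul_smul, mul_inv, mul_comm]
  inv_mem' := by
    rintro g ⟨a, ha, h1, h2, h3⟩
    refine ⟨a⁻¹, inv_pos.2 ha, act_inv_of g ?_, fun i => act_inv_of g (h2 i), act_inv_of g ?_⟩
    · rw [act_smul, h1, smul_smul, inv_mul_cancel₀ ha.ne', one_smul]
    · rw [act_smul, h3, smul_smul, inv_inv, mul_inv_cancel₀ ha.ne', one_smul]

/-- The group `K` of the matrices `((1, 0, 0), (0, f, 0), (0, 0, 1))`, `f ∈ SO(E)`, with respect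
to the basis `p, e_1, …, e_n, q`, where `E` is spanned by `e_1, …, e_n`. -/
def groupK (b : NullBasis n) : Subgroup (SO n) where
  carrier := {g | ∃ f ∈ Matrix.specialOrthogonalGroup (Fin n) ℝ, act g b.p = b.p ∧
    (∀ j, act g (b.e j) = ∑ i, f i j • b.e i) ∧ act g b.q = b.q}
  one_mem' := ⟨1, one_mem _, by simp [act_one], by simp [act_one, Matrix.one_apply],
    by simp [act_one]⟩
  mul_mem' := by
    rintro g h ⟨f, hf, h1, h2, h3⟩ ⟨k, hk, k1, k2, k3⟩
    refine ⟨f * k, mul_mem hf hk, ?_, fun j => ?_, ?_⟩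
    · rw [act_mul, k1, h1]
    · simp only [act_mul, k2, act_sum, act_smul, h2, Finset.smul_sum, smul_smul,
        Matrix.mul_apply, Finset.sum_smul]
      rw [Finset.sum_comm]
      simp only [mul_comm]
    · rw [act_mul, k3, h3]
  inv_mem' := by
    rintro g ⟨f, hf, h1, h2, h3⟩
    refine ⟨fᵀ, ?_, act_inv_of g h1, fun j => act_inv_of g ?_, act_inv_of g h3⟩
    · rw [Matrix.mem_specialOrthogonalGroup_iff] at hf ⊢
      refine ⟨?_, by rw [Matrix.det_transpose]; exact hf.2⟩
      rw [Matrix.mem_orthogonalGroup_iff, Matrix.transpose_transpose]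
      exact (Matrix.mem_orthogonalGroup_iff' _ _).1 hf.1
    · have hff : f * fᵀ = 1 :=
        (Matrix.mem_orthogonalGroup_iff _ _).1 (Matrix.mem_specialOrthogonalGroup_iff.1 hf).1
      simp only [act_sum, act_smul, h2, Finset.smul_sum, smul_smul]
      rw [Finset.sum_comm]
      have : ∀ y : Fin n, ∑ x, (fᵀ x j * f y x) • b.e y
          = (1 : Matrix (Fin n) (Fin n) ℝ) y j • b.e y := by
        intro y
        rw [← hff, Matrix.mul_apply, Finset.sum_smul]
        simp only [mul_comm]
      simp only [this]
      simp [Matrix.one_apply]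

/-- The group `N` of the matrices `((1, -Xᵗ, -XᵗX/2), (0, id, X), (0, 0, 1))`, `X ∈ E`, with
respect to the basis `p, e_1, …, e_n, q`. -/
def groupN (b : NullBasis n) : Subgroup (SO n) where
  carrier := {g | ∃ X : Fin n → ℝ, act g b.p = b.p ∧
    (∀ i, act g (b.e i) = b.e i - X i • b.p) ∧
    act g b.q = b.q + ∑ i, X i • b.e i - ((1 / 2 : ℝ) * ∑ i, X i * X i) • b.p}
  one_mem' := ⟨0, by simp [act_one], by simp [act_one], by simp [act_one]⟩
  mul_mem' := by
    rintro g h ⟨X, h1, h2, h3⟩ ⟨Y, k1, k2, k3⟩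
    refine ⟨X + Y, ?_, fun i => ?_, ?_⟩
    · rw [act_mul, k1, h1]
    · rw [act_mul, k2, act_sub, act_smul, h1, h2, Pi.add_apply, add_smul]
      abel
    · rw [act_mul, k3, act_sub, act_add, act_sum, h3, act_smul, h1]
      have e1 : ∀ i, act g (Y i • b.e i) = Y i • b.e i - (X i * Y i) • b.p := by
        intro i
        rw [act_smul, h2, smul_sub, smul_smul, mul_comm]
      have e2 : ∑ i, (X + Y) i * (X + Y) i
          = ∑ i, X i * X i + 2 * ∑ i, X i * Y i + ∑ i, Y i * Y i := by
        rw [Finset.mul_sum, ← Finset.sum_add_distrib, ← Finset.sum_add_distrib]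
        exact Finset.sum_congr rfl fun i _ => by simp only [Pi.add_apply]; ring
      have e3 : ∑ i, (X + Y) i • b.e i = ∑ i, X i • b.e i + ∑ i, Y i • b.e i := by
        rw [← Finset.sum_add_distrib]
        exact Finset.sum_congr rfl fun i _ => by rw [Pi.add_apply, add_smul]
      rw [Finset.sum_congr rfl fun i _ => e1 i, Finset.sum_sub_distrib, ← Finset.sum_smul,
        e2, e3]
      module
  inv_mem' := by
    rintro g ⟨X, h1, h2, h3⟩
    refine ⟨-X, act_inv_of g h1, fun i => act_inv_of g ?_, act_inv_of g ?_⟩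
    · rw [act_sub, act_smul, h1, h2, Pi.neg_apply]
      module
    · rw [act_sub, act_add, act_sum, h3, act_smul, h1]
      have e1 : ∀ i, act g ((-X) i • b.e i) = (X i * X i) • b.p - X i • b.e i := by
        intro i
        rw [act_smul, h2, Pi.neg_apply]
        module
      have e2 : ∑ i, (-X) i * (-X) i = ∑ i, X i * X i :=
        Finset.sum_congr rfl fun i _ => by simp only [Pi.neg_apply]; ring
      rw [Finset.sum_congr rfl fun i _ => e1 i, Finset.sum_sub_distrib, ← Finset.sum_smul, e2]
      module

/-- The groups `A` and `K` commute. -/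
theorem groupA_commute_groupK (b : NullBasis n) {a k : SO n} (ha : a ∈ groupA b)
    (hk : k ∈ groupK b) : a * k = k * a := by
  obtain ⟨c, -, h1, h2, h3⟩ := ha
  obtain ⟨f, -, k1, k2, k3⟩ := hk
  refine b.ext_act ?_ (fun j => ?_) ?_
  · rw [act_mul, act_mul, k1, h1, act_smul, k1]
  · simp only [act_mul, h2, k2, act_sum, act_smul]
  · rw [act_mul, act_mul, k3, h3, act_smul, k3]

/-- The group `A^Φ = {Φ(a) · a : a ∈ A}` of a homomorphism `Φ : A → K`. -/
def groupAPhi (b : NullBasis n) (Φ : groupA b →* groupK b) : Subgroup (SO n) where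
  carrier := {g | ∃ a : groupA b, g = (Φ a : SO n) * (a : SO n)}
  one_mem' := ⟨1, by simp⟩
  mul_mem' := by
    rintro g h ⟨a, rfl⟩ ⟨c, rfl⟩
    refine ⟨a * c, ?_⟩
    have := groupA_commute_groupK b a.2 (Φ c).2
    simp only [map_mul, Subgroup.coe_mul, mul_assoc]
    rw [← mul_assoc (a : SO n), this, mul_assoc]
  inv_mem' := by
    rintro g ⟨a, rfl⟩
    refine ⟨a⁻¹, ?_⟩
    have := groupA_commute_groupK b a.2 (Φ a).2
    rw [← this, mul_inv_rev, map_inv, Subgroup.coe_inv, Subgroup.coe_inv]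

/-- `G = P × Q` as an internal direct product of subgroups. -/
structure IsDirectProduct {S : Type} [Group S] (G P Q : Subgroup S) : Prop where
  commute : ∀ x ∈ P, ∀ y ∈ Q, x * y = y * x
  disjoint : P ⊓ Q = ⊥
  generate : P ⊔ Q = G

/-- `G = Q ⋉ N` as an internal semidirect product of subgroups, with `N` normal in `G`. -/
structure IsSemidirectProduct {S : Type} [Group S] (G Q N : Subgroup S) : Prop where
  normal : ∀ g ∈ G, ∀ x ∈ N, g * x * g⁻¹ ∈ N
  disjoint : Q ⊓ N = ⊥
  generate : Q ⊔ N = G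

/-- `G = (P × H) ⋉ N` as internal products of subgroups. -/
def IsProductForm {S : Type} [Group S] (G P H N : Subgroup S) : Prop :=
  ∃ M : Subgroup S, IsDirectProduct M P H ∧ IsSemidirectProduct G M N

end Lobachevsky

end

open Lobachevsky

open scoped Matrix
open Filter Topology

noncomputable section

namespace Lobachevsky

variable {n : ℕ}

/-! ### The Minkowski form -/

/-! Let G be generated by exp 𝔤, and write a ∧ b for the skew map `wedge a b`. The engine of the
proof is a loxodromic element g of G: one that scales two null vectors p, q with η(p, q) = 1 by a
and 1/a, where |a| > 1 (`ActsTransitively.exists_loxodromic`). If G preserves a line, some element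
scales it by a factor other than ±1, since otherwise the square of a nonzero linear form would be
constant on L. If not, G is irreducible, and a compactness argument with limits of g_k / ‖g_k‖ shows
that its traces are unbounded. A large trace forces an eigenvalue off the unit circle, and the
Lorentzian signature then gives a real eigenvector.

Since g normalizes 𝔤, rescaled conjugates a⁻ᵏ gᵏ X g⁻ᵏ stay in 𝔤. Along times at which the
rotational part of g nearly returns, they converge to p ∧ u, where u is the component of X q in E =
{p, q}^⊥ (`wedge_horoPart_mem`). The same holds with p and q exchanged. Let E_p and E_q be the
spaces of u in E with p ∧ u, respectively q ∧ u, in 𝔤. Then ⟨p, q⟩ + E_p + E_q is invariant and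
contains the timelike p - q, so it is V. If E_p and E_q are both nonzero, brackets give E_p = E_q =
E and 𝔤 = 𝔰𝔬(V). If one of them vanishes, say E_q, then E_p = E and 𝔤 preserves ℝp
(`lie_algebra_of_transitive`).

In the parabolic case 𝔤 = ℝZ + 𝔥 + p ∧ E, where 𝔥 kills p and q, while Z p = p and Z q = -q. The
trace form is negative definite on 𝔥, so ad Z acts on 𝔥 as an inner derivation, and Z can be
corrected to commute with 𝔥 (`exists_sub_centralizes`). Then Z = q ∧ p + B with B a rotational
generator, and exponentiating gives (A^Φ × H) ⋉ N with Φ(a) = exp(log a · B)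
(`isProductForm_expClosure`); B = 0 gives the untwisted group. If 𝔤 = 𝔰𝔬(V), a local logarithm
identifies G with the identity component.

For simple transitivity, H and the rotations about p - q fix a timelike vector, which forces H = 1
and excludes 𝔰𝔬(V) in the case E ≠ 0. Conversely, η(p, ·) and the η(e_i, ·) are coordinates on L;
A^Φ adjusts the first and N translates the others. Such a group is a connected Lie subgroup because
a continuous Φ is given by a one-parameter group of matrices, hence by an exponential
(`exists_eq_phiHom`). -/

theorem eta_comm (x y : V n) : eta n x y = eta n y x := by
  simp only [eta_apply, mul_comm]

theorem eta_isSymm (n : ℕ) : (eta n).IsSymm := ⟨fun x y => eta_comm x y⟩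

theorem eta_eq_dotProduct (x y : V n) : eta n x y = (gram n *ᵥ x) ⬝ᵥ y := by
  rw [eta_comm, eta, Matrix.toBilin'_apply', dotProduct_comm]

theorem gram_mul_self (n : ℕ) : gram n * gram n = 1 := by
  rw [gram, Matrix.diagonal_mul_diagonal, ← Matrix.diagonal_one]
  congr 1
  funext i
  refine Fin.cases ?_ (fun i => ?_) i <;> simp

theorem eq_of_eta {x y : V n} (h : ∀ z, eta n x z = eta n y z) : x = y := by
  have h1 : gram n *ᵥ x = gram n *ᵥ y :=
    dotProduct_eq _ _ fun z => by rw [← eta_eq_dotProduct, ← eta_eq_dotProduct, h]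
  have := congrArg (gram n *ᵥ ·) h1
  simpa [Matrix.mulVec_mulVec, gram_mul_self] using this

theorem eta_nondegenerate (n : ℕ) : (eta n).Nondegenerate := by
  refine ⟨fun x hx => eq_of_eta fun z => by simp [hx z],
    fun x hx => eq_of_eta fun z => by rw [eta_comm, hx z]; simp⟩

/-- η is positive definite on the hyperplane x₀ = 0. -/
theorem eq_zero_of_eta_self {x : V n} (h0 : x 0 = 0) (h : eta n x x ≤ 0) : x = 0 := by
  rw [eta_apply, h0] at h
  have h2 : ∑ i : Fin (n + 1), x i.succ * x i.succ = 0 :=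
    le_antisymm (by linarith) (Finset.sum_nonneg fun i _ => mul_self_nonneg _)
  rw [Finset.sum_eq_zero_iff_of_nonneg fun i _ => mul_self_nonneg _] at h2
  funext i
  refine Fin.cases h0 (fun i => ?_) i
  simpa using h2 i (Finset.mem_univ _)

/-- A vector orthogonal to a nonzero isotropic vector `p` is either spacelike or a multiple of
`p`. -/
theorem exists_smul_of_eta_self {p x : V n} (hp : p ≠ 0) (hpp : eta n p p = 0)
    (hpx : eta n p x = 0) (hxx : eta n x x ≤ 0) : ∃ c : ℝ, x = c • p := by
  have hp0 : p 0 ≠ 0 := fun h => hp (eq_zero_of_eta_self h hpp.le)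
  -- Subtracting this multiple of p cancels the time coordinate and leaves η(x, x) unchanged.
  refine ⟨x 0 / p 0, sub_eq_zero.1 (eq_zero_of_eta_self ?_ ?_)⟩
  · simp [hp0]
  · simpa [hpp, hpx, eta_comm x p] using hxx

/-- The base point of Lobachevskian space. -/
def basePoint (n : ℕ) : V n := Pi.single 0 1

theorem basePoint_mem : basePoint n ∈ lobSpace n := by
  refine ⟨?_, by simp [basePoint]⟩
  simp [eta_apply, basePoint]

/-- A point of Lobachevskian space in the plane spanned by the time axis and a space axis. -/
def hyperbolaPoint (i : Fin (n + 1)) (s : ℝ) : V n :=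
  Pi.single 0 (√(1 + s ^ 2)) + Pi.single i.succ s

theorem hyperbolaPoint_mem (i : Fin (n + 1)) (s : ℝ) : hyperbolaPoint i s ∈ lobSpace n := by
  have h1 : (0 : ℝ) < 1 + s ^ 2 := by positivity
  constructor
  · rw [eta_apply]
    simp only [hyperbolaPoint, Pi.add_apply, Pi.single_eq_same, Fin.succ_ne_zero, ne_eq,
      not_false_eq_true, Pi.single_eq_of_ne, Pi.single_eq_of_ne' , add_zero, zero_add]
    rw [Finset.sum_eq_single i]
    · simp only [Pi.single_eq_same]
      rw [Real.mul_self_sqrt h1.le]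
      ring
    · intro j _ hj
      rw [Pi.single_eq_of_ne (by simpa using hj)]
      simp
    · simp
  · simp [hyperbolaPoint, h1]

/-- A linear form whose square is constant on Lobachevskian space vanishes. -/
theorem eq_zero_of_sq_const_on_lobSpace (φ : V n →ₗ[ℝ] ℝ) (c : ℝ)
    (h : ∀ x ∈ lobSpace n, φ x ^ 2 = c) : φ = 0 := by
  set a : Fin (n + 2) → ℝ := fun i => φ (Pi.single i 1) with ha
  have hs : ∀ i (s : ℝ), φ (Pi.single i s) = s * a i := by
    intro i s
    rw [ha, ← smul_eq_mul, ← map_smul]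
    congr 1
    rw [← Pi.single_smul, smul_eq_mul, mul_one]
  have key : ∀ i : Fin (n + 1), a 0 = 0 ∧ a i.succ = 0 := by
    intro i
    -- Three points suffice: if a₀² and (√2 a₀ ± a_i)² all equal c, then adding the last two gives
    -- a₀² + a_i² = 0.
    have e0 := h _ basePoint_mem
    have e1 := h _ (hyperbolaPoint_mem i 1)
    have e2 := h _ (hyperbolaPoint_mem i (-1))
    rw [basePoint, hs] at e0
    rw [hyperbolaPoint, map_add, hs, hs] at e1 e2
    have h2 : √(1 + (1 : ℝ) ^ 2) ^ 2 = 2 := by rw [Real.sq_sqrt] <;> norm_num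
    rw [show (1 : ℝ) + (-1) ^ 2 = 1 + 1 ^ 2 by norm_num] at e2
    set r := √(1 + (1 : ℝ) ^ 2)
    have e3 : a 0 ^ 2 + a i.succ ^ 2 = 0 := by
      have : (r * a 0 + 1 * a i.succ) ^ 2 + (r * a 0 + -1 * a i.succ) ^ 2
        = 2 * r ^ 2 * a 0 ^ 2 + 2 * a i.succ ^ 2 := by ring
      rw [h2] at this
      linarith
    constructor <;> nlinarith [sq_nonneg (a 0), sq_nonneg (a i.succ)]
  refine LinearMap.pi_ext fun i s => ?_
  rw [hs]
  refine Fin.cases ?_ (fun i => ?_) i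
  · simp [(key 0).1]
  · simp [(key i).2]

/-- Used to show that a transitive group cannot send a nonzero p only to ±p. -/
theorem eq_zero_of_eta_sq_const {p : V n} {c : ℝ} (h : ∀ x ∈ lobSpace n, eta n x p ^ 2 = c) :
    p = 0 := by
  have := eq_zero_of_sq_const_on_lobSpace (eta n p) c fun x hx => by rw [eta_comm, h x hx]
  exact eq_of_eta fun z => by rw [this]; simp

theorem eq_top_of_lobSpace_subset {W : Submodule ℝ (V n)} (h : lobSpace n ⊆ W) : W = ⊤ := by
  by_contra hW
  obtain ⟨x, hx⟩ : ∃ x, x ∉ W := by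
    by_contra! hx
    exact hW (eq_top_iff.2 fun x _ => hx x)
  obtain ⟨φ, hφ, hφW⟩ := Submodule.exists_dual_map_eq_bot_of_notMem hx inferInstance
  refine hφ ?_
  rw [eq_zero_of_sq_const_on_lobSpace φ 0 fun y hy => ?_]
  · simp
  · have : φ y ∈ W.map φ := ⟨y, h hy, rfl⟩
    rw [hφW, Submodule.mem_bot] at this
    simp [this]

/-! ### The group action -/

theorem eta_act (g : SO n) (x y : V n) : eta n (act g x) (act g y) = eta n x y := g.2.1 x y

theorem act_inv_act (g : SO n) (x : V n) : act g⁻¹ (act g x) = x := by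
  rw [← act_mul, inv_mul_cancel, act_one]

theorem act_act_inv (g : SO n) (x : V n) : act g (act g⁻¹ x) = x := by
  rw [← act_mul, mul_inv_cancel, act_one]

theorem eta_act_left (g : SO n) (x y : V n) : eta n (act g x) y = eta n x (act g⁻¹ y) := by
  rw [← eta_act g x, act_act_inv]

theorem act_zero (g : SO n) : act g (0 : V n) = 0 := by simp [act]

theorem mat_mul (g h : SO n) : mat (g * h) = mat g * mat h := rfl

theorem mat_one : mat (1 : SO n) = 1 := rfl

theorem mat_injective : Function.Injective (mat : SO n → Mat n) := fun _ _ h =>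
  Subtype.ext (Units.ext h)

theorem mat_mul_mat_inv (g : SO n) : mat g * mat g⁻¹ = 1 := by
  rw [← mat_mul, mul_inv_cancel, mat_one]

theorem mat_inv_mul_mat (g : SO n) : mat g⁻¹ * mat g = 1 := by
  rw [← mat_mul, inv_mul_cancel, mat_one]

theorem ext_act {g h : SO n} (H : ∀ x, act g x = act h x) : g = h :=
  mat_injective (Matrix.ext_of_mulVec_single fun _ => H _)

/-- Every timelike line meets Lobachevskian space. -/
theorem exists_smul_mem_lobSpace {x : V n} (hxx : eta n x x < 0) : ∃ c : ℝ, c • x ∈ lobSpace n := by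
  have hx0 : x 0 ≠ 0 := by
    intro h0
    rw [eta_apply, h0] at hxx
    have : 0 ≤ ∑ i : Fin (n + 1), x i.succ * x i.succ :=
      Finset.sum_nonneg fun i _ => mul_self_nonneg _
    linarith
  have hs : √(-eta n x x) * √(-eta n x x) = -eta n x x := Real.mul_self_sqrt (by linarith)
  have hs0 : 0 < √(-eta n x x) := Real.sqrt_pos.2 (by linarith)
  set s := √(-eta n x x)
  have e : ∀ c : ℝ, c * c = 1 → 0 < c * x 0 → ∃ c : ℝ, c • x ∈ lobSpace n := by
    intro c hc hc0
    refine ⟨c / s, ?_, ?_⟩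
    · simp only [map_smul, LinearMap.smul_apply, smul_eq_mul]
      field_simp
      nlinarith
    · simp only [Pi.smul_apply, smul_eq_mul]
      rw [div_mul_eq_mul_div]
      positivity
  rcases lt_or_gt_of_ne hx0 with h | h
  · exact e (-1) (by norm_num) (by linarith)
  · exact e 1 (by norm_num) (by linarith)

/-- A subspace preserved by a transitive group that contains a timelike vector is everything. -/
theorem ActsTransitively.eq_top {G : Subgroup (SO n)} (hG : ActsTransitively G)
    {W : Submodule ℝ (V n)} (hW : Preserves G W) {x : V n} (hx : x ∈ W) (hxx : eta n x x < 0) :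
    W = ⊤ := by
  obtain ⟨c, hc⟩ := exists_smul_mem_lobSpace hxx
  refine eq_top_of_lobSpace_subset fun z hz => ?_
  obtain ⟨g, hg, rfl⟩ := hG.2 _ hc z hz
  exact hW g hg _ (W.smul_mem c hx)

/-! ### Skew endomorphisms and wedges -/

/-- The `η`-skew-symmetric endomorphisms, that is, the elements of `𝔰𝔬(V)`. -/
def IsSkew (X : Mat n) : Prop := ∀ x y : V n, eta n (X *ᵥ x) y + eta n x (X *ᵥ y) = 0

theorem IsSkew.eta_left {X : Mat n} (h : IsSkew X) (x y : V n) :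
    eta n (X *ᵥ x) y = - eta n x (X *ᵥ y) := by linarith [h x y]

theorem IsSkew.eta_self {X : Mat n} (h : IsSkew X) (x : V n) : eta n (X *ᵥ x) x = 0 := by
  have := h x x
  rw [eta_comm x] at this
  linarith

theorem IsSkew.add {X Y : Mat n} (hX : IsSkew X) (hY : IsSkew Y) : IsSkew (X + Y) := fun x y => by
  simp only [Matrix.add_mulVec, map_add, LinearMap.add_apply]
  linarith [hX x y, hY x y]

theorem IsSkew.smul {X : Mat n} (hX : IsSkew X) (c : ℝ) : IsSkew (c • X) := fun x y => by
  simp only [Matrix.smul_mulVec, map_smul, LinearMap.smul_apply, smul_eq_mul]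
  linear_combination c * hX x y

theorem IsSkew.neg {X : Mat n} (hX : IsSkew X) : IsSkew (-X) := by
  simpa using hX.smul (-1)

theorem IsSkew.sub {X Y : Mat n} (hX : IsSkew X) (hY : IsSkew Y) : IsSkew (X - Y) := by
  simpa [sub_eq_add_neg] using hX.add hY.neg

theorem IsSkew.zero : IsSkew (0 : Mat n) := fun x y => by simp

/-- The skew endomorphism `x ↦ η(a, x) b - η(b, x) a`. -/
def wedge (a b : V n) : Mat n :=
  Matrix.vecMulVec b (gram n *ᵥ a) - Matrix.vecMulVec a (gram n *ᵥ b)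

theorem wedge_mulVec (a b x : V n) : wedge a b *ᵥ x = eta n a x • b - eta n b x • a := by
  rw [wedge, Matrix.sub_mulVec, Matrix.vecMulVec_mulVec, Matrix.vecMulVec_mulVec,
    eta_eq_dotProduct, eta_eq_dotProduct]
  simp

theorem mat_ext {X Y : Mat n} (h : ∀ x, X *ᵥ x = Y *ᵥ x) : X = Y :=
  Matrix.ext_of_mulVec_single fun _ => h _

theorem wedge_isSkew (a b : V n) : IsSkew (wedge a b) := fun x y => by
  simp only [wedge_mulVec, map_sub, map_smul, LinearMap.sub_apply, LinearMap.smul_apply,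
    smul_eq_mul, eta_comm x]
  ring

theorem wedge_swap (a b : V n) : wedge a b = - wedge b a := by simp [wedge]

theorem wedge_add_right (a b c : V n) : wedge a (b + c) = wedge a b + wedge a c :=
  mat_ext fun x => by
    simp only [wedge_mulVec, Matrix.add_mulVec, map_add, LinearMap.add_apply]
    module

theorem wedge_smul_right (a b : V n) (c : ℝ) : wedge a (c • b) = c • wedge a b :=
  mat_ext fun x => by
    simp only [wedge_mulVec, Matrix.smul_mulVec, map_smul, LinearMap.smul_apply, smul_eq_mul]
    module

theorem wedge_smul_left (a b : V n) (c : ℝ) : wedge (c • a) b = c • wedge a b := by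
  rw [wedge_swap, wedge_smul_right, wedge_swap a, smul_neg]

theorem wedge_zero_right (a : V n) : wedge a 0 = 0 := by simpa using wedge_smul_right a 0 0

/-- The map `b ↦ wedge a b` as a linear map. -/
def wedgeRight (a : V n) : V n →ₗ[ℝ] Mat n where
  toFun := wedge a
  map_add' := wedge_add_right a
  map_smul' c b := wedge_smul_right a b c

/-- With 𝔰𝔬(V) identified with Λ²V, the adjoint action is the natural action by derivations;
`mat_mul_wedge` is the group version. -/
theorem IsSkew.commutator_wedge {X : Mat n} (hX : IsSkew X) (a b : V n) :
    X * wedge a b - wedge a b * X = wedge (X *ᵥ a) b + wedge a (X *ᵥ b) :=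
  mat_ext fun x => by
    simp only [Matrix.sub_mulVec, ← Matrix.mulVec_mulVec, wedge_mulVec, Matrix.add_mulVec,
      Matrix.mulVec_sub, Matrix.mulVec_smul, hX.eta_left]
    module

theorem mat_mul_wedge (g : SO n) (a b : V n) :
    mat g * wedge a b * mat g⁻¹ = wedge (act g a) (act g b) :=
  mat_ext fun x => by
    simp only [← Matrix.mulVec_mulVec, wedge_mulVec, Matrix.mulVec_sub, Matrix.mulVec_smul]
    simp only [eta_act_left]
    rfl

/-! ### Null pairs and null bases -/

/-- Two isotropic vectors with `η(p, q) = 1`. -/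
structure IsNullPair (p q : V n) : Prop where
  pp : eta n p p = 0
  qq : eta n q q = 0
  pq : eta n p q = 1

namespace IsNullPair

variable {p q : V n} (h : IsNullPair p q)
include h

theorem qp : eta n q p = 1 := by rw [eta_comm, h.pq]

theorem symm : IsNullPair q p := ⟨h.qq, h.pp, h.qp⟩

theorem left_ne_zero : p ≠ 0 := by
  rintro rfl
  simpa using h.pq

theorem eta_self_nonneg {x : V n} (hp : eta n p x = 0) : 0 ≤ eta n x x := by
  by_contra! hx
  obtain ⟨c, rfl⟩ := exists_smul_of_eta_self h.left_ne_zero h.pp hp hx.le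
  simp [h.pp] at hx

theorem eq_zero_of_eta_self {x : V n} (hp : eta n p x = 0) (hq : eta n q x = 0)
    (hx : eta n x x = 0) : x = 0 := by
  obtain ⟨c, rfl⟩ := exists_smul_of_eta_self h.left_ne_zero h.pp hp hx.le
  simp only [map_smul, h.qp, smul_eq_mul, mul_one] at hq
  simp [hq]

end IsNullPair

/-- η is positive definite on {p, q}^⊥, so an orthogonal basis of this complement can be normalized.
-/
theorem exists_nullBasis {p q : V n} (h : IsNullPair p q) :
    ∃ b : NullBasis n, b.p = p ∧ b.q = q := by
  set S : Submodule ℝ (V n) := Submodule.span ℝ {p, q} with hS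
  set E := (eta n).orthogonal S with hE
  have hEp : ∀ x ∈ E, eta n p x = 0 ∧ eta n q x = 0 := fun x hx =>
    ⟨hx p (Submodule.subset_span (by simp)), hx q (Submodule.subset_span (by simp))⟩
  have hli : LinearIndependent ℝ ![p, q] := by
    rw [LinearIndependent.pair_iff]
    intro s t hst
    have h1 := congrArg (eta n p) hst
    have h2 := congrArg (eta n q) hst
    simp [h.pp, h.pq] at h1
    simp [h.qp, h.qq] at h2
    exact ⟨h2, h1⟩
  have hfS : Module.finrank ℝ S = 2 := by
    have := finrank_span_eq_card hli
    rw [Matrix.range_cons_cons_empty] at this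
    simpa [hS] using this
  have hfE : Module.finrank ℝ E = n := by
    rw [hE, LinearMap.BilinForm.finrank_orthogonal (eta_nondegenerate n), hfS]
    simp
  let _ : Invertible (2 : ℝ) := invertibleOfNonzero two_ne_zero
  obtain ⟨v, hv⟩ := LinearMap.BilinForm.exists_orthogonal_basis (B := (eta n).restrict E)
    ⟨fun x y => eta_comm _ _⟩
  set v' := v.reindex (finCongr hfE)
  have hv' : ∀ i j, i ≠ j → eta n (v' i : V n) (v' j) = 0 := by
    intro i j hij
    have := hv (i := (finCongr hfE).symm i) (j := (finCongr hfE).symm j) (by simpa using hij)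
    simpa [v'] using this
  have hpos : ∀ i, 0 < eta n (v' i : V n) (v' i) := by
    intro i
    have hi := hEp _ (v' i).2
    refine lt_of_le_of_ne (h.eta_self_nonneg hi.1) fun h0 => ?_
    exact v'.ne_zero i (Subtype.ext (h.eq_zero_of_eta_self hi.1 hi.2 h0.symm))
  set e : Fin n → V n := fun i => (√(eta n (v' i : V n) (v' i)))⁻¹ • (v' i : V n) with he
  have hee : ∀ i j, eta n (e i) (e j) = if i = j then 1 else 0 := by
    intro i j
    split_ifs with hij
    · subst hij
      have h1 := Real.mul_self_sqrt (hpos i).le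
      have h2 := Real.sqrt_pos.2 (hpos i)
      simp only [he, map_smul, LinearMap.smul_apply, smul_eq_mul]
      field_simp
      nlinarith
    · simp [he, hv' i j hij]
  have hpe : ∀ i, eta n p (e i) = 0 := fun i => by simp [he, (hEp _ (v' i).2).1]
  have hqe : ∀ i, eta n q (e i) = 0 := fun i => by simp [he, (hEp _ (v' i).2).2]
  set f : Unit ⊕ Fin n ⊕ Unit → V n := Sum.elim (fun _ => p) (Sum.elim e fun _ => q) with hf
  have hfl : LinearIndependent ℝ f := by
    rw [Fintype.linearIndependent_iff]
    intro g hg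
    have key : ∀ x, ∑ i, g i * eta n x (f i) = 0 := by
      intro x
      have := congrArg (eta n x) hg
      simpa using this
    simp only [Fintype.sum_sum_type, hf, Sum.elim_inl, Sum.elim_inr, Finset.univ_unique,
      Finset.sum_singleton] at key
    have k1 := key p
    have k2 := key q
    simp [h.pp, h.pq, hpe, hqe, h.qq, h.qp] at k1 k2
    rintro (_ | i | _)
    · exact k2
    · have k3 := key (e i)
      simpa [hee, eta_comm (e i), hpe, hqe] using k3
    · exact k1
  have hcard : Fintype.card (Unit ⊕ Fin n ⊕ Unit) = Module.finrank ℝ (V n) := by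
    simp
    omega
  refine ⟨⟨basisOfLinearIndependentOfCardEqFinrank hfl hcard, p, e, q, ?_, ?_, ?_, h.pp, hpe, h.pq,
    hee, fun i => by rw [eta_comm, hqe], h.qq⟩, rfl, rfl⟩ <;> simp [hf]

namespace NullBasis

variable (b : NullBasis n)

theorem isNullPair : IsNullPair b.p b.q := ⟨b.eta_pp, b.eta_qq, b.eta_pq⟩

theorem eta_qe (i : Fin n) : eta n b.q (b.e i) = 0 := by rw [eta_comm, b.eta_eq]

theorem eta_ep (i : Fin n) : eta n (b.e i) b.p = 0 := by rw [eta_comm, b.eta_pe]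

theorem mulVec_ext {X Y : Mat n} (hp : X *ᵥ b.p = Y *ᵥ b.p) (he : ∀ i, X *ᵥ b.e i = Y *ᵥ b.e i)
    (hq : X *ᵥ b.q = Y *ᵥ b.q) : X = Y := by
  refine Matrix.toLin'.injective (b.basis.ext fun i => ?_)
  rcases i with _ | i | _
  · simpa [b.basis_p] using hp
  · simpa [b.basis_e] using he i
  · simpa [b.basis_q] using hq

theorem expand (x : V n) :
    x = eta n b.q x • b.p + ∑ i, eta n (b.e i) x • b.e i + eta n b.p x • b.q := by
  have h := b.basis.sum_repr x
  simp only [Fintype.sum_sum_type, b.basis_p, b.basis_e, b.basis_q, Finset.univ_unique,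
    Finset.sum_singleton, PUnit.default_eq_unit] at h
  have h1 := congrArg (eta n b.p) h
  have h2 := congrArg (eta n b.q) h
  have h3 := fun i => congrArg (eta n (b.e i)) h
  simp [b.eta_pp, b.eta_pq, b.eta_pe, b.eta_qe, b.eta_qq, b.isNullPair.qp, b.eta_ee, b.eta_eq,
    b.eta_ep] at h1 h2 h3
  rw [← h1, ← h2]
  simp only [← h3]
  rw [add_assoc, h]

theorem eta_self (x : V n) :
    eta n x x = 2 * eta n b.p x * eta n b.q x + ∑ i, eta n (b.e i) x ^ 2 := by
  have h := congrArg (eta n x) (b.expand x)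
  simp only [map_add, map_smul, map_sum, smul_eq_mul, eta_comm x, LinearMap.add_apply,
    LinearMap.smul_apply, LinearMap.sum_apply] at h
  rw [h, Finset.sum_congr rfl fun i _ => (pow_two _).symm]
  ring

/-- The orthogonal complement `E` of `p` and `q` is spanned by the `e_i`. -/
theorem expand_of_orthogonal {x : V n} (hp : eta n b.p x = 0) (hq : eta n b.q x = 0) :
    x = ∑ i, eta n (b.e i) x • b.e i := by
  conv_lhs => rw [b.expand x]
  simp [hp, hq]

theorem eta_ext {x y : V n} (hp : eta n b.p x = eta n b.p y) (hq : eta n b.q x = eta n b.q y)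
    (he : ∀ i, eta n (b.e i) x = eta n (b.e i) y) : x = y := by
  rw [b.expand x, b.expand y, hp, hq]
  simp only [he]

end NullBasis

/-! ### Loxodromic elements -/

/-- An eigenvector whose eigenvalue is not of modulus one is isotropic, and has an isotropic
partner. -/
theorem exists_nullPair_of_eigenvector {g : SO n} {p : V n} (hp : p ≠ 0) {a : ℝ}
    (ha : a ^ 2 ≠ 1) (hgp : act g p = a • p) :
    ∃ q, IsNullPair p q ∧ act g q = a⁻¹ • q := by
  have ha0 : a ≠ 0 := by
    rintro rfl
    rw [zero_smul] at hgp
    exact hp (by rw [← act_inv_act g p, hgp, act_zero])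
  have hiso : ∀ (c : ℝ) (x : V n), c ^ 2 ≠ 1 → act g x = c • x → eta n x x = 0 := by
    intro c x hc hx
    have h := eta_act g x x
    rw [hx] at h
    simp only [map_smul, LinearMap.smul_apply, smul_eq_mul] at h
    have : (c ^ 2 - 1) * eta n x x = 0 := by linear_combination h
    exact (mul_eq_zero.1 this).resolve_left (sub_ne_zero.2 hc)
  have hdet : (mat g - a • (1 : Mat n)).det = 0 :=
    Matrix.exists_mulVec_eq_zero_iff.1 ⟨p, hp, by
      rw [Matrix.sub_mulVec, Matrix.smul_mulVec, Matrix.one_mulVec]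
      exact sub_eq_zero.2 hgp⟩
  obtain ⟨y, hy, hyg⟩ := Matrix.exists_vecMul_eq_zero_iff.2 hdet
  set z := gram n *ᵥ y with hz
  have hzy : gram n *ᵥ z = y := by rw [hz, Matrix.mulVec_mulVec, gram_mul_self, Matrix.one_mulVec]
  have hz0 : z ≠ 0 := by
    intro h
    rw [h, Matrix.mulVec_zero] at hzy
    exact hy hzy.symm
  have hginv : act g⁻¹ z = a • z := by
    refine eq_of_eta fun x => ?_
    rw [eta_act_left, inv_inv]
    have h1 : y ⬝ᵥ ((mat g - a • (1 : Mat n)) *ᵥ x) = 0 := by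
      rw [Matrix.dotProduct_mulVec, hyg, zero_dotProduct]
    rw [Matrix.sub_mulVec, Matrix.smul_mulVec, Matrix.one_mulVec, ← hzy,
      ← eta_eq_dotProduct, map_sub, map_smul, sub_eq_zero] at h1
    rw [map_smul, LinearMap.smul_apply]
    exact h1
  have hgz : act g z = a⁻¹ • z := by
    have := act_act_inv g z
    rw [hginv, act_smul] at this
    rw [← this, smul_smul, inv_mul_cancel₀ ha0, one_smul, this]
  have hpp := hiso a p ha hgp
  have hzz := hiso a⁻¹ z (by simpa using ha) hgz
  -- Orthogonal null vectors are proportional, which would force a = a⁻¹.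
  have hpz : eta n p z ≠ 0 := by
    intro h
    obtain ⟨c, hc⟩ := exists_smul_of_eta_self hp hpp h hzz.le
    rw [hc, act_smul, hgp] at hgz
    have hc0 : c ≠ 0 := by
      rintro rfl
      exact hz0 (by simpa using hc)
    have h2 : (c * (a - a⁻¹)) • p = 0 := by
      rw [mul_sub, sub_smul, ← smul_smul, hgz]
      module
    have h3 := (mul_eq_zero.1 ((smul_eq_zero.1 h2).resolve_right hp)).resolve_left hc0
    apply ha
    field_simp at h3
    linarith
  refine ⟨(eta n p z)⁻¹ • z, ⟨hpp, by simp [hzz], by simp [hpz]⟩, ?_⟩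
  rw [act_smul, hgz, smul_comm]

/-- If all factors were ±1, then η(·, p)² would be constant on the single orbit L. -/
theorem exists_eigenvector_of_preserves_line {G : Subgroup (SO n)} (hG : ActsTransitively G)
    {p : V n} (hp : p ≠ 0) (hGp : Preserves G (Submodule.span ℝ {p})) :
    ∃ g ∈ G, ∃ a : ℝ, a ^ 2 ≠ 1 ∧ act g p = a • p := by
  by_contra! hcon
  refine hp (eq_zero_of_eta_sq_const (c := eta n (basePoint n) p ^ 2) fun x hx => ?_)
  obtain ⟨g, hg, rfl⟩ := hG.2 _ basePoint_mem _ hx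
  obtain ⟨a, ha⟩ := Submodule.mem_span_singleton.1
    (hGp g hg p (Submodule.mem_span_singleton_self p))
  have ha1 : a ^ 2 = 1 := by
    by_contra h
    exact hcon g hg a h ha.symm
  have := eta_act g (basePoint n) p
  rw [← ha, map_smul, smul_eq_mul] at this
  rw [← this, mul_pow, ha1, one_mul]

/-- A transitive group that preserves no isotropic line acts irreducibly. -/
theorem ActsTransitively.irreducible {G : Subgroup (SO n)} (hG : ActsTransitively G)
    (hline : ∀ p : V n, p ≠ 0 → eta n p p = 0 → ¬ Preserves G (Submodule.span ℝ {p}))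
    {W : Submodule ℝ (V n)} (hW : Preserves G W) (hW0 : W ≠ ⊥) : W = ⊤ := by
  set W' := (eta n).orthogonal W with hW'
  have hW'G : Preserves G W' := by
    intro g hg x hx y hy
    have h := hx (act g⁻¹ y) (hW _ (G.inv_mem hg) y hy)
    rw [eta_act_left, inv_inv] at h
    exact h
  -- A nonzero W ∩ W^⊥ is totally isotropic, so in this signature it is an invariant null line.
  have hdisj : W ⊓ W' = ⊥ := by
    by_contra hne
    obtain ⟨p, ⟨hpW, hpW'⟩, hp⟩ := Submodule.exists_mem_ne_zero_of_ne_bot hne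
    have hpp : eta n p p = 0 := hpW' p hpW
    refine hline p hp hpp fun g hg x hx => ?_
    obtain ⟨c, rfl⟩ := Submodule.mem_span_singleton.1 hx
    have h1 := hW g hg p hpW
    have h2 := hW'G g hg p hpW'
    obtain ⟨d, hd⟩ := exists_smul_of_eta_self hp hpp (h2 p hpW)  (h2 _ h1).le
    rw [act_smul, hd, smul_smul]
    exact Submodule.smul_mem _ _ (Submodule.mem_span_singleton_self p)
  have hcompl : IsCompl W W' :=
    (LinearMap.BilinForm.isCompl_orthogonal_iff_disjoint (eta_isSymm n).isRefl).2
      (disjoint_iff.2 hdisj)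
  -- Now V is the orthogonal sum of W and W^⊥, and one of the two components of a timelike vector is
  -- timelike.
  obtain ⟨w, hw, w', hw', hww⟩ := Submodule.mem_sup.1
    (hcompl.sup_eq_top.symm ▸ Submodule.mem_top : basePoint n ∈ W ⊔ W')
  have hsum : eta n w w + eta n w' w' = -1 := by
    have h0 : eta n w w' = 0 := hw' w hw
    have h1 := (basePoint_mem (n := n)).1
    rw [← hww] at h1
    simp only [map_add, LinearMap.add_apply, h0, eta_comm w' w] at h1
    linarith
  by_cases hneg : eta n w w < 0
  · exact hG.eq_top hW hw hneg
  · have := hG.eq_top hW'G hw' (by linarith)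
    rw [this, inf_top_eq] at hdisj
    exact absurd hdisj hW0

/-- An element of `SO(V)` whose trace exceeds `n + 2` in modulus has a real eigenvector with
eigenvalue not of modulus one. -/
theorem exists_eigenvector_of_trace {g : SO n} (hg : (n : ℝ) + 2 < |(mat g).trace|) :
    ∃ p : V n, p ≠ 0 ∧ ∃ a : ℝ, a ^ 2 ≠ 1 ∧ act g p = a • p := by
  set M : Matrix (Fin (n + 2)) (Fin (n + 2)) ℂ := (mat g).map Complex.ofRealHom with hM
  have htr : M.trace = ((mat g).trace : ℂ) := by
    simp [hM, Matrix.trace]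
  have hcard : Multiset.card M.charpoly.roots = n + 2 := by
    rw [Polynomial.splits_iff_card_roots.1 (IsAlgClosed.splits M.charpoly),
      Matrix.charpoly_natDegree_eq_dim, Fintype.card_fin]
  -- The trace is the sum of n + 2 complex eigenvalues, so they cannot all lie in the unit disc.
  obtain ⟨μ, hμ, hμ1⟩ : ∃ μ ∈ M.charpoly.roots, 1 < ‖μ‖ := by
    by_contra! hcon
    have h1 : ‖M.trace‖ ≤ n + 2 := by
      rw [Matrix.trace_eq_sum_roots_charpoly]
      refine (norm_multiset_sum_le _).trans ?_
      refine (Multiset.sum_le_card_nsmul _ 1 ?_).trans ?_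
      · intro x hx
        obtain ⟨μ, hμ, rfl⟩ := Multiset.mem_map.1 hx
        exact hcon μ hμ
      · rw [Multiset.card_map, hcard]
        simp
    rw [htr, Complex.norm_real, Real.norm_eq_abs] at h1
    linarith
  have hdet : (Matrix.scalar (Fin (n + 2)) μ - M).det = 0 := by
    rw [← Matrix.eval_charpoly]
    exact (Polynomial.mem_roots'.1 hμ).2
  obtain ⟨v, hv, hMv⟩ := Matrix.exists_mulVec_eq_zero_iff.2 hdet
  have hMv' : M *ᵥ v = μ • v := by
    rw [Matrix.sub_mulVec, sub_eq_zero] at hMv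
    rw [← hMv]
    simp
  set x : V n := fun i => (v i).re with hx
  set y : V n := fun i => (v i).im with hy
  have hgx : act g x = μ.re • x - μ.im • y := by
    funext i
    have := congrArg Complex.re (congrFun hMv' i)
    simpa [Matrix.mulVec, dotProduct, hM, act, hx, hy] using this
  have hgy : act g y = μ.im • x + μ.re • y := by
    funext i
    have := congrArg Complex.im (congrFun hMv' i)
    simp [Matrix.mulVec, dotProduct, hM] at this
    simp [act, Matrix.mulVec, dotProduct, hx, hy, this]
    ring
  have hμ2 : 1 < μ.re ^ 2 + μ.im ^ 2 := by
    have h1 : 1 < ‖μ‖ ^ 2 := by nlinarith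
    rw [Complex.sq_norm, Complex.normSq_apply] at h1
    linarith
  have e1 := eta_act g x x
  have e2 := eta_act g y y
  have e3 := eta_act g x y
  rw [hgx] at e1
  rw [hgy] at e2
  rw [hgx, hgy] at e3
  simp only [map_add, map_sub, map_smul, LinearMap.add_apply, LinearMap.sub_apply,
    LinearMap.smul_apply, smul_eq_mul, eta_comm y x] at e1 e2 e3
  set α := μ.re
  set β := μ.im
  set A := eta n x x
  set B := eta n y y
  set C := eta n x y
  have hm0 : α ^ 2 + β ^ 2 - 1 ≠ 0 := by linarith
  -- For the complex eigenvector v = x + iy, invariance gives |μ|² η(v, v̄) = η(v, v̄) and μ² η(v,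
  -- v) = η(v, v). Since |μ| > 1 both pairings vanish, so x and y are null and mutually orthogonal.
  have hAB : A + B = 0 := by
    refine (mul_eq_zero.1 (?_ : (α ^ 2 + β ^ 2 - 1) * (A + B) = 0)).resolve_left hm0
    linear_combination e1 + e2
  have hDE : (A - B) ^ 2 + (2 * C) ^ 2 = 0 := by
    have hm1 : (α ^ 2 + β ^ 2) ^ 2 - 1 ≠ 0 := by nlinarith
    refine (mul_eq_zero.1
      (?_ : ((α ^ 2 + β ^ 2) ^ 2 - 1) * ((A - B) ^ 2 + (2 * C) ^ 2) = 0)).resolve_left hm1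
    have f1 : (α ^ 2 - β ^ 2) * (A - B) - 4 * α * β * C = A - B := by
      linear_combination e1 - e2
    have f2 : 2 * α * β * (A - B) + (α ^ 2 - β ^ 2) * (2 * C) = 2 * C := by
      linear_combination 2 * e3
    have : ((α ^ 2 - β ^ 2) * (A - B) - 4 * α * β * C) ^ 2
        + (2 * α * β * (A - B) + (α ^ 2 - β ^ 2) * (2 * C)) ^ 2
        = (A - B) ^ 2 + (2 * C) ^ 2 := by rw [f1, f2]
    linear_combination this
  have hA : A = 0 := by nlinarith [sq_nonneg (A - B), sq_nonneg (2 * C)]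
  have hB : B = 0 := by linarith
  have hC : C = 0 := by nlinarith [sq_nonneg (A - B), sq_nonneg (2 * C)]
  by_cases hx0 : x = 0
  · have hy0 : y ≠ 0 := by
      intro hy0
      apply hv
      funext i
      exact Complex.ext (congrFun hx0 i) (congrFun hy0 i)
    rw [hx0, act_zero, smul_zero, zero_sub, eq_comm, neg_eq_zero] at hgx
    have hβ := (smul_eq_zero.1 hgx).resolve_right hy0
    rw [hβ] at hμ2
    refine ⟨y, hy0, α, by linarith, ?_⟩
    rw [hgy, hβ, zero_smul, zero_add]
  -- Hence y = c x, and comparing g y with c · g x gives β (1 + c²) = 0: the eigenvalue is real.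
  · obtain ⟨c, hc⟩ := exists_smul_of_eta_self hx0 hA hC hB.le
    have h1 : (c * (α - β * c)) • x = (β + α * c) • x := by
      have := hgy
      rw [hc, act_smul, hgx, hc] at this
      rw [show (c * (α - β * c)) • x = c • (α • x - β • c • x) by module, this]
      module
    have h2 : c * (α - β * c) = β + α * c := smul_left_injective ℝ hx0 h1
    have hβ : β = 0 := by nlinarith [sq_nonneg c]
    rw [hβ] at hμ2
    refine ⟨x, hx0, α, by linarith, ?_⟩
    rw [hgx, hβ, zero_smul, sub_zero]

open scoped Matrix.Norms.Elementwise in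
theorem ActsTransitively.exists_norm_ge {G : Subgroup (SO n)} (hG : ActsTransitively G) (k : ℕ) :
    ∃ g ∈ G, (k : ℝ) ≤ ‖mat g‖ := by
  obtain ⟨g, hg, h⟩ := hG.2 _ basePoint_mem _ (hyperbolaPoint_mem 0 k)
  refine ⟨g, hg, ?_⟩
  have h0 : mat g 1 0 = k := by
    have := congrFun h 1
    simpa [act, basePoint, hyperbolaPoint] using this
  calc (k : ℝ) = ‖mat g 1 0‖ := by rw [h0]; simp
    _ ≤ ‖mat g‖ := Matrix.norm_entry_le_entrywise_sup_norm _

open scoped Matrix.Norms.Elementwise in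
/-- The traces of an irreducible transitive group are unbounded. -/
theorem ActsTransitively.exists_trace {G : Subgroup (SO n)} (hG : ActsTransitively G)
    (hirr : ∀ W : Submodule ℝ (V n), Preserves G W → W ≠ ⊥ → W = ⊤) (C : ℝ) :
    ∃ g ∈ G, C < |(mat g).trace| := by
  by_contra! hcon
  choose g hgG hg using hG.exists_norm_ge
  -- The bound on the norm of g 0 is vacuous, hence the shift by one.
  have hpos : ∀ k, 0 < ‖mat (g (k + 1))‖ := fun k => lt_of_lt_of_le (by positivity) (hg (k + 1))
  set r : ℕ → ℝ := fun k => ‖mat (g (k + 1))‖⁻¹ with hr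
  set M : ℕ → Mat n := fun k => r k • mat (g (k + 1)) with hM
  have hM1 : ∀ k, ‖M k‖ = 1 := by
    intro k
    rw [hM, norm_smul, hr, norm_inv, norm_norm, inv_mul_cancel₀ (hpos k).ne']
  have hr0 : Tendsto r atTop (𝓝 0) := by
    refine tendsto_inv_atTop_zero.comp (tendsto_atTop_mono (fun k => ?_)
      tendsto_natCast_atTop_atTop)
    refine le_trans ?_ (hg (k + 1))
    push_cast
    linarith
  obtain ⟨T, hT, φ, hφ, hlim⟩ := (isCompact_sphere (0 : Mat n) 1).tendsto_subseq
    (x := M) fun k => by simp [hM1]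
  have hT0 : T ≠ 0 := by
    rintro rfl
    simp at hT
  have hrφ := hr0.comp hφ.tendsto_atTop
  -- The traces of elements of G are bounded by C, and the rescaling factors tend to 0.
  have htr : ∀ h ∈ G, (mat h * T).trace = 0 := by
    intro h hh
    have h1 : Tendsto (fun k => (mat h * M (φ k)).trace) atTop (𝓝 (mat h * T).trace) := by
      have hc : Continuous fun X : Mat n => (mat h * X).trace := by fun_prop
      exact (hc.tendsto T).comp hlim
    refine tendsto_nhds_unique h1 (squeeze_zero_norm (fun k => ?_)
      (by simpa using hrφ.mul_const C))
    have h2 := hcon (h * g (φ k + 1)) (G.mul_mem hh (hgG _))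
    rw [hM, Matrix.mul_smul, Matrix.trace_smul, ← mat_mul, smul_eq_mul, norm_mul,
      Real.norm_eq_abs (Matrix.trace _)]
    have h3 : ‖r (φ k)‖ = r (φ k) := by rw [hr, norm_inv, norm_norm]
    rw [h3]
    exact mul_le_mul_of_nonneg_left h2 (by rw [← h3]; positivity)
  -- Rescaling multiplies η by r² → 0, so the image of T is totally isotropic and T has rank one.
  have hiso : ∀ x y, eta n (T *ᵥ x) (T *ᵥ y) = 0 := by
    intro x y
    have hc : Continuous fun X : Mat n => eta n (X *ᵥ x) (X *ᵥ y) := by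
      simp only [eta_eq_dotProduct]
      fun_prop
    refine tendsto_nhds_unique ((hc.tendsto T).comp hlim) ?_
    have h2 : ∀ k, eta n (M (φ k) *ᵥ x) (M (φ k) *ᵥ y) = r (φ k) * r (φ k) * eta n x y := by
      intro k
      simp only [hM, Matrix.smul_mulVec, map_smul, LinearMap.smul_apply, smul_eq_mul]
      rw [← eta_act (g (φ k + 1)) x y, mul_assoc]
      rfl
    have h3 : (fun k => r (φ k) * r (φ k) * eta n x y) =
        (fun X : Mat n => eta n (X *ᵥ x) (X *ᵥ y)) ∘ (M ∘ φ) := funext fun k => (h2 k).symm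
    rw [← h3]
    simpa using (hrφ.mul hrφ).mul_const (eta n x y)
  obtain ⟨x₀, hx₀⟩ : ∃ x, T *ᵥ x ≠ 0 := by
    by_contra! h
    exact hT0 (mat_ext fun x => by rw [h, Matrix.zero_mulVec])
  set u := T *ᵥ x₀ with hu
  have hrank : ∀ x, ∃ c : ℝ, T *ᵥ x = c • u := fun x =>
    exists_smul_of_eta_self hx₀ (hiso _ _) (hiso _ _) (hiso _ _).le
  choose c hc using hrank
  set f : V n := fun i => c (Pi.single i 1) with hf
  have hTuf : T = Matrix.vecMulVec u f := by
    refine Matrix.ext_of_mulVec_single fun i => ?_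
    rw [hc, Matrix.vecMulVec_mulVec]
    simp [hf]
  set W : Submodule ℝ (V n) := Submodule.span ℝ {x | ∃ h ∈ G, x = act h u} with hW
  have hWG : Preserves G W := by
    intro g hg x hx
    refine Submodule.span_induction (p := fun x _ => act g x ∈ W) ?_ ?_ ?_ ?_ hx
    · rintro x ⟨h, hh, rfl⟩
      exact Submodule.subset_span ⟨g * h, G.mul_mem hg hh, by rw [act_mul]⟩
    · rw [act_zero]
      exact zero_mem _
    · intro x y _ _ hx hy
      rw [act_add]
      exact add_mem hx hy
    · intro a x _ hx
      rw [act_smul]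
      exact W.smul_mem _ hx
  have hWtop : W = ⊤ := by
    refine hirr W hWG fun h => hx₀ ?_
    have : u ∈ W := Submodule.subset_span ⟨1, G.one_mem, by rw [act_one]⟩
    rwa [h, Submodule.mem_bot] at this
  -- With T = u fᵗ the trace of hT is f(hu), so f kills the span of the orbit of u, which is V by
  -- irreducibility.
  have hfW : ∀ x ∈ W, x ⬝ᵥ f = 0 := by
    intro x hx
    refine Submodule.span_induction (p := fun x _ => x ⬝ᵥ f = 0) ?_ ?_ ?_ ?_ hx
    · rintro x ⟨h, hh, rfl⟩
      rw [← Matrix.trace_vecMulVec, ← htr h hh, hTuf, Matrix.mul_vecMulVec]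
      rfl
    · simp
    · intro x y _ _ hx hy
      rw [add_dotProduct, hx, hy, add_zero]
    · intro a x _ hx
      rw [smul_dotProduct, hx, smul_zero]
  have hf0 : f = 0 := by
    refine dotProduct_eq _ _ fun x => ?_
    rw [dotProduct_comm, hfW x (hWtop ▸ Submodule.mem_top), zero_dotProduct]
  exact hT0 (by rw [hTuf, hf0, Matrix.vecMulVec_zero])

/-- A transitive group contains a loxodromic element. -/
theorem ActsTransitively.exists_loxodromic {G : Subgroup (SO n)} (hG : ActsTransitively G) :
    ∃ g ∈ G, ∃ p q : V n, IsNullPair p q ∧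
      ∃ a : ℝ, 1 < |a| ∧ act g p = a • p ∧ act g q = a⁻¹ • q := by
  obtain ⟨g, hg, p, hp, a, ha, hgp⟩ :
      ∃ g ∈ G, ∃ p : V n, p ≠ 0 ∧ ∃ a : ℝ, a ^ 2 ≠ 1 ∧ act g p = a • p := by
    by_cases hline : ∃ p : V n, p ≠ 0 ∧ Preserves G (Submodule.span ℝ {p})
    · obtain ⟨p, hp, hGp⟩ := hline
      obtain ⟨g, hg, a, ha⟩ := exists_eigenvector_of_preserves_line hG hp hGp
      exact ⟨g, hg, p, hp, a, ha⟩
    · obtain ⟨g, hg, htr⟩ := hG.exists_trace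
        (fun W hW hW0 => hG.irreducible (fun p hp _ h => hline ⟨p, hp, h⟩) hW hW0) (n + 2)
      exact ⟨g, hg, exists_eigenvector_of_trace htr⟩
  obtain ⟨q, hpq, hgq⟩ := exists_nullPair_of_eigenvector hp ha hgp
  have ha0 : a ≠ 0 := by
    rintro rfl
    rw [zero_smul] at hgp
    exact hp (by rw [← act_inv_act g p, hgp, act_zero])
  rcases lt_or_ge 1 |a| with h | h
  · exact ⟨g, hg, p, q, hpq, a, h, hgp, hgq⟩
  · refine ⟨g, hg, q, p, hpq.symm, a⁻¹, ?_, hgq, by rw [inv_inv, hgp]⟩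
    rw [abs_inv]
    refine (one_lt_inv₀ (abs_pos.2 ha0)).2 (lt_of_le_of_ne h fun h1 => ha ?_)
    rw [← sq_abs, h1, one_pow]

/-! ### Matrix exponentials -/

theorem hasSum_exp (X : Mat n) :
    HasSum (fun k : ℕ => ((k.factorial : ℝ)⁻¹) • X ^ k) (NormedSpace.exp X) := by
  let _ : NormedRing (Mat n) := Matrix.linftyOpNormedRing
  let _ : NormedAlgebra ℝ (Mat n) := Matrix.linftyOpNormedAlgebra
  exact NormedSpace.exp_series_hasSum_exp' X

theorem continuous_exp : Continuous (NormedSpace.exp : Mat n → Mat n) := by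
  let _ : NormedRing (Mat n) := Matrix.linftyOpNormedRing
  let _ : NormedAlgebra ℝ (Mat n) := Matrix.linftyOpNormedAlgebra
  let _ : NormedAlgebra ℚ (Mat n) := NormedAlgebra.restrictScalars ℚ ℝ _
  exact NormedSpace.exp_continuous

theorem hasDerivAt_exp_smul (X : Mat n) (i j : Fin (n + 2)) (t : ℝ) :
    HasDerivAt (fun s : ℝ => NormedSpace.exp (s • X) i j) ((NormedSpace.exp (t • X) * X) i j) t := by
  let _ : NormedRing (Mat n) := Matrix.linftyOpNormedRing
  let _ : NormedAlgebra ℝ (Mat n) := Matrix.linftyOpNormedAlgebra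
  have h := hasDerivAt_exp_smul_const X t
  have h1 := (LinearMap.toContinuousLinearMap
    (Matrix.entryLinearMap ℝ ℝ i j : Mat n →ₗ[ℝ] ℝ)).hasFDerivAt.comp_hasDerivAt t h
  exact h1

theorem exp_sub_exp_mem (S : Submodule ℝ (Mat n)) {X Y : Mat n}
    (h : ∀ k : ℕ, X ^ k - Y ^ k ∈ S) : NormedSpace.exp X - NormedSpace.exp Y ∈ S := by
  refine S.closed_of_finiteDimensional.mem_of_tendsto ((hasSum_exp X).sub (hasSum_exp Y))
    (Eventually.of_forall fun _ => S.sum_mem fun k _ => ?_)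
  rw [← smul_sub]
  exact S.smul_mem _ (h k)

theorem exp_mem_of_pow_mem (S : Submodule ℝ (Mat n)) {X : Mat n} (h : ∀ k : ℕ, X ^ k ∈ S) :
    NormedSpace.exp X ∈ S :=
  S.closed_of_finiteDimensional.mem_of_tendsto (hasSum_exp X)
    (Eventually.of_forall fun _ => S.sum_mem fun k _ => S.smul_mem _ (h k))

theorem exp_mulVec_of_eigen {X : Mat n} {x : V n} {c : ℝ} (h : X *ᵥ x = c • x) :
    NormedSpace.exp X *ᵥ x = Real.exp c • x := by
  have hk : ∀ k : ℕ, X ^ k *ᵥ x = c ^ k • x := by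
    intro k
    induction k with
    | zero => simp
    | succ k ih => rw [pow_succ, ← Matrix.mulVec_mulVec, h, Matrix.mulVec_smul, ih, smul_smul,
        pow_succ, mul_comm]
  have h1 : HasSum (fun k : ℕ => (((k.factorial : ℝ)⁻¹) • X ^ k) *ᵥ x)
      (NormedSpace.exp X *ᵥ x) :=
    (hasSum_exp X).map (⟨⟨fun M => M *ᵥ x, by simp⟩, fun M N => Matrix.add_mulVec M N x⟩ :
      Mat n →+ V n) (by
        change Continuous fun M : Mat n => M *ᵥ x
        fun_prop)
  have h2 : HasSum (fun k : ℕ => (((k.factorial : ℝ)⁻¹) • X ^ k) *ᵥ x) (Real.exp c • x) := by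
    have h3 : HasSum (fun k : ℕ => (((k.factorial : ℝ)⁻¹) * c ^ k) • x) (Real.exp c • x) := by
      refine HasSum.smul_const ?_ x
      rw [Real.exp_eq_exp_ℝ]
      simpa using NormedSpace.exp_series_hasSum_exp' (𝕂 := ℝ) c
    refine h3.congr_fun fun k => ?_
    rw [Matrix.smul_mulVec, hk, smul_smul]
  exact h1.unique h2

theorem exp_mulVec_of_kernel {X : Mat n} {x : V n} (h : X *ᵥ x = 0) :
    NormedSpace.exp X *ᵥ x = x := by
  have := exp_mulVec_of_eigen (X := X) (x := x) (c := 0) (by rw [h, zero_smul])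
  rwa [Real.exp_zero, one_smul] at this

theorem exp_mulVec_mem {X : Mat n} {W : Submodule ℝ (V n)} (h : ∀ x ∈ W, X *ᵥ x ∈ W) :
    ∀ x ∈ W, NormedSpace.exp X *ᵥ x ∈ W := by
  let S : Submodule ℝ (Mat n) :=
    { carrier := {M | ∀ x ∈ W, M *ᵥ x ∈ W}
      add_mem' := fun {M N} hM hN x hx => by
        rw [Matrix.add_mulVec]
        exact add_mem (hM x hx) (hN x hx)
      zero_mem' := fun x _ => by simp
      smul_mem' := fun c M hM x hx => by
        rw [Matrix.smul_mulVec]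
        exact W.smul_mem c (hM x hx) }
  refine exp_mem_of_pow_mem S fun k => ?_
  induction k with
  | zero =>
    intro x hx
    simpa using hx
  | succ k ih =>
    intro x hx
    rw [pow_succ, ← Matrix.mulVec_mulVec]
    exact ih _ (h x hx)

theorem exp_add_of_comm {X Y : Mat n} (h : X * Y = Y * X) :
    NormedSpace.exp (X + Y) = NormedSpace.exp X * NormedSpace.exp Y :=
  Matrix.exp_add_of_commute X Y h

theorem exp_mul_exp_neg (X : Mat n) : NormedSpace.exp X * NormedSpace.exp (-X) = 1 := by
  rw [← exp_add_of_comm (by simp), add_neg_cancel, NormedSpace.exp_zero]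

theorem exp_add_smul (X : Mat n) (s t : ℝ) :
    NormedSpace.exp ((s + t) • X) = NormedSpace.exp (s • X) * NormedSpace.exp (t • X) := by
  rw [add_smul]
  exact exp_add_of_comm (by simp [smul_smul, mul_comm])

theorem IsSkew.transpose {X : Mat n} (hX : IsSkew X) : Xᵀ = gram n * (-X) * gram n := by
  have h1 : Xᵀ * gram n = - (gram n * X) := by
    refine mat_ext fun x => dotProduct_eq _ _ fun y => ?_
    have h := hX x y
    rw [eta_eq_dotProduct, eta_eq_dotProduct, Matrix.dotProduct_mulVec] at h
    rw [← Matrix.mulVec_mulVec, Matrix.mulVec_transpose, Matrix.neg_mulVec, neg_dotProduct,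
      ← Matrix.mulVec_mulVec]
    linarith
  rw [mul_neg, ← h1, mul_assoc, gram_mul_self, mul_one]

theorem isUnit_gram (n : ℕ) : IsUnit (gram n) :=
  IsUnit.of_mul_eq_one _ (gram_mul_self n)

theorem gram_inv (n : ℕ) : (gram n)⁻¹ = gram n := Matrix.inv_eq_left_inv (gram_mul_self n)

theorem gram_conj_exp (X : Mat n) :
    NormedSpace.exp (gram n * X * gram n) = gram n * NormedSpace.exp X * gram n := by
  have := Matrix.exp_conj (gram n) X (isUnit_gram n)
  rwa [gram_inv] at this

theorem IsSkew.eta_exp {X : Mat n} (hX : IsSkew X) (x y : V n) :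
    eta n (NormedSpace.exp X *ᵥ x) (NormedSpace.exp X *ᵥ y) = eta n x y := by
  have h1 : (NormedSpace.exp X)ᵀ = gram n * NormedSpace.exp (-X) * gram n := by
    rw [← Matrix.exp_transpose, hX.transpose, gram_conj_exp]
  rw [eta_comm, eta_eq_dotProduct, Matrix.dotProduct_mulVec, ← Matrix.mulVec_transpose, h1,
    Matrix.mulVec_mulVec, Matrix.mulVec_mulVec, mul_assoc (gram n * _), gram_mul_self,
    mul_one, mul_assoc]
  have : NormedSpace.exp (-X) * NormedSpace.exp X = 1 := by
    simpa using exp_mul_exp_neg (-X)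
  rw [this, mul_one, ← eta_eq_dotProduct, eta_comm]

theorem det_sq_of_eta {M : Mat n} (h : ∀ x y, eta n (M *ᵥ x) (M *ᵥ y) = eta n x y) :
    M.det ^ 2 = 1 := by
  have h1 : Mᵀ * gram n * M = gram n := by
    refine mat_ext fun x => dotProduct_eq _ _ fun y => ?_
    have := h x y
    rw [eta_eq_dotProduct, eta_eq_dotProduct, Matrix.dotProduct_mulVec, ← Matrix.mulVec_transpose,
      Matrix.mulVec_mulVec, Matrix.mulVec_mulVec] at this
    exact this
  have h2 := congrArg Matrix.det h1
  rw [Matrix.det_mul, Matrix.det_mul, Matrix.det_transpose] at h2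
  have h3 : (gram n).det ≠ 0 := (Matrix.isUnit_iff_isUnit_det _).1 (isUnit_gram n) |>.ne_zero
  refine mul_left_cancel₀ h3 ?_
  linear_combination h2

/-- The element of `SO(V)` with the matrix `exp X`. -/
def expSO (X : Mat n) (hX : IsSkew X) : SO n :=
  ⟨⟨NormedSpace.exp X, NormedSpace.exp (-X), exp_mul_exp_neg X,
    by simpa using exp_mul_exp_neg (-X)⟩, hX.eta_exp, by
      -- An η-isometry has determinant of square 1, and exp X is the square of the isometry
      -- exp(X/2).
      have h1 : NormedSpace.exp X
          = NormedSpace.exp ((1 / 2 : ℝ) • X) * NormedSpace.exp ((1 / 2 : ℝ) • X) := by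
        rw [← exp_add_smul]
        norm_num
      have h2 := det_sq_of_eta (hX.smul (1 / 2)).eta_exp
      change (NormedSpace.exp X).det = 1
      rw [h1, Matrix.det_mul, ← pow_two, h2]⟩

theorem mat_expSO (X : Mat n) (hX : IsSkew X) : mat (expSO X hX) = NormedSpace.exp X := rfl

theorem act_expSO (X : Mat n) (hX : IsSkew X) (x : V n) :
    act (expSO X hX) x = NormedSpace.exp X *ᵥ x := rfl

theorem expSO_inv (X : Mat n) (hX : IsSkew X) : (expSO X hX)⁻¹ = expSO (-X) hX.neg :=
  mat_injective rfl

theorem isEmbedding_mat : Topology.IsEmbedding (mat : SO n → Mat n) := by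
  let _ : NormedRing (Mat n) := Matrix.linftyOpNormedRing
  have : HasSummableGeomSeries (Mat n) :=
    @instHasSummableGeomSeriesOfCompleteSpace _ _ (Matrix.instCompleteSpace _ _ ℝ)
  exact (Units.isOpenEmbedding_val (R := Mat n)).isEmbedding.comp Topology.IsEmbedding.subtypeVal

/-- Conjugation by exp y is exp(ad y). Here ad y is the sum of the commuting operators L and R, and
every term of the series of iterated brackets lies in the closed subspace S. -/
theorem exp_mul_mul_exp_neg_mem {𝔸 : Type*} [NormedRing 𝔸] [NormedAlgebra ℝ 𝔸]
    [CompleteSpace 𝔸] {S : Submodule ℝ 𝔸} (hS : IsClosed (S : Set 𝔸)) {y : 𝔸}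
    (h : ∀ x ∈ S, y * x - x * y ∈ S) {x : 𝔸} (hx : x ∈ S) :
    NormedSpace.exp y * x * NormedSpace.exp (-y) ∈ S := by
  let _ : NormedAlgebra ℚ (𝔸 →L[ℝ] 𝔸) := NormedAlgebra.restrictScalars ℚ ℝ _
  set L : 𝔸 →L[ℝ] 𝔸 := ContinuousLinearMap.mul ℝ 𝔸 y with hL
  set R : 𝔸 →L[ℝ] 𝔸 := (ContinuousLinearMap.mul ℝ 𝔸).flip (-y) with hR
  have hLk : ∀ (k : ℕ) z, (L ^ k) z = y ^ k * z := by
    intro k z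
    induction k with
    | zero => simp
    | succ k ih => rw [pow_succ', mul_apply_eq_comp, ih, pow_succ', hL,
        ContinuousLinearMap.mul_apply', mul_assoc]
  have hRk : ∀ (k : ℕ) z, (R ^ k) z = z * (-y) ^ k := by
    intro k z
    induction k with
    | zero => simp
    | succ k ih => rw [pow_succ', mul_apply_eq_comp, ih, pow_succ, hR,
        ContinuousLinearMap.flip_apply, ContinuousLinearMap.mul_apply', mul_assoc]
  have heval : ∀ (A : 𝔸 →L[ℝ] 𝔸) z,
      HasSum (fun k : ℕ => ((k.factorial : ℝ)⁻¹) • (A ^ k) z) (NormedSpace.exp A z) := by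
    intro A z
    exact (NormedSpace.exp_series_hasSum_exp' (𝕂 := ℝ) A).mapL (ContinuousLinearMap.apply ℝ _ z)
  have hexpL : ∀ z, NormedSpace.exp L z = NormedSpace.exp y * z := by
    intro z
    refine (heval L z).unique ?_
    simp only [hLk, ← smul_mul_assoc]
    exact (NormedSpace.exp_series_hasSum_exp' (𝕂 := ℝ) y).mul_right z
  have hexpR : ∀ z, NormedSpace.exp R z = z * NormedSpace.exp (-y) := by
    intro z
    refine (heval R z).unique ?_
    simp only [hRk, ← mul_smul_comm]
    exact (NormedSpace.exp_series_hasSum_exp' (𝕂 := ℝ) (-y)).mul_left z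
  have hcomm : Commute L R := by
    ext1 z
    simp [hL, hR, mul_assoc]
  have h1 : NormedSpace.exp (L + R) x = NormedSpace.exp y * x * NormedSpace.exp (-y) := by
    rw [NormedSpace.exp_add_of_commute hcomm, mul_apply_eq_comp, hexpR, hexpL,
      mul_assoc]
  have hk : ∀ k : ℕ, ((L + R) ^ k) x ∈ S := by
    intro k
    induction k with
    | zero => simpa using hx
    | succ k ih =>
      rw [pow_succ', mul_apply_eq_comp]
      have := h _ ih
      simpa [hL, hR, sub_eq_add_neg] using this
  rw [← h1]
  exact hS.mem_of_tendsto (heval (L + R) x)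
    (Eventually.of_forall fun _ => S.sum_mem fun k _ => S.smul_mem _ (hk k))

theorem exp_conj_mem {𝔤 : Submodule ℝ (Mat n)} {Y : Mat n}
    (hlie : ∀ X ∈ 𝔤, Y * X - X * Y ∈ 𝔤) {X : Mat n} (hX : X ∈ 𝔤) :
    NormedSpace.exp Y * X * NormedSpace.exp (-Y) ∈ 𝔤 := by
  let _ : NormedRing (Mat n) := Matrix.linftyOpNormedRing
  let _ : NormedAlgebra ℝ (Mat n) := Matrix.linftyOpNormedAlgebra
  exact exp_mul_mul_exp_neg_mem 𝔤.closed_of_finiteDimensional hlie hX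

/-- The subgroup of `SO(V)` generated by the exponentials of the elements of `𝔤`. -/
def expClosure (𝔤 : Submodule ℝ (Mat n)) : Subgroup (SO n) :=
  Subgroup.closure {g : SO n | ∃ X ∈ 𝔤, mat g = NormedSpace.exp X}

theorem expSO_mem_expClosure {𝔤 : Submodule ℝ (Mat n)} {X : Mat n} (hX : IsSkew X) (h : X ∈ 𝔤) :
    expSO X hX ∈ expClosure 𝔤 := Subgroup.subset_closure ⟨X, h, rfl⟩

theorem expClosure_induction {𝔤 : Submodule ℝ (Mat n)} (h𝔤 : ∀ X ∈ 𝔤, IsSkew X) {H : Subgroup (SO n)}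
    (h : ∀ X (hX : X ∈ 𝔤), expSO X (h𝔤 X hX) ∈ H) : expClosure 𝔤 ≤ H := by
  refine (Subgroup.closure_le _).2 ?_
  rintro g ⟨X, hX, hg⟩
  have : g = expSO X (h𝔤 X hX) := mat_injective hg
  rw [this]
  exact h X hX

/-- The stabilizer of a subspace in `SO(V)`. -/
def stabilizer (W : Submodule ℝ (V n)) : Subgroup (SO n) where
  carrier := {g | (∀ x ∈ W, act g x ∈ W) ∧ ∀ x ∈ W, act g⁻¹ x ∈ W}
  one_mem' := ⟨fun x hx => by rwa [act_one], fun x hx => by rwa [inv_one, act_one]⟩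
  mul_mem' := fun {g h} hg hh => ⟨fun x hx => by
    rw [act_mul]
    exact hg.1 _ (hh.1 x hx), fun x hx => by
    rw [mul_inv_rev, act_mul]
    exact hh.2 _ (hg.2 x hx)⟩
  inv_mem' := fun {g} hg => ⟨hg.2, by simpa using hg.1⟩

theorem preserves_expClosure {𝔤 : Submodule ℝ (Mat n)} (h𝔤 : ∀ X ∈ 𝔤, IsSkew X)
    {W : Submodule ℝ (V n)} (hW : ∀ X ∈ 𝔤, ∀ x ∈ W, X *ᵥ x ∈ W) : Preserves (expClosure 𝔤) W := by
  have : expClosure 𝔤 ≤ stabilizer W := expClosure_induction h𝔤 fun X hX =>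
    ⟨fun x hx => exp_mulVec_mem (hW X hX) x hx, fun x hx => by
      rw [expSO_inv]
      exact exp_mulVec_mem (hW _ (neg_mem hX)) x hx⟩
  exact fun g hg => (this hg).1

/-- The normalizer in `SO(V)` of a subspace of matrices. -/
def conjStabilizer (𝔤 : Submodule ℝ (Mat n)) : Subgroup (SO n) where
  carrier := {g | (∀ X ∈ 𝔤, mat g * X * mat g⁻¹ ∈ 𝔤) ∧ ∀ X ∈ 𝔤, mat g⁻¹ * X * mat g ∈ 𝔤}
  one_mem' := by simp [mat_one]
  mul_mem' := fun {g h} hg hh => ⟨fun X hX => by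
    have := hg.1 _ (hh.1 X hX)
    simpa only [mul_inv_rev, mat_mul, mul_assoc] using this, fun X hX => by
    have := hh.2 _ (hg.2 X hX)
    simpa only [mul_inv_rev, mat_mul, mul_assoc] using this⟩
  inv_mem' := fun {g} hg => ⟨by simpa using hg.2, by simpa using hg.1⟩

theorem conj_mem_of_mem_expClosure {𝔤 : Submodule ℝ (Mat n)} (h𝔤 : ∀ X ∈ 𝔤, IsSkew X)
    (hlie : ∀ X ∈ 𝔤, ∀ Y ∈ 𝔤, X * Y - Y * X ∈ 𝔤) {g : SO n} (hg : g ∈ expClosure 𝔤)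
    {X : Mat n} (hX : X ∈ 𝔤) : mat g * X * mat g⁻¹ ∈ 𝔤 := by
  have : expClosure 𝔤 ≤ conjStabilizer 𝔤 := expClosure_induction h𝔤 fun Y hY =>
    ⟨fun X hX => exp_conj_mem (hlie Y hY) hX, fun X hX => by
      have := exp_conj_mem (hlie _ (neg_mem hY)) hX
      rwa [neg_neg] at this⟩
  exact (this hg).1 X hX

/-! ### The Lie algebra of a transitive group -/

/-- A skew endomorphism in terms of wedges of the vectors of a null basis and their images. -/
theorem NullBasis.skew_expand (b : NullBasis n) {X : Mat n} (hX : IsSkew X) :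
    X = (1 / 2 : ℝ) • (wedge b.p (X *ᵥ b.q) + wedge b.q (X *ᵥ b.p)
      + ∑ i, wedge (b.e i) (X *ᵥ b.e i)) := by
  refine mat_ext fun x => ?_
  have h1 : X *ᵥ x = eta n b.q x • X *ᵥ b.p + ∑ i, eta n (b.e i) x • X *ᵥ b.e i
      + eta n b.p x • X *ᵥ b.q := by
    conv_lhs => rw [b.expand x]
    simp only [Matrix.mulVec_add, Matrix.mulVec_smul, Matrix.mulVec_sum]
  have h2 := b.expand (X *ᵥ x)
  rw [Matrix.smul_mulVec, Matrix.add_mulVec, Matrix.add_mulVec, Matrix.sum_mulVec]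
  simp only [wedge_mulVec, hX.eta_left, neg_smul, sub_neg_eq_add, Finset.sum_add_distrib]
  have h3 : eta n b.p x • X *ᵥ b.q + eta n b.q (X *ᵥ x) • b.p
      + (eta n b.q x • X *ᵥ b.p + eta n b.p (X *ᵥ x) • b.q)
      + (∑ i, eta n (b.e i) x • X *ᵥ b.e i + ∑ i, eta n (b.e i) (X *ᵥ x) • b.e i)
      = X *ᵥ x + X *ᵥ x := by
    conv_rhs => enter [2]; rw [h2]
    rw [h1]
    abel
  rw [h3, ← two_smul ℝ, smul_smul]
  norm_num

/-! ### Horospherical components as limits under a loxodromic element -/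

/-- The component of `X q` orthogonal to the null pair `p, q`. -/
def horoPart (X : Mat n) (p q : V n) : V n := X *ᵥ q + eta n (X *ᵥ p) q • q

section IsNullPair

variable {p q : V n} {X : Mat n}

theorem eta_horoPart (h : IsNullPair p q) (hX : IsSkew X) : eta n p (horoPart X p q) = 0 := by
  simp only [horoPart, map_add, map_smul, h.pq, hX.eta_left, smul_eq_mul]
  ring

theorem eta_horoPart' (h : IsNullPair p q) (hX : IsSkew X) : eta n q (horoPart X p q) = 0 := by
  simp only [horoPart, map_add, map_smul, h.qq, smul_eq_mul]
  rw [eta_comm, hX.eta_self]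
  ring

theorem mulVec_right_eq (X : Mat n) (p q : V n) : X *ᵥ q = horoPart X p q - eta n (X *ᵥ p) q • q := by
  simp [horoPart]

theorem mulVec_left_eq (hX : IsSkew X) (p q : V n) : X *ᵥ p = horoPart X q p + eta n (X *ᵥ p) q • p := by
  rw [horoPart, hX.eta_left q, eta_comm q]
  simp

end IsNullPair

section Limit

variable {p q : V n} (h : IsNullPair p q) {g : SO n} {a : ℝ}

theorem act_pow_of_eigen {x : V n} {a : ℝ} (hx : act g x = a • x) (k : ℕ) :
    act (g ^ k) x = a ^ k • x := by
  induction k with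
  | zero => simp [act_one]
  | succ k ih => rw [pow_succ, act_mul, hx, act_smul, ih, smul_smul, pow_succ, mul_comm]

theorem eta_act_pow_of_orthogonal {x y : V n} {a : ℝ} (ha : a ≠ 0) (hx : act g x = a • x)
    (hxy : eta n x y = 0) (k : ℕ) : eta n x (act (g ^ k) y) = 0 := by
  have := eta_act (g ^ k) x y
  rw [act_pow_of_eigen hx, hxy, map_smul, LinearMap.smul_apply, smul_eq_mul] at this
  exact (mul_eq_zero.1 this).resolve_left (pow_ne_zero _ ha)

theorem continuous_wedge : Continuous fun x : V n × V n => wedge x.1 x.2 := by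
  unfold wedge
  fun_prop

open scoped Matrix.Norms.Elementwise in
-- The wedge of two vectors with bounded orbits stays bounded, so the factor a⁻ᵏ sends it to 0.
theorem tendsto_inv_pow_smul_wedge (ha : 1 < |a|) {y z : V n} (hy : ∃ C, ∀ k, ‖act (g ^ k) y‖ ≤ C)
    (hz : ∃ C, ∀ k, ‖act (g ^ k) z‖ ≤ C) :
    Tendsto (fun k : ℕ => (a ^ k)⁻¹ • wedge (act (g ^ k) y) (act (g ^ k) z)) atTop (𝓝 0) := by
  obtain ⟨C, hC⟩ := hy
  obtain ⟨D, hD⟩ := hz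
  obtain ⟨K, hK⟩ := ((isCompact_closedBall (0 : V n) C).prod
    (isCompact_closedBall (0 : V n) D)).exists_bound_of_continuousOn
    (continuous_wedge (n := n)).continuousOn
  have hr : Tendsto (fun k : ℕ => |a|⁻¹ ^ k) atTop (𝓝 0) :=
    tendsto_pow_atTop_nhds_zero_of_lt_one (by positivity) (inv_lt_one_of_one_lt₀ ha)
  refine squeeze_zero_norm (fun k => ?_) (by simpa using hr.mul_const K)
  rw [norm_smul, norm_inv, norm_pow, Real.norm_eq_abs]
  refine mul_le_mul_of_nonneg_left (hK (act (g ^ k) y, act (g ^ k) z) ?_) (by positivity)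
  exact ⟨by simpa using hC k, by simpa using hD k⟩

include h

/-- Convergence of vectors orthogonal to a null pair is detected by `η`. -/
theorem tendsto_zero_of_eta {ι : Type*} {l : Filter ι} {w : ι → V n} (hp : ∀ i, eta n p (w i) = 0)
    (hq : ∀ i, eta n q (w i) = 0) (hw : Tendsto (fun i => eta n (w i) (w i)) l (𝓝 0)) :
    Tendsto w l (𝓝 0) := by
  obtain ⟨b, rfl, rfl⟩ := exists_nullBasis h
  have h1 : ∀ j, Tendsto (fun i => eta n (b.e j) (w i)) l (𝓝 0) := by
    intro j
    have h2 : Tendsto (fun i => eta n (b.e j) (w i) ^ 2) l (𝓝 0) := by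
      refine squeeze_zero (fun i => sq_nonneg _) (fun i => ?_) hw
      rw [b.eta_self, hp, hq]
      simp only [mul_zero, zero_add]
      exact Finset.single_le_sum (f := fun j => eta n (b.e j) (w i) ^ 2)
        (fun _ _ => sq_nonneg _) (Finset.mem_univ j)
    have h3 := (Real.continuous_sqrt.tendsto 0).comp h2
    simp only [Function.comp_def, Real.sqrt_sq_eq_abs, Real.sqrt_zero] at h3
    exact (tendsto_zero_iff_abs_tendsto_zero _).2 h3
  have h2 : w = fun i => ∑ j, eta n (b.e j) (w i) • b.e j :=
    funext fun i => b.expand_of_orthogonal (hp i) (hq i)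
  rw [h2]
  have h3 := tendsto_finsetSum Finset.univ fun j _ => (h1 j).smul_const (b.e j)
  simpa using h3

/-- g preserves E = {p, q}^⊥, where η is positive definite, so an orbit in E stays on a sphere. -/
theorem exists_norm_act_pow_le (ha : a ≠ 0) (hgp : act g p = a • p) (hgq : act g q = a⁻¹ • q)
    {y : V n} (hp : eta n p y = 0) (hq : eta n q y = 0) : ∃ C, ∀ k, ‖act (g ^ k) y‖ ≤ C := by
  obtain ⟨b, rfl, rfl⟩ := exists_nullBasis h
  -- Each coordinate t satisfies t² ≤ η(y, y), and |t| ≤ t² + 1.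
  refine ⟨∑ j, (eta n y y + 1) * ‖b.e j‖, fun k => ?_⟩
  have hp' := eta_act_pow_of_orthogonal ha hgp hp k
  have hq' := eta_act_pow_of_orthogonal (inv_ne_zero ha) hgq hq k
  rw [b.expand_of_orthogonal hp' hq']
  refine norm_sum_le_of_le _ fun j _ => ?_
  rw [norm_smul]
  refine mul_le_mul_of_nonneg_right ?_ (norm_nonneg _)
  have h1 : eta n (b.e j) (act (g ^ k) y) ^ 2 ≤ eta n y y := by
    rw [← eta_act (g ^ k) y y, b.eta_self, hp', hq']
    simp only [mul_zero, zero_add]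
    exact Finset.single_le_sum (f := fun j => eta n (b.e j) (act (g ^ k) y) ^ 2)
        (fun _ _ => sq_nonneg _) (Finset.mem_univ j)
  rw [Real.norm_eq_abs]
  nlinarith [sq_abs (eta n (b.e j) (act (g ^ k) y)), sq_nonneg (|eta n (b.e j) (act (g ^ k) y)| - 1),
    abs_nonneg (eta n (b.e j) (act (g ^ k) y))]

/-- Orbits of the rotational part of a loxodromic element are recurrent. -/
theorem exists_recurrence (ha : a ≠ 0) (hgp : act g p = a • p) (hgq : act g q = a⁻¹ • q)
    {y : V n} (hp : eta n p y = 0) (hq : eta n q y = 0) :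
    ∃ φ : ℕ → ℕ, Tendsto φ atTop atTop ∧ Tendsto (fun j => act (g ^ φ j) y) atTop (𝓝 y) := by
  obtain ⟨C, hC⟩ := exists_norm_act_pow_le h ha hgp hgq hp hq
  have hcont : Continuous fun x : V n => eta n x x := by
    simp only [eta_apply]
    fun_prop
  have key : ∀ M : ℕ, ∃ k ≥ M, eta n (act (g ^ k) y - y) (act (g ^ k) y - y) < 1 / ((M : ℝ) + 1) := by
    intro M
    -- Sampling at multiples of M + 1 makes the difference of two distinct times at least M.
    set s : ℕ → V n := fun i => act (g ^ (i * (M + 1))) y with hs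
    obtain ⟨z, -, φ, hφ, hlim⟩ := (isCompact_closedBall (0 : V n) C).tendsto_subseq
      (x := s) fun i => by simpa using hC _
    have h1 : Tendsto (fun i => s (φ (i + 1)) - s (φ i)) atTop (𝓝 0) := by
      have := (hlim.comp (tendsto_add_atTop_nat 1)).sub hlim
      simpa using this
    have h2 := (hcont.tendsto 0).comp h1
    simp only [Function.comp_def, map_zero] at h2
    obtain ⟨i, hi⟩ := (h2.eventually (gt_mem_nhds (by positivity :
      (0 : ℝ) < 1 / ((M : ℝ) + 1)))).exists
    have hlt : φ i < φ (i + 1) := hφ (Nat.lt_succ_self i)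
    refine ⟨(φ (i + 1) - φ i) * (M + 1), ?_, ?_⟩
    · have : 1 ≤ φ (i + 1) - φ i := by omega
      nlinarith
    -- Two nearby points of the orbit are moved back by an isometry to y and a point close to y.
    · have h3 : s (φ (i + 1)) - s (φ i) = act (g ^ (φ i * (M + 1)))
          (act (g ^ ((φ (i + 1) - φ i) * (M + 1))) y - y) := by
        rw [act_sub, ← act_mul, ← pow_add, ← add_mul]
        congr 5
        omega
      rwa [h3, eta_act] at hi
  choose φ hφ hφ2 using key
  refine ⟨φ, tendsto_atTop_mono hφ tendsto_id, ?_⟩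
  have h1 : Tendsto (fun j => act (g ^ φ j) y - y) atTop (𝓝 0) := by
    have hp' : ∀ j, eta n p (act (g ^ φ j) y - y) = 0 := fun j => by
      rw [map_sub, eta_act_pow_of_orthogonal ha hgp hp, hp, sub_zero]
    have hq' : ∀ j, eta n q (act (g ^ φ j) y - y) = 0 := fun j => by
      rw [map_sub, eta_act_pow_of_orthogonal (inv_ne_zero ha) hgq hq, hq, sub_zero]
    refine tendsto_zero_of_eta h hp' hq' (squeeze_zero (fun j => h.eta_self_nonneg (hp' j))
      (fun j => (hφ2 j).le) tendsto_one_div_add_atTop_nhds_zero_nat)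
  simpa using h1.add_const y

/-- A subspace of `𝔰𝔬(V)` that is normalized by a loxodromic element contains the horospherical
parts of its elements. -/
theorem wedge_horoPart_mem (ha : 1 < |a|) (hgp : act g p = a • p) (hgq : act g q = a⁻¹ • q)
    {𝔤 : Submodule ℝ (Mat n)} (hconj : ∀ X ∈ 𝔤, mat g * X * mat g⁻¹ ∈ 𝔤) {X : Mat n}
    (hX : IsSkew X) (hX𝔤 : X ∈ 𝔤) : wedge p (horoPart X p q) ∈ 𝔤 := by
  have ha0 : a ≠ 0 := by
    rintro rfl
    simp at ha
    linarith
  obtain ⟨φ, hφ, hlim⟩ := exists_recurrence h ha0 hgp hgq (eta_horoPart h hX) (eta_horoPart' h hX)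
  -- D k is a⁻ᵏ Ad(gᵏ). It rotates p ∧ E, because p is scaled by aᵏ, and it contracts p ∧ q, q ∧ E
  -- and E ∧ E.
  let D : ℕ → Mat n →ₗ[ℝ] Mat n := fun k =>
    { toFun := fun Y => (a ^ k)⁻¹ • (mat (g ^ k) * Y * mat (g ^ k)⁻¹)
      map_add' := fun Y Z => by rw [mul_add, add_mul, smul_add]
      map_smul' := fun c Y => by
        rw [mul_smul_comm, smul_mul_assoc, smul_comm]
        rfl }
  have hDw : ∀ k y z, D k (wedge y z) = (a ^ k)⁻¹ • wedge (act (g ^ k) y) (act (g ^ k) z) :=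
    fun k y z => congrArg ((a ^ k)⁻¹ • ·) (mat_mul_wedge (g ^ k) y z)
  have hD𝔤 : ∀ k, D k X ∈ 𝔤 := by
    intro k
    refine 𝔤.smul_mem _ ?_
    induction k with
    | zero => simpa [mat_one] using hX𝔤
    | succ k ih =>
      have := hconj _ ih
      rw [pow_succ']
      simpa only [mat_mul, mul_inv_rev, mul_assoc] using this
  -- The matrices that D contracts to 0.
  let S : Submodule ℝ (Mat n) :=
    { carrier := {Y | Tendsto (fun k => D k Y) atTop (𝓝 0)}
      add_mem' := fun {Y Z} hY hZ => by
        simpa using Tendsto.add (Set.mem_ofPred.1 hY) (Set.mem_ofPred.1 hZ)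
      zero_mem' := by simp
      smul_mem' := fun c Y hY => by
        simpa using Tendsto.const_smul (Set.mem_ofPred.1 hY) c }
  let Bd : Submodule ℝ (V n) :=
    { carrier := {y | ∃ C, ∀ k, ‖act (g ^ k) y‖ ≤ C}
      add_mem' := by
        rintro y z ⟨C, hC⟩ ⟨D, hD⟩
        exact ⟨C + D, fun k => by
          rw [act_add]
          exact norm_add_le_of_le (hC k) (hD k)⟩
      zero_mem' := ⟨0, fun k => by rw [act_zero, norm_zero]⟩
      smul_mem' := by
        rintro c y ⟨C, hC⟩
        exact ⟨‖c‖ * C, fun k => by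
          rw [act_smul, norm_smul]
          exact mul_le_mul_of_nonneg_left (hC k) (norm_nonneg c)⟩ }
  have hSw : ∀ y ∈ Bd, ∀ z ∈ Bd, wedge y z ∈ S := by
    intro y hy z hz
    change Tendsto (fun k => D k (wedge y z)) atTop (𝓝 0)
    simp only [hDw]
    exact tendsto_inv_pow_smul_wedge ha hy hz
  have hBq : q ∈ Bd := by
    refine ⟨‖q‖, fun k => ?_⟩
    rw [act_pow_of_eigen hgq, norm_smul, norm_pow, norm_inv, Real.norm_eq_abs]
    exact mul_le_of_le_one_left (norm_nonneg q)
      (pow_le_one₀ (by positivity) (inv_le_one_of_one_le₀ ha.le))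
  have hBE : ∀ y, eta n p y = 0 → eta n q y = 0 → y ∈ Bd := fun y hp hq =>
    exists_norm_act_pow_le h ha0 hgp hgq hp hq
  have hqp : wedge p q ∈ S := by
    change Tendsto (fun k => D k (wedge p q)) atTop (𝓝 0)
    have hr : Tendsto (fun k : ℕ => a⁻¹ ^ k) atTop (𝓝 0) :=
      tendsto_pow_atTop_nhds_zero_of_abs_lt_one (by rw [abs_inv]; exact inv_lt_one_of_one_lt₀ ha)
    have h1 : ∀ k, D k (wedge p q) = a⁻¹ ^ k • wedge p q := by
      intro k
      rw [hDw, act_pow_of_eigen hgp, act_pow_of_eigen hgq, wedge_smul_left, wedge_smul_right,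
        smul_smul, smul_smul, inv_mul_cancel₀ (pow_ne_zero _ ha0), one_mul]
    simp only [h1]
    simpa using hr.smul_const (wedge p q)
  have hbd : ∀ y, eta n q y = 0 → y ∈ Bd := by
    intro y hy
    have : y = (y - eta n p y • q) + eta n p y • q := by simp
    rw [this]
    refine add_mem (hBE _ ?_ ?_) (Bd.smul_mem _ hBq) <;> simp [h.pq, h.qq, hy]
  set u := horoPart X p q with hu
  -- Removing p ∧ u makes q an eigenvector, so no p ∧ E component is left in the wedge expansion.
  have hY : X - wedge p u ∈ S := by
    obtain ⟨b, rfl, rfl⟩ := exists_nullBasis h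
    have hYs := hX.sub (wedge_isSkew b.p u)
    have hYq : (X - wedge b.p u) *ᵥ b.q = - eta n (X *ᵥ b.p) b.q • b.q := by
      rw [Matrix.sub_mulVec, wedge_mulVec, h.pq, eta_comm, eta_horoPart' h hX,
        mulVec_right_eq X b.p b.q, ← hu]
      module
    set Y := X - wedge b.p u
    have hYo : ∀ x, eta n b.q x = 0 → eta n b.q (Y *ᵥ x) = 0 := by
      intro x hx
      have := hYs b.q x
      rw [hYq, map_smul, LinearMap.smul_apply, hx, smul_zero, zero_add] at this
      exact this
    rw [b.skew_expand hYs]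
    refine S.smul_mem _ (add_mem (add_mem ?_ ?_) (sum_mem fun i _ => ?_))
    · rw [hYq, wedge_smul_right]
      exact S.smul_mem _ hqp
    · have h1 : Y *ᵥ b.p = horoPart Y b.q b.p + eta n (Y *ᵥ b.p) b.q • b.p := mulVec_left_eq hYs _ _
      rw [h1, wedge_add_right, wedge_smul_right, wedge_swap b.q b.p]
      exact add_mem (hSw _ hBq _ (hBE _ (eta_horoPart' h.symm hYs) (eta_horoPart h.symm hYs)))
        (S.smul_mem _ (neg_mem hqp))
    · exact hSw _ (hbd _ (b.eta_qe i)) _ (hbd _ (hYo _ (b.eta_qe i)))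
  have hDu : ∀ k, D k (wedge p u) = wedge p (act (g ^ k) u) := by
    intro k
    rw [hDw, act_pow_of_eigen hgp, wedge_smul_left, smul_smul,
      inv_mul_cancel₀ (pow_ne_zero _ ha0), one_smul]
  -- Along the recurrence times the surviving part p ∧ gᵏu returns to p ∧ u.
  have hlimX : Tendsto (fun j => D (φ j) X) atTop (𝓝 (wedge p u)) := by
    have h1 : Tendsto (fun j => D (φ j) (wedge p u)) atTop (𝓝 (wedge p u)) := by
      simp only [hDu]
      exact ((wedgeRight p).continuous_of_finiteDimensional.tendsto u).comp hlim
    have h2 := h1.add (Tendsto.comp (Set.mem_ofPred.1 hY) hφ)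
    rw [add_zero] at h2
    refine h2.congr fun j => ?_
    simp only [Function.comp_def]
    rw [← map_add, add_sub_cancel]
  exact 𝔤.closed_of_finiteDimensional.mem_of_tendsto hlimX (Eventually.of_forall fun j => hD𝔤 _)

end Limit

/-! ### The horospherical subspaces and the dichotomy for 𝔤 -/

/-- The vectors `u` orthogonal to the null pair `p, q` for which `p ∧ u` lies in `𝔤`. -/
def horoSpace (𝔤 : Submodule ℝ (Mat n)) (p q : V n) : Submodule ℝ (V n) :=
  LinearMap.ker (eta n p) ⊓ LinearMap.ker (eta n q) ⊓ 𝔤.comap (wedgeRight p)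

theorem mem_horoSpace {𝔤 : Submodule ℝ (Mat n)} {p q u : V n} :
    u ∈ horoSpace 𝔤 p q ↔ (eta n p u = 0 ∧ eta n q u = 0) ∧ wedge p u ∈ 𝔤 := Iff.rfl

section

variable {𝔤 : Submodule ℝ (Mat n)} {p q : V n}

theorem horoPart_mem_horoSpace (h : IsNullPair p q)
    (hhoro : ∀ X ∈ 𝔤, wedge p (horoPart X p q) ∈ 𝔤) {X : Mat n} (hXs : IsSkew X) (hX : X ∈ 𝔤) :
    horoPart X p q ∈ horoSpace 𝔤 p q :=
  ⟨⟨eta_horoPart h hXs, eta_horoPart' h hXs⟩, hhoro X hX⟩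

/-- `𝔤` maps its horospherical part to the span of `p`, `q` and itself. -/
theorem mulVec_mem_of_mem_horoSpace (h : IsNullPair p q) (h𝔤 : ∀ X ∈ 𝔤, IsSkew X)
    (hlie : ∀ X ∈ 𝔤, ∀ Y ∈ 𝔤, X * Y - Y * X ∈ 𝔤)
    (hhoro : ∀ X ∈ 𝔤, wedge p (horoPart X p q) ∈ 𝔤)
    (hhoro' : ∀ X ∈ 𝔤, wedge q (horoPart X q p) ∈ 𝔤) {X : Mat n} (hX : X ∈ 𝔤) {f : V n}
    (hf : f ∈ horoSpace 𝔤 p q) :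
    X *ᵥ f ∈ Submodule.span ℝ {p, q} ⊔ horoSpace 𝔤 p q := by
  obtain ⟨⟨hpf, hqf⟩, hf𝔤⟩ := mem_horoSpace.1 hf
  have hXs := h𝔤 X hX
  set u := horoPart X p q with hu
  set v := horoPart X q p with hv
  set c := eta n (X *ᵥ p) q with hc
  -- X₀ is the part of X that preserves both lines ℝp and ℝq; it also preserves E.
  set X₀ := X - wedge p u - wedge q v with hX₀
  have hX₀𝔤 : X₀ ∈ 𝔤 := sub_mem (sub_mem hX (hhoro X hX)) (hhoro' X hX)
  have hX₀s := h𝔤 X₀ hX₀𝔤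
  have hup := eta_horoPart h hXs
  have huq := eta_horoPart' h hXs
  have hvq := eta_horoPart h.symm hXs
  have hvp := eta_horoPart' h.symm hXs
  have hX₀p : X₀ *ᵥ p = c • p := by
    rw [hX₀, Matrix.sub_mulVec, Matrix.sub_mulVec, wedge_mulVec, wedge_mulVec, h.pp, h.qp,
      eta_comm u, hup, eta_comm v, hvp, mulVec_left_eq hXs p q]
    module
  have hX₀q : X₀ *ᵥ q = (-c) • q := by
    rw [hX₀, Matrix.sub_mulVec, Matrix.sub_mulVec, wedge_mulVec, wedge_mulVec, h.pq, h.qq,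
      eta_comm u, huq, eta_comm v, hvq, mulVec_right_eq X p q]
    module
  have hX₀f : X₀ *ᵥ f ∈ horoSpace 𝔤 p q := by
    refine mem_horoSpace.2 ⟨⟨?_, ?_⟩, ?_⟩
    · have := hX₀s p f
      rw [hX₀p, map_smul, LinearMap.smul_apply, hpf, smul_zero, zero_add] at this
      exact this
    · have := hX₀s q f
      rw [hX₀q, map_smul, LinearMap.smul_apply, hqf, smul_zero, zero_add] at this
      exact this
    -- [X₀, p ∧ f] = c p ∧ f + p ∧ X₀f, and the first summand is already in 𝔤.
    · have h1 := hlie _ hX₀𝔤 _ hf𝔤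
      rw [hX₀s.commutator_wedge, hX₀p, wedge_smul_left] at h1
      exact (𝔤.add_mem_iff_right (𝔤.smul_mem c hf𝔤)).1 h1
  have hXf : X *ᵥ f = (- eta n u f) • p + (- eta n v f) • q + X₀ *ᵥ f := by
    rw [hX₀, Matrix.sub_mulVec, Matrix.sub_mulVec, wedge_mulVec, wedge_mulVec, hpf, hqf]
    module
  rw [hXf]
  refine add_mem (Submodule.mem_sup_left (add_mem ?_ ?_)) (Submodule.mem_sup_right hX₀f)
  · exact Submodule.smul_mem _ _ (Submodule.subset_span (by simp))
  · exact Submodule.smul_mem _ _ (Submodule.subset_span (by simp))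

/-- This element is the bracket [p ∧ u, q ∧ v]. -/
theorem wedge_sub_mem (h : IsNullPair p q) (h𝔤 : ∀ X ∈ 𝔤, IsSkew X)
    (hlie : ∀ X ∈ 𝔤, ∀ Y ∈ 𝔤, X * Y - Y * X ∈ 𝔤) {u v : V n} (hu : u ∈ horoSpace 𝔤 p q)
    (hv : v ∈ horoSpace 𝔤 q p) : wedge u v - eta n u v • wedge q p ∈ 𝔤 := by
  obtain ⟨⟨hpu, hqu⟩, hu𝔤⟩ := mem_horoSpace.1 hu
  obtain ⟨⟨hqv, hpv⟩, hv𝔤⟩ := mem_horoSpace.1 hv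
  have h1 := hlie _ hu𝔤 _ hv𝔤
  rw [(h𝔤 _ hu𝔤).commutator_wedge, wedge_mulVec, wedge_mulVec, h.pq, eta_comm u q, hqu, hpv,
    one_smul, zero_smul, zero_smul, sub_zero, zero_sub, ← neg_smul, wedge_smul_right,
    neg_smul, ← sub_eq_add_neg] at h1
  exact h1

/-- Bracketing u ∧ v - η(u, v) q ∧ p with p ∧ u gives η(u, u) p ∧ v - 2 η(u, v) p ∧ u. As η(u, u) ≠
0, one nonzero u in E_p pulls all of E_q into E_p. -/
theorem mem_horoSpace_of_swap (h : IsNullPair p q) (h𝔤 : ∀ X ∈ 𝔤, IsSkew X)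
    (hlie : ∀ X ∈ 𝔤, ∀ Y ∈ 𝔤, X * Y - Y * X ∈ 𝔤) {u v : V n} (hu : u ∈ horoSpace 𝔤 p q)
    (hu0 : u ≠ 0) (hv : v ∈ horoSpace 𝔤 q p) : v ∈ horoSpace 𝔤 p q := by
  have hY := wedge_sub_mem h h𝔤 hlie hu hv
  obtain ⟨⟨hpu, hqu⟩, hu𝔤⟩ := mem_horoSpace.1 hu
  obtain ⟨⟨hqv, hpv⟩, hv𝔤⟩ := mem_horoSpace.1 hv
  refine mem_horoSpace.2 ⟨⟨hpv, hqv⟩, ?_⟩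
  have h1 := hlie _ hY _ hu𝔤
  have hYp : (wedge u v - eta n u v • wedge q p) *ᵥ p = (- eta n u v) • p := by
    rw [Matrix.sub_mulVec, Matrix.smul_mulVec, wedge_mulVec, wedge_mulVec, h.pp, h.qp,
      eta_comm u p, eta_comm v p, hpu, hpv]
    module
  have hYu : (wedge u v - eta n u v • wedge q p) *ᵥ u = eta n u u • v - eta n u v • u := by
    rw [Matrix.sub_mulVec, Matrix.smul_mulVec, wedge_mulVec, wedge_mulVec, hpu, hqu,
      eta_comm v u]
    module
  rw [(h𝔤 _ hY).commutator_wedge, hYp, hYu, wedge_smul_left, sub_eq_add_neg, wedge_add_right,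
    ← neg_smul, wedge_smul_right, wedge_smul_right] at h1
  have huu : eta n u u ≠ 0 := fun h0 => hu0 (h.eq_zero_of_eta_self hpu hqu h0)
  have h2 : wedge p v = (eta n u u)⁻¹ • (- eta n u v • wedge p u
      + (eta n u u • wedge p v + -eta n u v • wedge p u))
      + ((eta n u u)⁻¹ * (2 * eta n u v)) • wedge p u := by
    have h3 : wedge p v = ((eta n u u)⁻¹ * eta n u u) • wedge p v := by
      rw [inv_mul_cancel₀ huu, one_smul]
    conv_lhs => rw [h3]
    module
  rw [h2]
  exact add_mem (𝔤.smul_mem _ h1) (𝔤.smul_mem _ hu𝔤)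

/-- If `𝔤` contains all `p ∧ u` and all `q ∧ u` then it is all of `𝔰𝔬(V)`. -/
theorem mem_of_horoSpaces (h : IsNullPair p q) (h𝔤 : ∀ X ∈ 𝔤, IsSkew X)
    (hlie : ∀ X ∈ 𝔤, ∀ Y ∈ 𝔤, X * Y - Y * X ∈ 𝔤)
    (hp : ∀ u, eta n p u = 0 → eta n q u = 0 → wedge p u ∈ 𝔤)
    (hq : ∀ u, eta n p u = 0 → eta n q u = 0 → wedge q u ∈ 𝔤)
    {e : V n} (he0 : e ≠ 0) (hpe : eta n p e = 0) (hqe : eta n q e = 0)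
    {X : Mat n} (hX : IsSkew X) : X ∈ 𝔤 := by
  have hmem : ∀ u v, eta n p u = 0 → eta n q u = 0 → eta n p v = 0 → eta n q v = 0 →
      wedge u v - eta n u v • wedge q p ∈ 𝔤 := fun u v h1 h2 h3 h4 =>
    wedge_sub_mem h h𝔤 hlie (mem_horoSpace.2 ⟨⟨h1, h2⟩, hp u h1 h2⟩)
      (mem_horoSpace.2 ⟨⟨h4, h3⟩, hq v h3 h4⟩)
  -- Taking u = v = e kills e ∧ e and leaves a nonzero multiple of q ∧ p; this is where E ≠ 0 is
  -- needed.
  have hqp : wedge q p ∈ 𝔤 := by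
    have h1 := hmem e e hpe hqe hpe hqe
    have h2 : eta n e e ≠ 0 := fun h0 => he0 (h.eq_zero_of_eta_self hpe hqe h0)
    have h3 : wedge e e = 0 := by simp [wedge]
    rw [h3, zero_sub, neg_mem_iff] at h1
    exact (𝔤.smul_mem_iff h2).1 h1
  have hpq : wedge p q ∈ 𝔤 := by
    rw [wedge_swap]
    exact neg_mem hqp
  have hE : ∀ u v, eta n p u = 0 → eta n q u = 0 → eta n p v = 0 → eta n q v = 0 →
      wedge u v ∈ 𝔤 := fun u v h1 h2 h3 h4 => by
    simpa using add_mem (hmem u v h1 h2 h3 h4) (𝔤.smul_mem (eta n u v) hqp)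
  have hdec : ∀ y : V n, ∃ (c d : ℝ) (z : V n), eta n p z = 0 ∧ eta n q z = 0 ∧
      y = c • p + d • q + z := fun y =>
    ⟨eta n q y, eta n p y, y - eta n q y • p - eta n p y • q, by simp [h.pp, h.pq],
      by simp [h.qp, h.qq], by module⟩
  have hE' : ∀ u y, eta n p u = 0 → eta n q u = 0 → wedge u y ∈ 𝔤 := by
    intro u y h1 h2
    obtain ⟨c, d, z, h3, h4, rfl⟩ := hdec y
    rw [wedge_add_right, wedge_add_right, wedge_smul_right, wedge_smul_right, wedge_swap u p,
      wedge_swap u q]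
    exact add_mem (add_mem (𝔤.smul_mem _ (neg_mem (hp u h1 h2)))
      (𝔤.smul_mem _ (neg_mem (hq u h1 h2)))) (hE u z h1 h2 h3 h4)
  have hp' : ∀ y, wedge p y ∈ 𝔤 := by
    intro y
    obtain ⟨c, d, z, h3, h4, rfl⟩ := hdec y
    rw [wedge_add_right, wedge_add_right, wedge_smul_right, wedge_smul_right]
    refine add_mem (add_mem (𝔤.smul_mem _ ?_) (𝔤.smul_mem _ hpq)) (hp z h3 h4)
    simp [wedge]
  have hq' : ∀ y, wedge q y ∈ 𝔤 := by
    intro y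
    obtain ⟨c, d, z, h3, h4, rfl⟩ := hdec y
    rw [wedge_add_right, wedge_add_right, wedge_smul_right, wedge_smul_right]
    refine add_mem (add_mem (𝔤.smul_mem _ hqp) (𝔤.smul_mem _ ?_)) (hq z h3 h4)
    simp [wedge]
  obtain ⟨b, rfl, rfl⟩ := exists_nullBasis h
  rw [b.skew_expand hX]
  exact 𝔤.smul_mem _ (add_mem (add_mem (hp' _) (hq' _))
    (sum_mem fun i _ => hE' _ _ (b.eta_pe i) (b.eta_qe i)))

end

/-- The Lie algebra of a transitive group is `𝔰𝔬(V)`, or it preserves an isotropic line `ℝp` and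
contains all `p ∧ u`. -/
theorem lie_algebra_of_transitive {𝔤 : Submodule ℝ (Mat n)} (h𝔤 : ∀ X ∈ 𝔤, IsSkew X)
    (hlie : ∀ X ∈ 𝔤, ∀ Y ∈ 𝔤, X * Y - Y * X ∈ 𝔤) (htrans : ActsTransitively (expClosure 𝔤)) :
    (∃ p q : V n, IsNullPair p q ∧ (∃ e, e ≠ 0 ∧ eta n p e = 0 ∧ eta n q e = 0) ∧
      ∀ X, IsSkew X → X ∈ 𝔤) ∨
    ∃ b : NullBasis n, (∀ u, eta n b.p u = 0 → eta n b.q u = 0 → wedge b.p u ∈ 𝔤) ∧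
      ∀ X ∈ 𝔤, ∃ c : ℝ, X *ᵥ b.p = c • b.p := by
  obtain ⟨g, hg, p, q, h, a, ha, hgp, hgq⟩ := htrans.exists_loxodromic
  have ha0 : a ≠ 0 := by
    rintro rfl
    simp at ha
    linarith
  have hginv : ∀ {x : V n} {c : ℝ}, c ≠ 0 → act g x = c⁻¹ • x → act g⁻¹ x = c • x := by
    intro x c hc hx
    refine act_inv_of g ?_
    rw [act_smul, hx, smul_smul, mul_inv_cancel₀ hc, one_smul]
  have hhoro : ∀ X ∈ 𝔤, wedge p (horoPart X p q) ∈ 𝔤 := fun X hX =>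
    wedge_horoPart_mem h ha hgp hgq (fun X hX => conj_mem_of_mem_expClosure h𝔤 hlie hg hX)
      (h𝔤 X hX) hX
  have hhoro' : ∀ X ∈ 𝔤, wedge q (horoPart X q p) ∈ 𝔤 := fun X hX =>
    wedge_horoPart_mem h.symm ha (hginv ha0 hgq) (hginv (inv_ne_zero ha0) (by rwa [inv_inv]))
      (fun X hX => conj_mem_of_mem_expClosure h𝔤 hlie (inv_mem hg) hX) (h𝔤 X hX) hX
  -- The 𝔤-invariant subspace ⟨p, q⟩ + E_p + E_q.
  set W := Submodule.span ℝ {p, q} ⊔ horoSpace 𝔤 p q ⊔ horoSpace 𝔤 q p with hW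
  have hpW : p ∈ W := Submodule.mem_sup_left (Submodule.mem_sup_left
    (Submodule.subset_span (by simp)))
  have hqW : q ∈ W := Submodule.mem_sup_left (Submodule.mem_sup_left
    (Submodule.subset_span (by simp)))
  have hWinv : ∀ X ∈ 𝔤, ∀ x ∈ W, X *ᵥ x ∈ W := by
    intro X hX x hx
    suffices hle : W ≤ W.comap (Matrix.mulVecLin X) from hle hx
    refine sup_le (sup_le ?_ ?_) ?_
    · rw [Submodule.span_le]
      rintro y (rfl | rfl)
      · change X *ᵥ y ∈ W
        rw [mulVec_left_eq (h𝔤 X hX) y q]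
        exact add_mem (Submodule.mem_sup_right (horoPart_mem_horoSpace h.symm hhoro' (h𝔤 X hX) hX))
          (W.smul_mem _ hpW)
      · change X *ᵥ y ∈ W
        rw [mulVec_right_eq X p y]
        exact sub_mem (Submodule.mem_sup_left (Submodule.mem_sup_right
          (horoPart_mem_horoSpace h hhoro (h𝔤 X hX) hX))) (W.smul_mem _ hqW)
    · intro f hf
      exact Submodule.mem_sup_left (mulVec_mem_of_mem_horoSpace h h𝔤 hlie hhoro hhoro' hX hf)
    · intro f hf
      have h1 := mulVec_mem_of_mem_horoSpace h.symm h𝔤 hlie hhoro' hhoro hX hf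
      rw [Set.pair_comm] at h1
      exact (sup_le (le_sup_left.trans le_sup_left) le_sup_right :
        Submodule.span ℝ {p, q} ⊔ horoSpace 𝔤 q p ≤ W) h1
  -- W contains p - q, with η(p - q, p - q) = -2.
  have hWtop : W = ⊤ := by
    refine htrans.eq_top (preserves_expClosure h𝔤 hWinv) (sub_mem hpW hqW) ?_
    simp [h.pp, h.qq, h.pq, h.qp]
  have hE : ∀ x, eta n p x = 0 → eta n q x = 0 → x ∈ horoSpace 𝔤 p q ⊔ horoSpace 𝔤 q p := by
    intro x hpx hqx
    have hx : x ∈ W := hWtop ▸ Submodule.mem_top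
    rw [hW, sup_assoc] at hx
    obtain ⟨y, hy, z, hz, rfl⟩ := Submodule.mem_sup.1 hx
    obtain ⟨c, d, rfl⟩ := Submodule.mem_span_pair.1 hy
    have hzp : eta n p z = 0 ∧ eta n q z = 0 := by
      obtain ⟨z₁, hz₁, z₂, hz₂, rfl⟩ := Submodule.mem_sup.1 hz
      obtain ⟨⟨h1, h2⟩, -⟩ := mem_horoSpace.1 hz₁
      obtain ⟨⟨h3, h4⟩, -⟩ := mem_horoSpace.1 hz₂
      simp [h1, h2, h3, h4]
    simp [h.pp, h.pq, hzp.1] at hpx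
    simp [h.qq, h.qp, hzp.2] at hqx
    simpa [hpx, hqx] using hz
  -- Stated for any null pair, because either E_q or E_p may vanish; in the second case q spans the
  -- invariant line.
  have hpar : ∀ {p q : V n}, IsNullPair p q →
      (∀ X ∈ 𝔤, wedge q (horoPart X q p) ∈ 𝔤) → horoSpace 𝔤 q p = ⊥ →
      (∀ x, eta n p x = 0 → eta n q x = 0 → x ∈ horoSpace 𝔤 p q) →
      ∃ b : NullBasis n, (∀ u, eta n b.p u = 0 → eta n b.q u = 0 → wedge b.p u ∈ 𝔤) ∧
      ∀ X ∈ 𝔤, ∃ c : ℝ, X *ᵥ b.p = c • b.p := by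
    intro p q h hhoro' hbot hE
    obtain ⟨b, rfl, rfl⟩ := exists_nullBasis h
    refine ⟨b, fun u hu hu' => (mem_horoSpace.1 (hE u hu hu')).2, fun X hX => ?_⟩
    have h1 := horoPart_mem_horoSpace h.symm hhoro' (h𝔤 X hX) hX
    rw [hbot, Submodule.mem_bot] at h1
    exact ⟨_, by rw [mulVec_left_eq (h𝔤 X hX) b.p b.q, h1, zero_add]⟩
  by_cases hq0 : horoSpace 𝔤 q p = ⊥
  · exact Or.inr (hpar h hhoro' hq0 fun x h1 h2 => by simpa [hq0] using hE x h1 h2)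
  by_cases hp0 : horoSpace 𝔤 p q = ⊥
  · exact Or.inr (hpar h.symm hhoro hp0 fun x h1 h2 => by simpa [hp0] using hE x h2 h1)
  obtain ⟨u, hu, hu0⟩ := Submodule.exists_mem_ne_zero_of_ne_bot hp0
  obtain ⟨v, hv, hv0⟩ := Submodule.exists_mem_ne_zero_of_ne_bot hq0
  have hle : horoSpace 𝔤 q p ≤ horoSpace 𝔤 p q := fun x hx =>
    mem_horoSpace_of_swap h h𝔤 hlie hu hu0 hx
  have hle' : horoSpace 𝔤 p q ≤ horoSpace 𝔤 q p := fun x hx =>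
    mem_horoSpace_of_swap h.symm h𝔤 hlie hv hv0 hx
  obtain ⟨⟨hpu, hqu⟩, -⟩ := mem_horoSpace.1 hu
  refine Or.inl ⟨p, q, h, ⟨u, hu0, hpu, hqu⟩, fun X hX => ?_⟩
  refine mem_of_horoSpaces h h𝔤 hlie (fun x h1 h2 => ?_) (fun x h1 h2 => ?_) hu0 hpu hqu hX
  · exact (mem_horoSpace.1 (sup_le le_rfl hle (hE x h1 h2))).2
  · exact (mem_horoSpace.1 (sup_le hle' le_rfl (hE x h1 h2))).2

/-! ### The groups `A`, `K` and `N` as exponentials -/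

theorem exp_comm {X Y : Mat n} (h : X * Y = Y * X) :
    NormedSpace.exp X * NormedSpace.exp Y = NormedSpace.exp Y * NormedSpace.exp X := by
  rw [← exp_add_of_comm h, add_comm X Y, exp_add_of_comm h.symm]

/-- The subgroup of `SO(V)` fixing a vector. -/
def fixer (x : V n) : Subgroup (SO n) where
  carrier := {g | act g x = x}
  one_mem' := act_one x
  mul_mem' := fun {g h} hg hh => by
    change act (g * h) x = x
    rw [act_mul, hh, hg]
  inv_mem' := fun {g} hg => act_inv_of g hg

theorem expClosure_le_fixer {𝔤 : Submodule ℝ (Mat n)} (h𝔤 : ∀ X ∈ 𝔤, IsSkew X) {x : V n}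
    (hx : ∀ X ∈ 𝔤, X *ᵥ x = 0) : expClosure 𝔤 ≤ fixer x :=
  expClosure_induction h𝔤 fun X hX => exp_mulVec_of_kernel (hx X hX)

namespace NullBasis

variable (b : NullBasis n)

theorem wedge_qp_p : wedge b.q b.p *ᵥ b.p = b.p := by
  simp [wedge_mulVec, b.eta_pp, b.isNullPair.qp]

theorem wedge_qp_q : wedge b.q b.p *ᵥ b.q = -b.q := by
  simp [wedge_mulVec, b.eta_qq, b.eta_pq]

theorem wedge_qp_e (i : Fin n) : wedge b.q b.p *ᵥ b.e i = 0 := by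
  simp [wedge_mulVec, b.eta_qe, b.eta_pe]

/-- The trace in terms of a null basis. -/
theorem trace_eq (M : Mat n) :
    M.trace = eta n b.q (M *ᵥ b.p) + ∑ i, eta n (b.e i) (M *ᵥ b.e i) + eta n b.p (M *ᵥ b.q) := by
  have h1 : (1 : Mat n) = Matrix.vecMulVec b.p (gram n *ᵥ b.q)
      + ∑ i, Matrix.vecMulVec (b.e i) (gram n *ᵥ b.e i) + Matrix.vecMulVec b.q (gram n *ᵥ b.p) := by
    refine mat_ext fun x => ?_
    rw [Matrix.one_mulVec, Matrix.add_mulVec, Matrix.add_mulVec, Matrix.sum_mulVec]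
    simp only [Matrix.vecMulVec_mulVec, ← eta_eq_dotProduct]
    simpa using b.expand x
  have h2 : M.trace = (M * 1).trace := by rw [mul_one]
  rw [h2, h1, mul_add, mul_add, Finset.mul_sum]
  simp only [Matrix.mul_vecMulVec, Matrix.trace_add, Matrix.trace_sum, Matrix.trace_vecMulVec]
  simp only [eta_eq_dotProduct, dotProduct_comm]

/-- The element of `A` with the parameter `a = exp t`. -/
def expA (t : ℝ) : SO n := expSO (t • wedge b.q b.p) ((wedge_isSkew _ _).smul t)

theorem act_expA_p (t : ℝ) : act (b.expA t) b.p = Real.exp t • b.p :=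
  exp_mulVec_of_eigen (by rw [Matrix.smul_mulVec, b.wedge_qp_p])

theorem act_expA_q (t : ℝ) : act (b.expA t) b.q = (Real.exp t)⁻¹ • b.q := by
  rw [← Real.exp_neg]
  exact exp_mulVec_of_eigen (by rw [Matrix.smul_mulVec, b.wedge_qp_q]; module)

theorem act_expA_e (t : ℝ) (i : Fin n) : act (b.expA t) (b.e i) = b.e i :=
  exp_mulVec_of_kernel (by rw [Matrix.smul_mulVec, b.wedge_qp_e, smul_zero])

theorem expA_mem (t : ℝ) : b.expA t ∈ groupA b :=
  ⟨Real.exp t, Real.exp_pos t, b.act_expA_p t, b.act_expA_e t, b.act_expA_q t⟩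

/-- The factor by which a group element stretches the null vector `p`. -/
def stretch (g : SO n) : ℝ := eta n (act g b.p) b.q

theorem stretch_of_act {g : SO n} {a : ℝ} (h : act g b.p = a • b.p) : b.stretch g = a := by
  simp [stretch, h, b.eta_pq]

theorem stretch_expA (t : ℝ) : b.stretch (b.expA t) = Real.exp t :=
  b.stretch_of_act (b.act_expA_p t)

theorem stretch_pos {g : SO n} (hg : g ∈ groupA b) : 0 < b.stretch g := by
  obtain ⟨a, ha, h, -⟩ := hg
  rwa [b.stretch_of_act h]

theorem eq_expA {g : SO n} (hg : g ∈ groupA b) : g = b.expA (Real.log (b.stretch g)) := by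
  have hpos := b.stretch_pos hg
  obtain ⟨a, ha, h1, h2, h3⟩ := hg
  rw [b.stretch_of_act h1] at hpos ⊢
  refine b.ext_act ?_ (fun i => ?_) ?_
  · rw [h1, b.act_expA_p, Real.exp_log hpos]
  · rw [h2, b.act_expA_e]
  · rw [h3, b.act_expA_q, Real.exp_log hpos]

theorem stretch_mul {g h : SO n} (hg : g ∈ groupA b) (hh : h ∈ groupA b) :
    b.stretch (g * h) = b.stretch g * b.stretch h := by
  obtain ⟨a, -, h1, -⟩ := hg
  obtain ⟨c, -, h2, -⟩ := hh
  rw [b.stretch_of_act h1, b.stretch_of_act h2]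
  refine b.stretch_of_act ?_
  rw [act_mul, h2, act_smul, h1, smul_smul, mul_comm]

/-- Fixing p and q forces g to preserve E, and the determinant of the block on E is that of g. -/
theorem mem_groupK {g : SO n} (hp : act g b.p = b.p) (hq : act g b.q = b.q) : g ∈ groupK b := by
  set f : Matrix (Fin n) (Fin n) ℝ := Matrix.of fun i j => eta n (b.e i) (act g (b.e j)) with hf
  have hpe : ∀ j, eta n b.p (act g (b.e j)) = 0 := fun j => by
    have := eta_act g b.p (b.e j)
    rwa [hp, b.eta_pe] at this
  have hqe : ∀ j, eta n b.q (act g (b.e j)) = 0 := fun j => by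
    have := eta_act g b.q (b.e j)
    rwa [hq, b.eta_qe] at this
  have hge : ∀ j, act g (b.e j) = ∑ i, f i j • b.e i := fun j =>
    b.expand_of_orthogonal (hpe j) (hqe j)
  refine ⟨f, Matrix.mem_specialOrthogonalGroup_iff.2 ⟨?_, ?_⟩, hp, hge, hq⟩
  · rw [Matrix.mem_orthogonalGroup_iff']
    ext i j
    have h1 := eta_act g (b.e i) (b.e j)
    rw [b.eta_ee, hge j, map_sum] at h1
    rw [Matrix.mul_apply, Matrix.one_apply, ← h1]
    refine Finset.sum_congr rfl fun k _ => ?_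
    rw [map_smul, smul_eq_mul, eta_comm]
    exact mul_comm _ _
  · have h1 : LinearMap.det (Matrix.mulVecLin (mat g)) = 1 := by
      rw [← Matrix.toLin'_apply', LinearMap.det_toLin']
      exact g.2.2
    rw [← LinearMap.det_toMatrix b.basis] at h1
    have h2 : LinearMap.toMatrix b.basis b.basis (Matrix.mulVecLin (mat g))
        = Matrix.fromBlocks 1 0 0 (Matrix.fromBlocks f 0 0 1) := by
      have hp' : Matrix.mulVecLin (mat g) (b.basis (Sum.inl ())) = b.basis (Sum.inl ()) := by
        rw [b.basis_p]; exact hp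
      have hq' : Matrix.mulVecLin (mat g) (b.basis (Sum.inr (Sum.inr ())))
          = b.basis (Sum.inr (Sum.inr ())) := by
        rw [b.basis_q]; exact hq
      have he' : ∀ j, Matrix.mulVecLin (mat g) (b.basis (Sum.inr (Sum.inl j)))
          = ∑ i, f i j • b.basis (Sum.inr (Sum.inl i)) := by
        intro j
        simp only [b.basis_e]
        exact hge j
      ext i j
      rw [LinearMap.toMatrix_apply]
      rcases j with _ | j | _
      · rw [hp', Module.Basis.repr_self]
        rcases i with _ | i | _ <;> simp
      · rw [he', map_sum]
        simp only [map_smul, Module.Basis.repr_self]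
        rcases i with _ | i | _ <;> simp [Finsupp.single_apply]
      · rw [hq', Module.Basis.repr_self]
        rcases i with _ | i | _ <;> simp
    rw [h2, Matrix.det_fromBlocks_zero₂₁, Matrix.det_fromBlocks_zero₂₁] at h1
    simpa using h1

theorem act_p_of_mem_groupK {g : SO n} (hg : g ∈ groupK b) : act g b.p = b.p := by
  obtain ⟨f, -, h, -⟩ := hg
  exact h

theorem act_q_of_mem_groupK {g : SO n} (hg : g ∈ groupK b) : act g b.q = b.q := by
  obtain ⟨f, -, -, -, h⟩ := hg
  exact h

/-- `N` consists of the elements that act trivially on `p` and on `p^⊥ / p`. -/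
theorem mem_groupN {g : SO n} (hp : act g b.p = b.p)
    (he : ∀ i, ∃ c : ℝ, act g (b.e i) = b.e i + c • b.p) : g ∈ groupN b := by
  choose c hc using he
  -- The image of q is determined by its pairings: invariance of η(p, q) and η(e_i, q) gives those
  -- with p and e_i, and η(q, q) = 0 gives the remaining one.
  have h1 : eta n b.p (act g b.q) = 1 := by
    have := eta_act g b.p b.q
    rwa [hp, b.eta_pq] at this
  have h2 : ∀ i, eta n (b.e i) (act g b.q) = - c i := fun i => by
    have := eta_act g (b.e i) b.q
    rw [hc, b.eta_eq, map_add, map_smul, LinearMap.add_apply, LinearMap.smul_apply, h1,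
      smul_eq_mul] at this
    linarith
  have h3 : eta n b.q (act g b.q) = - (1 / 2 * ∑ i, c i ^ 2) := by
    have := eta_act g b.q b.q
    rw [b.eta_qq, b.eta_self, h1] at this
    simp only [h2, neg_sq] at this
    linarith
  refine ⟨fun i => - c i, hp, fun i => by rw [hc]; module, ?_⟩
  rw [b.expand (act g b.q), h1, h3]
  simp only [h2, ← pow_two, neg_sq]
  module

theorem act_e_of_mem_groupN {g : SO n} (hg : g ∈ groupN b) {y : V n} (hy : eta n b.p y = 0) :
    ∃ c : ℝ, act g y = y + c • b.p := by
  obtain ⟨X, hp, he, -⟩ := hg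
  rw [b.expand y, hy, zero_smul, add_zero, act_add, act_sum]
  refine ⟨- ∑ i, eta n (b.e i) y * X i, ?_⟩
  simp only [act_smul, hp, he, smul_sub, Finset.sum_sub_distrib, neg_smul, Finset.sum_smul,
    smul_smul]
  module

theorem act_p_of_mem_groupN {g : SO n} (hg : g ∈ groupN b) : act g b.p = b.p := by
  obtain ⟨X, hp, -⟩ := hg
  exact hp

/-- Elements that preserve the line `ℝp` normalize `N`. -/
theorem conj_mem_groupN {g x : SO n} {c : ℝ} (hg : act g b.p = c • b.p) (hx : x ∈ groupN b) :
    g * x * g⁻¹ ∈ groupN b := by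
  have hc : c ≠ 0 := by
    rintro rfl
    rw [zero_smul] at hg
    exact b.isNullPair.left_ne_zero (by rw [← act_inv_act g b.p, hg, act_zero])
  have hg' : act g⁻¹ b.p = c⁻¹ • b.p := by
    refine act_inv_of g ?_
    rw [act_smul, hg, smul_smul, inv_mul_cancel₀ hc, one_smul]
  refine b.mem_groupN ?_ fun i => ?_
  · rw [act_mul, act_mul, hg', act_smul, b.act_p_of_mem_groupN hx, act_smul, hg, smul_smul,
      inv_mul_cancel₀ hc, one_smul]
  · have h1 : eta n b.p (act g⁻¹ (b.e i)) = 0 := by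
      rw [eta_comm, eta_act_left, inv_inv, hg, map_smul, b.eta_ep, smul_zero]
    obtain ⟨d, hd⟩ := b.act_e_of_mem_groupN hx h1
    exact ⟨d * c, by rw [act_mul, act_mul, hd, act_add, act_act_inv, act_smul, hg, smul_smul]⟩

/-- Makes N meet the groups that preserve ℝq trivially. -/
theorem eq_one_of_mem_groupN {g : SO n} (hg : g ∈ groupN b) {c : ℝ} (h : act g b.q = c • b.q) :
    g = 1 := by
  obtain ⟨X, hp, he, hq⟩ := hg
  have hX : ∀ i, X i = 0 := by
    intro i
    have h1 := congrArg (eta n (b.e i)) (hq.symm.trans h)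
    simpa [b.eta_eq, b.eta_ep, b.eta_ee] using h1
  refine b.ext_act ?_ (fun i => ?_) ?_
  · rw [hp, act_one]
  · rw [he, act_one, hX]
    simp
  · rw [hq, act_one]
    simp [hX]

end NullBasis

/-- p ∧ u has cube zero, so the exponential series stops at degree two. -/
theorem exp_wedge_mulVec {p u : V n} (hpp : eta n p p = 0) (hpu : eta n p u = 0) (x : V n) :
    NormedSpace.exp (wedge p u) *ᵥ x
      = x + wedge p u *ᵥ x + (1 / 2 : ℝ) • wedge p u *ᵥ (wedge p u *ᵥ x) := by
  have h3 : (wedge p u) ^ 3 = 0 := by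
    refine mat_ext fun x => ?_
    simp only [pow_succ, pow_zero, one_mul, ← Matrix.mulVec_mulVec]
    simp [wedge_mulVec, Matrix.mulVec_sub, Matrix.mulVec_smul, hpp, hpu, eta_comm u p]
  have h1 : NormedSpace.exp (wedge p u) = ∑ k ∈ Finset.range 3,
      ((k.factorial : ℝ)⁻¹) • (wedge p u) ^ k := by
    refine (hasSum_exp (wedge p u)).unique (hasSum_sum_of_ne_finset_zero fun k hk => ?_)
    rw [pow_eq_zero_of_le (by simpa using hk) h3, smul_zero]
  rw [h1]
  simp [Finset.sum_range_succ, Matrix.add_mulVec, Matrix.smul_mulVec, pow_two,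
    ← Matrix.mulVec_mulVec, Nat.factorial]

/-- `N` consists of the exponentials of the `p ∧ u` with `u ∈ E`. -/
theorem NullBasis.exists_eq_exp_of_mem_groupN (b : NullBasis n) {g : SO n} (hg : g ∈ groupN b) :
    ∃ u : V n, eta n b.p u = 0 ∧ eta n b.q u = 0 ∧
      g = expSO (wedge b.p u) (wedge_isSkew _ _) := by
  obtain ⟨X, hp, he, hq⟩ := hg
  have hpu : eta n b.p (∑ i, X i • b.e i) = 0 := by simp [b.eta_pe]
  have hqu : eta n b.q (∑ i, X i • b.e i) = 0 := by simp [b.eta_qe]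
  have heu : ∀ i, eta n (∑ i, X i • b.e i) (b.e i) = X i := fun i => by
    rw [eta_comm]
    simp [b.eta_ee]
  set u := ∑ i, X i • b.e i with hu
  have huu : eta n u u = ∑ i, X i * X i := by
    conv_lhs => enter [2]; rw [hu]
    rw [map_sum]
    exact Finset.sum_congr rfl fun i _ => by rw [map_smul, heu, smul_eq_mul]
  refine ⟨u, hpu, hqu, b.ext_act ?_ (fun i => ?_) ?_⟩
  · rw [hp, act_expSO, exp_wedge_mulVec b.eta_pp hpu]
    simp [wedge_mulVec, b.eta_pp, eta_comm u, hpu]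
  · rw [he, act_expSO, exp_wedge_mulVec b.eta_pp hpu]
    simp [wedge_mulVec, b.eta_pe, heu, b.eta_pp, eta_comm u b.p, hpu, sub_eq_add_neg,
      Matrix.mulVec_neg, Matrix.mulVec_smul]
  · rw [hq, act_expSO, exp_wedge_mulVec b.eta_pp hpu]
    simp only [wedge_mulVec, b.eta_pq, eta_comm u b.q, hqu, hpu, huu, one_smul, zero_smul,
      sub_zero, zero_sub]
    module

/-- X and X₀ agree on p and induce the same map on p^⊥/p, hence so do their exponentials. The
quotient acts trivially on both, which characterizes N. -/
theorem inv_mul_exp_mem_groupN (b : NullBasis n) {X X₀ : Mat n} (hX : IsSkew X) (hX₀ : IsSkew X₀)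
    {u : V n} {c : ℝ} (hu : eta n b.p u = 0) (hp : X₀ *ᵥ b.p = c • b.p)
    (hXX : X = X₀ + wedge b.p u) : (expSO X₀ hX₀)⁻¹ * expSO X hX ∈ groupN b := by
  have hwp : wedge b.p u *ᵥ b.p = 0 := by simp [wedge_mulVec, b.eta_pp, eta_comm u, hu]
  have hXp : X *ᵥ b.p = c • b.p := by rw [hXX, Matrix.add_mulVec, hwp, hp, add_zero]
  have hep : act (expSO X hX) b.p = Real.exp c • b.p := exp_mulVec_of_eigen hXp
  have hep₀ : act (expSO X₀ hX₀) b.p = Real.exp c • b.p := exp_mulVec_of_eigen hp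
  -- The matrices that map p^⊥ into ℝp, that is, vanish on p^⊥ modulo p; all the differences Xᵏ -
  -- X₀ᵏ lie here.
  let S : Submodule ℝ (Mat n) :=
    { carrier := {M | ∀ y, eta n b.p y = 0 → M *ᵥ y ∈ Submodule.span ℝ {b.p}}
      add_mem' := fun {M N} hM hN y hy => by
        rw [Matrix.add_mulVec]
        exact add_mem (hM y hy) (hN y hy)
      zero_mem' := fun y _ => by simp
      smul_mem' := fun c M hM y hy => by
        rw [Matrix.smul_mulVec]
        exact Submodule.smul_mem _ c (hM y hy) }
  have hS : ∀ k : ℕ, X ^ k - X₀ ^ k ∈ S := by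
    intro k
    induction k with
    | zero => simp
    | succ k ih =>
      intro y hy
      have hXk : X ^ k *ᵥ b.p = c ^ k • b.p := by
        clear ih
        induction k with
        | zero => simp
        | succ k ih => rw [pow_succ, ← Matrix.mulVec_mulVec, hXp, Matrix.mulVec_smul, ih,
            smul_smul, pow_succ, mul_comm]
      have h1 : X ^ (k + 1) - X₀ ^ (k + 1) = X ^ k * wedge b.p u + (X ^ k - X₀ ^ k) * X₀ := by
        rw [pow_succ, pow_succ, sub_mul]
        conv_lhs => enter [1]; rw [hXX, mul_add, ← hXX]
        abel
      rw [h1, Matrix.add_mulVec, ← Matrix.mulVec_mulVec, ← Matrix.mulVec_mulVec]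
      refine add_mem ?_ (ih _ ?_)
      · rw [wedge_mulVec, hy, zero_smul, zero_sub, ← neg_smul, Matrix.mulVec_smul, hXk]
        exact Submodule.smul_mem _ _ (Submodule.smul_mem _ _ (Submodule.mem_span_singleton_self _))
      · have := hX₀ b.p y
        rw [hp, map_smul, LinearMap.smul_apply, hy, smul_zero, zero_add] at this
        exact this
  have hsub := exp_sub_exp_mem S hS
  refine b.mem_groupN ?_ fun i => ?_
  · rw [act_mul, hep, ← hep₀, act_inv_act]
  · obtain ⟨d, hd⟩ := Submodule.mem_span_singleton.1 (hsub (b.e i) (b.eta_pe i))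
    rw [Matrix.sub_mulVec] at hd
    have h1 : act (expSO X hX) (b.e i) = act (expSO X₀ hX₀) (b.e i)
        + (d * (Real.exp c)⁻¹) • act (expSO X₀ hX₀) b.p := by
      rw [hep₀, smul_smul, mul_assoc, inv_mul_cancel₀ (Real.exp_ne_zero c), mul_one, hd]
      simp [act_expSO]
    exact ⟨_, by rw [act_mul, h1, act_add, act_smul, act_inv_act, act_inv_act]⟩

/-! ### The twisted groups `A^Φ` -/

/-- The rotational generators: skew endomorphisms that kill `p` and `q`. -/
structure IsRotGen (b : NullBasis n) (B : Mat n) : Prop where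
  skew : IsSkew B
  p : B *ᵥ b.p = 0
  q : B *ᵥ b.q = 0

theorem IsRotGen.comm {b : NullBasis n} {B : Mat n} (hB : IsRotGen b B) :
    B * wedge b.q b.p = wedge b.q b.p * B := by
  rw [← sub_eq_zero, hB.skew.commutator_wedge, hB.p, hB.q, wedge_zero_right, wedge_swap,
    wedge_zero_right]
  simp

theorem IsRotGen.smul {b : NullBasis n} {B : Mat n} (hB : IsRotGen b B) (t : ℝ) :
    IsRotGen b (t • B) :=
  ⟨hB.skew.smul t, by rw [Matrix.smul_mulVec, hB.p, smul_zero],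
    by rw [Matrix.smul_mulVec, hB.q, smul_zero]⟩

theorem IsRotGen.exp_mem {b : NullBasis n} {B : Mat n} (hB : IsRotGen b B) :
    expSO B hB.skew ∈ groupK b :=
  b.mem_groupK (exp_mulVec_of_kernel hB.p) (exp_mulVec_of_kernel hB.q)

/-- The homomorphism `A → K` sending the element with parameter `a` to `exp (log a • B)`. -/
def phiHom (b : NullBasis n) (B : Mat n) (hB : IsRotGen b B) : groupA b →* groupK b :=
  MonoidHom.mk' (fun g => ⟨_, (hB.smul (Real.log (b.stretch g))).exp_mem⟩) fun g h => by
    refine Subtype.ext (mat_injective ?_)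
    change NormedSpace.exp _ = NormedSpace.exp _ * NormedSpace.exp _
    rw [← exp_add_smul, ← Real.log_mul (b.stretch_pos g.2).ne' (b.stretch_pos h.2).ne',
      ← b.stretch_mul g.2 h.2]
    rfl

theorem mat_phiHom {b : NullBasis n} {B : Mat n} (hB : IsRotGen b B) (g : groupA b) :
    mat (phiHom b B hB g : SO n) = NormedSpace.exp (Real.log (b.stretch g) • B) := rfl

theorem continuous_phiHom {b : NullBasis n} {B : Mat n} (hB : IsRotGen b B) :
    Continuous (phiHom b B hB) := by
  rw [(isEmbedding_mat.comp Topology.IsEmbedding.subtypeVal).continuous_iff]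
  change Continuous fun g : groupA b => NormedSpace.exp (Real.log (b.stretch g) • B)
  have h1 : Continuous fun g : groupA b => b.stretch g := by
    have h2 : Continuous fun g : groupA b => mat (g : SO n) :=
      isEmbedding_mat.continuous.comp continuous_subtype_val
    simp only [NullBasis.stretch, eta_eq_dotProduct, act]
    fun_prop
  exact continuous_exp.comp ((h1.log fun g => (b.stretch_pos g.2).ne').smul continuous_const)

theorem mem_groupAPhi_phiHom {b : NullBasis n} {B : Mat n} (hB : IsRotGen b B)
    (hs : IsSkew (wedge b.q b.p + B)) {g : SO n} :
    g ∈ groupAPhi b (phiHom b B hB) ↔ ∃ t : ℝ, g = expSO (t • (wedge b.q b.p + B)) (hs.smul t) := by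
  have key : ∀ t : ℝ, NormedSpace.exp (t • (wedge b.q b.p + B))
      = NormedSpace.exp (t • B) * NormedSpace.exp (t • wedge b.q b.p) := by
    intro t
    rw [add_comm (wedge b.q b.p), smul_add]
    refine exp_add_of_comm ?_
    simp only [smul_mul_assoc, mul_smul_comm, hB.comm]
  constructor
  · rintro ⟨a, rfl⟩
    refine ⟨Real.log (b.stretch a), mat_injective ?_⟩
    rw [mat_mul, mat_phiHom, mat_expSO, key]
    conv_lhs => rw [b.eq_expA a.2]
    rw [NullBasis.expA, mat_expSO, ← NullBasis.expA, b.stretch_expA, Real.log_exp]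
  · rintro ⟨t, rfl⟩
    refine ⟨⟨b.expA t, b.expA_mem t⟩, mat_injective ?_⟩
    rw [mat_mul, mat_phiHom, mat_expSO, key, b.stretch_expA, Real.log_exp]
    rfl

theorem groupAPhi_one (b : NullBasis n) : groupAPhi b 1 = groupA b := by
  ext g
  constructor
  · rintro ⟨a, rfl⟩
    simp
  · intro hg
    exact ⟨⟨g, hg⟩, by simp⟩

/-- The group generated by the exponentials of `ℝ(q ∧ p + B) ⊕ 𝔥 ⊕ p ∧ E`. -/
theorem isProductForm_expClosure (b : NullBasis n) {B : Mat n} (hB : IsRotGen b B)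
    {𝔤 𝔥 : Submodule ℝ (Mat n)} (h𝔥 : ∀ Y ∈ 𝔥, IsRotGen b Y) (hB𝔥 : ∀ Y ∈ 𝔥, B * Y = Y * B)
    (h𝔤s : ∀ X ∈ 𝔤, IsSkew X)
    (h𝔤 : ∀ X, X ∈ 𝔤 ↔ ∃ (s : ℝ) (Y : Mat n) (u : V n), Y ∈ 𝔥 ∧ eta n b.p u = 0 ∧
      eta n b.q u = 0 ∧ X = s • (wedge b.q b.p + B) + Y + wedge b.p u) :
    expClosure 𝔥 ≤ groupK b ∧ IsProductForm (expClosure 𝔤) (groupAPhi b (phiHom b B hB))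
      (expClosure 𝔥) (groupN b) := by
  set Z := wedge b.q b.p + B with hZ
  have hZs : IsSkew Z := (wedge_isSkew _ _).add hB.skew
  have hZp : Z *ᵥ b.p = b.p := by rw [hZ, Matrix.add_mulVec, b.wedge_qp_p, hB.p, add_zero]
  have hZq : Z *ᵥ b.q = -b.q := by rw [hZ, Matrix.add_mulVec, b.wedge_qp_q, hB.q, add_zero]
  have hZY : ∀ Y ∈ 𝔥, Z * Y = Y * Z := fun Y hY => by
    rw [hZ, add_mul, mul_add, hB𝔥 Y hY, (h𝔥 Y hY).comm]
  have h𝔥s : ∀ Y ∈ 𝔥, IsSkew Y := fun Y hY => (h𝔥 Y hY).skew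
  have hHK : expClosure 𝔥 ≤ groupK b := expClosure_induction h𝔥s fun Y hY => (h𝔥 Y hY).exp_mem
  refine ⟨hHK, _ ⊔ _, ⟨?_, ?_, rfl⟩, ⟨?_, ?_, ?_⟩⟩
  · intro x hx y hy
    obtain ⟨t, rfl⟩ := (mem_groupAPhi_phiHom hB hZs).1 hx
    have hle : expClosure 𝔥 ≤ Subgroup.centralizer {expSO (t • Z) (hZs.smul t)} := by
      refine expClosure_induction h𝔥s fun Y hY => ?_
      rw [Subgroup.mem_centralizer_singleton_iff]
      refine mat_injective ?_
      rw [mat_mul, mat_mul, mat_expSO, mat_expSO]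
      refine exp_comm ?_
      rw [smul_mul_assoc, mul_smul_comm, hZY Y hY]
    exact (Subgroup.mem_centralizer_singleton_iff.1 (hle hy)).symm
  -- An element of H fixes p, whereas exp(tZ) scales it by exp t, so t = 0.
  · rw [eq_bot_iff]
    rintro x ⟨hx, hxH⟩
    obtain ⟨t, rfl⟩ := (mem_groupAPhi_phiHom hB hZs).1 hx
    have h1 : act (expSO (t • Z) (hZs.smul t)) b.p = Real.exp t • b.p :=
      exp_mulVec_of_eigen (by rw [Matrix.smul_mulVec, hZp])
    rw [b.act_p_of_mem_groupK (hHK hxH)] at h1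
    have h2 : Real.exp t = 1 := by
      have := congrArg (eta n b.q) h1
      simpa [b.isNullPair.qp] using this.symm
    have h3 : t = 0 := by simpa using h2
    subst h3
    refine Subgroup.mem_bot.2 (mat_injective ?_)
    rw [mat_expSO, zero_smul, NormedSpace.exp_zero, mat_one]
  · intro g hg x hx
    have hpres : Preserves (expClosure 𝔤) (Submodule.span ℝ {b.p}) := by
      refine preserves_expClosure h𝔤s fun X hX y hy => ?_
      obtain ⟨c, rfl⟩ := Submodule.mem_span_singleton.1 hy
      obtain ⟨s, Y, u, hY, hu, -, rfl⟩ := (h𝔤 X).1 hX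
      have h1 : (s • Z + Y + wedge b.p u) *ᵥ b.p = s • b.p := by
        simp [Matrix.add_mulVec, Matrix.smul_mulVec, hZp, (h𝔥 Y hY).p, wedge_mulVec, b.eta_pp,
          eta_comm u, hu]
      rw [Matrix.mulVec_smul, h1, smul_smul]
      exact Submodule.smul_mem _ _ (Submodule.mem_span_singleton_self _)
    obtain ⟨c, hc⟩ := Submodule.mem_span_singleton.1
      (hpres g hg b.p (Submodule.mem_span_singleton_self _))
    exact b.conj_mem_groupN hc.symm hx
  · rw [eq_bot_iff]
    rintro x ⟨hx, hxN⟩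
    -- Both A^Φ and H preserve ℝq, which no nontrivial element of N does.
    have hle : groupAPhi b (phiHom b B hB) ⊔ expClosure 𝔥 ≤
        stabilizer (Submodule.span ℝ {b.q}) := by
      refine sup_le (fun y hy => ?_) (fun y hy => ?_)
      · have key : ∀ t : ℝ, ∀ y ∈ Submodule.span ℝ {b.q},
            act (expSO (t • Z) (hZs.smul t)) y ∈ Submodule.span ℝ {b.q} := fun t y hy => by
          obtain ⟨c, rfl⟩ := Submodule.mem_span_singleton.1 hy
          have h1 : act (expSO (t • Z) (hZs.smul t)) b.q = Real.exp (-t) • b.q :=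
            exp_mulVec_of_eigen (by rw [Matrix.smul_mulVec, hZq]; module)
          rw [act_smul, h1]
          exact Submodule.smul_mem _ _ (Submodule.smul_mem _ _ (Submodule.mem_span_singleton_self _))
        obtain ⟨t, rfl⟩ := (mem_groupAPhi_phiHom hB hZs).1 hy
        refine ⟨key t, ?_⟩
        have h2 : (expSO (t • Z) (hZs.smul t))⁻¹ = expSO ((-t) • Z) (hZs.smul (-t)) := by
          refine mat_injective ?_
          rw [expSO_inv, mat_expSO, mat_expSO, neg_smul]
        rw [h2]
        exact key (-t)
      · have key : ∀ z ∈ expClosure 𝔥, ∀ y ∈ Submodule.span ℝ {b.q},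
            act z y ∈ Submodule.span ℝ {b.q} := fun z hz y hy => by
          obtain ⟨c, rfl⟩ := Submodule.mem_span_singleton.1 hy
          rw [act_smul, b.act_q_of_mem_groupK (hHK hz)]
          exact Submodule.smul_mem _ _ (Submodule.mem_span_singleton_self _)
        exact ⟨key y hy, key _ (inv_mem hy)⟩
    obtain ⟨c, hc⟩ := Submodule.mem_span_singleton.1
      ((hle hx).1 b.q (Submodule.mem_span_singleton_self _))
    exact Subgroup.mem_bot.2 (b.eq_one_of_mem_groupN hxN hc.symm)
  · refine le_antisymm (sup_le (sup_le ?_ ?_) ?_) (expClosure_induction h𝔤s fun X hX => ?_)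
    · intro x hx
      obtain ⟨t, rfl⟩ := (mem_groupAPhi_phiHom hB hZs).1 hx
      exact expSO_mem_expClosure _ ((h𝔤 _).2 ⟨t, 0, 0, zero_mem _, by simp, by simp,
        by rw [add_zero, wedge_zero_right, add_zero]⟩)
    · refine expClosure_induction h𝔥s fun Y hY => expSO_mem_expClosure _ ((h𝔤 _).2 ⟨0, Y, 0, hY,
        by simp, by simp, by simp [wedge_zero_right]⟩)
    · intro x hx
      obtain ⟨u, hu, hu', rfl⟩ := b.exists_eq_exp_of_mem_groupN hx
      exact expSO_mem_expClosure _ ((h𝔤 _).2 ⟨0, 0, u, zero_mem _, hu, hu', by simp⟩)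
    · obtain ⟨s, Y, u, hY, hu, hu', hXe⟩ := (h𝔤 X).1 hX
      have hYs := h𝔥s Y hY
      have hX₀ : IsSkew (s • Z + Y) := (hZs.smul s).add hYs
      -- exp X equals exp(sZ + Y) times an element of N, and exp(sZ + Y) = exp(sZ) exp Y because Z
      -- and Y commute.
      have h1 := inv_mul_exp_mem_groupN b (h𝔤s X hX) hX₀ (c := s) hu (by
        rw [Matrix.add_mulVec, Matrix.smul_mulVec, hZp, (h𝔥 Y hY).p, add_zero]) hXe
      have h2 : expSO (s • Z + Y) hX₀ = expSO (s • Z) (hZs.smul s) * expSO Y hYs := by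
        refine mat_injective ?_
        rw [mat_mul, mat_expSO, mat_expSO, mat_expSO]
        exact exp_add_of_comm (by rw [smul_mul_assoc, mul_smul_comm, hZY Y hY])
      have h3 : expSO (s • Z + Y) hX₀ ∈ groupAPhi b (phiHom b B hB) ⊔ expClosure 𝔥 := by
        rw [h2]
        exact mul_mem (Subgroup.mem_sup_left ((mem_groupAPhi_phiHom hB hZs).2 ⟨s, rfl⟩))
          (Subgroup.mem_sup_right (expSO_mem_expClosure _ hY))
      have h4 := mul_mem (Subgroup.mem_sup_left h3 :
        _ ∈ (groupAPhi b (phiHom b B hB) ⊔ expClosure 𝔥) ⊔ groupN b) (Subgroup.mem_sup_right h1)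
      rwa [mul_inv_cancel_left] at h4

/-! ### Transitive parabolic Lie algebras -/

/-- tr Y² = -∑ η(Y e_i, Y e_i) with all Y e_i in the positive definite space E, so the trace form is
negative definite on rotational generators. -/
theorem IsRotGen.trace_mul_self {b : NullBasis n} {Y : Mat n} (hY : IsRotGen b Y)
    (h : (Y * Y).trace = 0) : Y = 0 := by
  have hpe : ∀ i, eta n b.p (Y *ᵥ b.e i) = 0 := fun i => by
    have := hY.skew b.p (b.e i)
    rwa [hY.p, map_zero, LinearMap.zero_apply, zero_add] at this
  have hqe : ∀ i, eta n b.q (Y *ᵥ b.e i) = 0 := fun i => by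
    have := hY.skew b.q (b.e i)
    rwa [hY.q, map_zero, LinearMap.zero_apply, zero_add] at this
  have h1 : ∀ i, eta n (b.e i) ((Y * Y) *ᵥ b.e i) = - eta n (Y *ᵥ b.e i) (Y *ᵥ b.e i) := by
    intro i
    rw [← Matrix.mulVec_mulVec, hY.skew.eta_left, neg_neg]
  rw [b.trace_eq, ← Matrix.mulVec_mulVec, ← Matrix.mulVec_mulVec b.q, hY.p, hY.q] at h
  simp only [h1, Matrix.mulVec_zero, map_zero, zero_add, add_zero, Finset.sum_neg_distrib,
    neg_eq_zero] at h
  rw [Finset.sum_eq_zero_iff_of_nonneg fun i _ => b.isNullPair.eta_self_nonneg (hpe i)] at h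
  refine b.mulVec_ext ?_ (fun i => ?_) ?_
  · rw [hY.p, Matrix.zero_mulVec]
  · rw [b.isNullPair.eq_zero_of_eta_self (hpe i) (hqe i) (h i (Finset.mem_univ i)),
      Matrix.zero_mulVec]
  · rw [hY.q, Matrix.zero_mulVec]

/-- Otherwise G would fix p and η(·, p) would be constant on L. -/
theorem ActsTransitively.exists_mulVec_ne_zero {𝔤 : Submodule ℝ (Mat n)}
    (h𝔤 : ∀ X ∈ 𝔤, IsSkew X) (htrans : ActsTransitively (expClosure 𝔤)) {p : V n} (hp : p ≠ 0) :
    ∃ X ∈ 𝔤, X *ᵥ p ≠ 0 := by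
  by_contra! hcon
  refine hp (eq_zero_of_eta_sq_const (c := eta n (basePoint n) p ^ 2) fun x hx => ?_)
  obtain ⟨g, hg, rfl⟩ := htrans.2 _ basePoint_mem _ hx
  have h1 : act g p = p := expClosure_le_fixer h𝔤 hcon hg
  conv_lhs => rw [← h1, eta_act]

/-- A subspace of rotational generators that is normalized by `Z` contains an element that
differs from `Z` by something centralizing it. -/
theorem exists_sub_centralizes {b : NullBasis n} {𝔥 : Submodule ℝ (Mat n)}
    (h𝔥 : ∀ Y ∈ 𝔥, IsRotGen b Y) (hlie : ∀ X ∈ 𝔥, ∀ Y ∈ 𝔥, X * Y - Y * X ∈ 𝔥) {Z : Mat n}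
    (hZ : ∀ Y ∈ 𝔥, Z * Y - Y * Z ∈ 𝔥) :
    ∃ Y₀ ∈ 𝔥, ∀ Y ∈ 𝔥, (Z - Y₀) * Y = Y * (Z - Y₀) := by
  let T : LinearMap.BilinForm ℝ 𝔥 := LinearMap.mk₂ ℝ
    (fun X Y => ((X : Mat n) * (Y : Mat n)).trace) (fun X Y W => by simp [add_mul])
    (fun c X Y => by simp) (fun X Y W => by simp [mul_add]) (fun c X Y => by simp)
  have hT : ∀ X Y : 𝔥, T X Y = ((X : Mat n) * (Y : Mat n)).trace := fun _ _ => rfl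
  have hnd : T.Nondegenerate := by
    refine ⟨fun X hX => ?_, fun X hX => ?_⟩ <;>
    exact Subtype.ext ((h𝔥 X X.2).trace_mul_self (hX X))
  -- Y₀ represents the functional Y ↦ tr(ZY), so Z - Y₀ is trace-orthogonal to 𝔥.
  let φ : 𝔥 →ₗ[ℝ] ℝ :=
    { toFun := fun Y => (Z * (Y : Mat n)).trace
      map_add' := fun X Y => by simp [mul_add]
      map_smul' := fun c X => by simp }
  obtain ⟨Y₀, hY₀⟩ := (T.toDual hnd).surjective φ
  have horth : ∀ Y ∈ 𝔥, ((Z - Y₀) * Y).trace = 0 := by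
    intro Y hY
    have := LinearMap.congr_fun hY₀ ⟨Y, hY⟩
    rw [LinearMap.BilinForm.toDual_def, hT] at this
    rw [sub_mul, Matrix.trace_sub, this]
    exact sub_self _
  refine ⟨Y₀, Y₀.2, fun Y hY => ?_⟩
  have hmem : (Z - Y₀) * Y - Y * (Z - Y₀) ∈ 𝔥 := by
    have := sub_mem (hZ Y hY) (hlie _ Y₀.2 _ hY)
    rwa [show (Z - (Y₀ : Mat n)) * Y - Y * (Z - Y₀) = Z * Y - Y * Z - (Y₀ * Y - Y * Y₀) by
      noncomm_ring]
  -- For W = [Z - Y₀, Y], invariance of the trace form gives tr W² = tr((Z - Y₀)[Y, W]) = 0, so W =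
  -- 0 by definiteness.
  refine sub_eq_zero.1 ((h𝔥 _ hmem).trace_mul_self ?_)
  set W := (Z - (Y₀ : Mat n)) * Y - Y * (Z - Y₀) with hW
  have h1 := horth _ (hlie _ hY _ hmem)
  have key : ∀ A Y W : Mat n, (A * Y * W - Y * A * W).trace = (A * (Y * W - W * Y)).trace := by
    intro A Y W
    rw [Matrix.trace_sub, mul_assoc Y A W, Matrix.trace_mul_comm Y, mul_sub, Matrix.trace_sub]
    simp only [mul_assoc]
  calc (W * W).trace = (((Z - Y₀) * Y) * W - (Y * (Z - Y₀)) * W).trace := by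
        conv_lhs => enter [1, 1]; rw [hW]
        rw [sub_mul]
    _ = ((Z - Y₀) * (Y * W - W * Y)).trace := key _ _ _
    _ = 0 := h1

/-- Modulo p ∧ E every element preserves both ℝp and ℝq, and transitivity supplies one that scales p
nontrivially. Correcting it by 𝔥 makes it commute with 𝔥, so that the product of A^Φ and H becomes
direct. -/
theorem exists_rotGen_of_parabolic {b : NullBasis n} {𝔤 : Submodule ℝ (Mat n)}
    (h𝔤 : ∀ X ∈ 𝔤, IsSkew X) (hlie : ∀ X ∈ 𝔤, ∀ Y ∈ 𝔤, X * Y - Y * X ∈ 𝔤)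
    (htrans : ActsTransitively (expClosure 𝔤))
    (hN : ∀ u, eta n b.p u = 0 → eta n b.q u = 0 → wedge b.p u ∈ 𝔤)
    (hpar : ∀ X ∈ 𝔤, ∃ c : ℝ, X *ᵥ b.p = c • b.p) :
    ∃ (B : Mat n) (𝔥 : Submodule ℝ (Mat n)), IsRotGen b B ∧ (∀ Y ∈ 𝔥, IsRotGen b Y) ∧
      (∀ Y ∈ 𝔥, B * Y = Y * B) ∧
      ∀ X, X ∈ 𝔤 ↔ ∃ (s : ℝ) (Y : Mat n) (u : V n), Y ∈ 𝔥 ∧ eta n b.p u = 0 ∧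
        eta n b.q u = 0 ∧ X = s • (wedge b.q b.p + B) + Y + wedge b.p u := by
  have hb := b.isNullPair
  have hpar' : ∀ X ∈ 𝔤, X *ᵥ b.p = eta n (X *ᵥ b.p) b.q • b.p := by
    intro X hX
    obtain ⟨c, hc⟩ := hpar X hX
    simp [hc, b.eta_pq]
  have hu_mem : ∀ X ∈ 𝔤, wedge b.p (horoPart X b.p b.q) ∈ 𝔤 := fun X hX =>
    hN _ (eta_horoPart hb (h𝔤 X hX)) (eta_horoPart' hb (h𝔤 X hX))
  have hwp : ∀ u, eta n b.p u = 0 → wedge b.p u *ᵥ b.p = 0 := fun u hu => by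
    simp [wedge_mulVec, b.eta_pp, eta_comm u, hu]
  have hwq : ∀ u, eta n b.q u = 0 → wedge b.p u *ᵥ b.q = u := fun u hu => by
    simp [wedge_mulVec, b.eta_pq, eta_comm u, hu]
  have hredp : ∀ X ∈ 𝔤, (X - wedge b.p (horoPart X b.p b.q)) *ᵥ b.p
      = eta n (X *ᵥ b.p) b.q • b.p := fun X hX => by
    rw [Matrix.sub_mulVec, hwp _ (eta_horoPart hb (h𝔤 X hX)), sub_zero]
    exact hpar' X hX
  have hredq : ∀ X ∈ 𝔤, (X - wedge b.p (horoPart X b.p b.q)) *ᵥ b.q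
      = - eta n (X *ᵥ b.p) b.q • b.q := fun X hX => by
    rw [Matrix.sub_mulVec, hwq _ (eta_horoPart' hb (h𝔤 X hX)), mulVec_right_eq X b.p b.q]
    module
  obtain ⟨X, hX, hXp⟩ := htrans.exists_mulVec_ne_zero h𝔤 hb.left_ne_zero
  set c := eta n (X *ᵥ b.p) b.q with hc
  have hc0 : c ≠ 0 := fun h0 => hXp (by rw [hpar' X hX, ← hc, h0, zero_smul])
  -- Normalized to act by 1 on p and by -1 on q, like q ∧ p.
  set Z₁ := c⁻¹ • (X - wedge b.p (horoPart X b.p b.q)) with hZ₁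
  have hZ₁𝔤 : Z₁ ∈ 𝔤 := 𝔤.smul_mem _ (sub_mem hX (hu_mem X hX))
  have hZ₁p : Z₁ *ᵥ b.p = b.p := by
    rw [hZ₁, Matrix.smul_mulVec, hredp X hX, smul_smul, inv_mul_cancel₀ hc0, one_smul]
  have hZ₁q : Z₁ *ᵥ b.q = - b.q := by
    rw [hZ₁, Matrix.smul_mulVec, hredq X hX, smul_smul, mul_neg, inv_mul_cancel₀ hc0, neg_smul,
      one_smul]
  let 𝔥 : Submodule ℝ (Mat n) :=
    { carrier := {Y | Y ∈ 𝔤 ∧ Y *ᵥ b.p = 0 ∧ Y *ᵥ b.q = 0}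
      add_mem' := by
        rintro Y W ⟨h1, h2, h3⟩ ⟨k1, k2, k3⟩
        exact ⟨add_mem h1 k1, by rw [Matrix.add_mulVec, h2, k2, add_zero],
          by rw [Matrix.add_mulVec, h3, k3, add_zero]⟩
      zero_mem' := by simp
      smul_mem' := by
        rintro c Y ⟨h1, h2, h3⟩
        exact ⟨𝔤.smul_mem c h1, by rw [Matrix.smul_mulVec, h2, smul_zero],
          by rw [Matrix.smul_mulVec, h3, smul_zero]⟩ }
  have h𝔥 : ∀ Y ∈ 𝔥, IsRotGen b Y := fun Y hY => ⟨h𝔤 Y hY.1, hY.2.1, hY.2.2⟩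
  have h𝔥lie : ∀ X ∈ 𝔥, ∀ Y ∈ 𝔥, X * Y - Y * X ∈ 𝔥 := by
    rintro X ⟨h1, h2, h3⟩ Y ⟨k1, k2, k3⟩
    refine ⟨hlie X h1 Y k1, ?_, ?_⟩ <;>
    simp [Matrix.sub_mulVec, ← Matrix.mulVec_mulVec, h2, h3, k2, k3]
  have hZ₁𝔥 : ∀ Y ∈ 𝔥, Z₁ * Y - Y * Z₁ ∈ 𝔥 := by
    rintro Y ⟨k1, k2, k3⟩
    refine ⟨hlie _ hZ₁𝔤 Y k1, ?_, ?_⟩ <;>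
    simp [Matrix.sub_mulVec, ← Matrix.mulVec_mulVec, hZ₁p, hZ₁q, k2, k3, Matrix.mulVec_neg]
  obtain ⟨Y₀, hY₀, hcomm⟩ := exists_sub_centralizes h𝔥 h𝔥lie hZ₁𝔥
  have hZ𝔤 : Z₁ - Y₀ ∈ 𝔤 := sub_mem hZ₁𝔤 hY₀.1
  have hZp : (Z₁ - Y₀) *ᵥ b.p = b.p := by rw [Matrix.sub_mulVec, hZ₁p, hY₀.2.1, sub_zero]
  have hZq : (Z₁ - Y₀) *ᵥ b.q = - b.q := by rw [Matrix.sub_mulVec, hZ₁q, hY₀.2.2, sub_zero]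
  refine ⟨Z₁ - Y₀ - wedge b.q b.p, 𝔥, ⟨(h𝔤 _ hZ𝔤).sub (wedge_isSkew _ _), ?_, ?_⟩, h𝔥, ?_, ?_⟩
  · rw [Matrix.sub_mulVec, hZp, b.wedge_qp_p, sub_self]
  · rw [Matrix.sub_mulVec, hZq, b.wedge_qp_q, sub_self]
  · intro Y hY
    rw [sub_mul, mul_sub, hcomm Y hY, (h𝔥 Y hY).comm]
  · intro W
    rw [add_sub_cancel]
    constructor
    · intro hW
      refine ⟨eta n (W *ᵥ b.p) b.q, W - wedge b.p (horoPart W b.p b.q)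
        - eta n (W *ᵥ b.p) b.q • (Z₁ - Y₀), horoPart W b.p b.q, ⟨?_, ?_, ?_⟩,
        eta_horoPart hb (h𝔤 W hW), eta_horoPart' hb (h𝔤 W hW), by abel⟩
      · exact sub_mem (sub_mem hW (hu_mem W hW)) (𝔤.smul_mem _ hZ𝔤)
      · rw [Matrix.sub_mulVec, hredp W hW, Matrix.smul_mulVec, hZp, sub_self]
      · rw [Matrix.sub_mulVec, hredq W hW, Matrix.smul_mulVec, hZq]
        module
    · rintro ⟨s, Y, u, hY, hu, hu', rfl⟩
      exact add_mem (add_mem (𝔤.smul_mem _ hZ𝔤) hY.1) (hN u hu hu')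

/-! ### The identity component -/

theorem continuous_expSO {X : Mat n} (hX : IsSkew X) :
    Continuous fun t : ℝ => expSO (t • X) (hX.smul t) := by
  rw [isEmbedding_mat.continuous_iff]
  exact continuous_exp.comp (continuous_id.smul continuous_const)

theorem expClosure_le_SO0 {𝔤 : Submodule ℝ (Mat n)} (h𝔤 : ∀ X ∈ 𝔤, IsSkew X) :
    expClosure 𝔤 ≤ SO0 n := by
  refine expClosure_induction h𝔤 fun X hX => ?_
  have h1 := (isPreconnected_range (continuous_expSO (h𝔤 X hX))).subset_connectedComponent
    (x := 1) ⟨0, mat_injective (by rw [mat_expSO, zero_smul, NormedSpace.exp_zero, mat_one])⟩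
  refine h1 ⟨1, mat_injective (by rw [mat_expSO, mat_expSO, one_smul])⟩

theorem exists_local_log_of_complete {𝔸 : Type*} [NormedRing 𝔸] [NormedAlgebra ℝ 𝔸]
    [CompleteSpace 𝔸] : ∃ log : 𝔸 → 𝔸, Tendsto log (𝓝 1) (𝓝 0) ∧
      (∀ᶠ y in 𝓝 1, NormedSpace.exp (log y) = y) ∧ ∀ᶠ x in 𝓝 0, log (NormedSpace.exp x) = x := by
  have h : HasStrictFDerivAt (NormedSpace.exp : 𝔸 → 𝔸)
      ((ContinuousLinearEquiv.refl ℝ 𝔸 : 𝔸 ≃L[ℝ] 𝔸) : 𝔸 →L[ℝ] 𝔸) 0 := hasStrictFDerivAt_exp_zero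
  refine ⟨h.localInverse, ?_, ?_, h.eventually_left_inverse⟩
  · have := h.localInverse_tendsto
    rwa [NormedSpace.exp_zero] at this
  · have := h.eventually_right_inverse
    rwa [NormedSpace.exp_zero] at this

theorem exists_local_log (n : ℕ) : ∃ log : Mat n → Mat n, Tendsto log (𝓝 1) (𝓝 0) ∧
    (∀ᶠ y in 𝓝 1, NormedSpace.exp (log y) = y) ∧
      ∀ᶠ x in 𝓝 0, log (NormedSpace.exp x) = x := by
  let _ : NormedRing (Mat n) := Matrix.linftyOpNormedRing
  let _ : NormedAlgebra ℝ (Mat n) := Matrix.linftyOpNormedAlgebra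
  exact exists_local_log_of_complete

theorem isSkew_of_transpose {X : Mat n} (h : gram n * (-Xᵀ) * gram n = X) : IsSkew X := by
  intro x y
  have h1 : gram n * X = -(Xᵀ * gram n) := by
    rw [← h, ← mul_assoc, ← mul_assoc, gram_mul_self, one_mul, h, neg_mul]
  rw [eta_eq_dotProduct, eta_eq_dotProduct, Matrix.mulVec_mulVec, h1, Matrix.neg_mulVec,
    neg_dotProduct, ← Matrix.mulVec_mulVec, Matrix.mulVec_transpose, ← Matrix.dotProduct_mulVec,
    neg_add_cancel]

theorem gram_mul_transpose_inv (g : SO n) : gram n * (mat g⁻¹)ᵀ * gram n = mat g := by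
  have h1 : (mat g)ᵀ * gram n * mat g = gram n := by
    refine mat_ext fun x => dotProduct_eq _ _ fun y => ?_
    have := eta_act g x y
    rw [eta_eq_dotProduct, eta_eq_dotProduct, act, act, Matrix.dotProduct_mulVec,
      ← Matrix.mulVec_transpose, Matrix.mulVec_mulVec, Matrix.mulVec_mulVec] at this
    exact this
  have h2 : (mat g⁻¹)ᵀ * (mat g)ᵀ = 1 := by
    rw [← Matrix.transpose_mul, mat_mul_mat_inv, Matrix.transpose_one]
  have h3 : (mat g⁻¹)ᵀ * gram n = gram n * mat g := by
    rw [← h1, ← mul_assoc, ← mul_assoc, h2, one_mul, h1]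
  rw [mul_assoc, h3, ← mul_assoc, gram_mul_self, one_mul]

/-- Let J be the Gram matrix and σ(X) = -J Xᵗ J, whose fixed points are skew. For g near 1, both log
g and σ(log g) exponentiate to g, so they coincide by local injectivity and log g is skew. The
generated subgroup is thus a neighbourhood of 1, hence open and closed. -/
theorem SO0_eq_expClosure {𝔤 : Submodule ℝ (Mat n)} (h𝔤 : ∀ X ∈ 𝔤, IsSkew X)
    (hall : ∀ X, IsSkew X → X ∈ 𝔤) : expClosure 𝔤 = SO0 n := by
  refine le_antisymm (expClosure_le_SO0 h𝔤) ?_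
  obtain ⟨log, hlog, hexp, hlog'⟩ := exists_local_log n
  have hσ : Tendsto (fun X : Mat n => gram n * (-Xᵀ) * gram n) (𝓝 0) (𝓝 0) := by
    have hc : Continuous fun X : Mat n => gram n * (-Xᵀ) * gram n := by fun_prop
    have := hc.tendsto 0
    simpa using this
  have hmat : Tendsto (mat : SO n → Mat n) (𝓝 1) (𝓝 1) := by
    have := (isEmbedding_mat (n := n)).continuous.tendsto 1
    rwa [mat_one] at this
  have hnhds : (expClosure 𝔤 : Set (SO n)) ∈ 𝓝 (1 : SO n) := by
    filter_upwards [hmat.eventually hexp, hmat.eventually (hlog.eventually (hσ.eventually hlog'))]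
      with g h1 h2
    have h3 : NormedSpace.exp (gram n * (-(log (mat g))ᵀ) * gram n) = mat g := by
      rw [gram_conj_exp, ← Matrix.transpose_neg, Matrix.exp_transpose]
      have h4 : NormedSpace.exp (-log (mat g)) = mat g⁻¹ := by
        have h5 := exp_mul_exp_neg (log (mat g))
        rw [h1] at h5
        calc NormedSpace.exp (-log (mat g)) = mat g⁻¹ * (mat g * NormedSpace.exp (-log (mat g))) := by
              rw [← mul_assoc, mat_inv_mul_mat, one_mul]
          _ = mat g⁻¹ := by rw [h5, mul_one]
      rw [h4, gram_mul_transpose_inv]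
    rw [h3] at h2
    exact Subgroup.subset_closure ⟨_, hall _ (isSkew_of_transpose h2.symm), h1.symm⟩
  have hopen := (expClosure 𝔤).isOpen_of_mem_nhds hnhds
  have hclopen : IsClopen (expClosure 𝔤 : Set (SO n)) := ⟨(expClosure 𝔤).isClosed_of_isOpen hopen, hopen⟩
  exact hclopen.connectedComponent_subset (one_mem _)

/-! ### One-parameter subgroups -/

/-- A continuous one-parameter group in a Banach algebra is an exponential. -/
theorem exists_eq_exp_of_continuous {𝔸 : Type*} [NormedRing 𝔸] [NormedAlgebra ℝ 𝔸]
    [CompleteSpace 𝔸] {φ : ℝ → 𝔸} (hφ : Continuous φ) (h0 : φ 0 = 1)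
    (hadd : ∀ s t, φ (s + t) = φ s * φ t) : ∃ D : 𝔸, ∀ t, φ t = NormedSpace.exp (t • D) := by
  let _ : NormedAlgebra ℚ 𝔸 := NormedAlgebra.restrictScalars ℚ ℝ _
  have hF : ∀ t, HasDerivAt (fun u => ∫ s in (0 : ℝ)..u, φ s) (φ t) t := fun t =>
    intervalIntegral.integral_hasDerivAt_right (hφ.intervalIntegrable _ _)
      hφ.aestronglyMeasurable.stronglyMeasurableAtFilter hφ.continuousAt
  -- The averages of φ over [0, ε] tend to φ(0) = 1 and are therefore invertible for small ε.
  obtain ⟨ε, hε, hunit⟩ : ∃ ε : ℝ, ε ≠ 0 ∧ IsUnit (∫ s in (0 : ℝ)..ε, φ s) := by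
    have h1 := hasDerivAt_iff_tendsto_slope.1 (hF 0)
    rw [h0] at h1
    have h2 := h1.eventually (Units.isOpen.mem_nhds (isUnit_one : IsUnit (1 : 𝔸)))
    obtain ⟨ε, hε, hε0⟩ := (h2.and self_mem_nhdsWithin).exists
    have hε0' : ε ≠ 0 := hε0
    refine ⟨ε, hε0', ?_⟩
    have h3 : IsUnit (ε⁻¹ • ∫ s in (0 : ℝ)..ε, φ s) := by
      have : slope (fun u => ∫ s in (0 : ℝ)..u, φ s) 0 ε = ε⁻¹ • ∫ s in (0 : ℝ)..ε, φ s := by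
        simp [slope_def_module]
      rw [← this]
      exact hε
    have h4 := h3.smul (Units.mk0 ε hε0')
    rwa [Units.smul_def, Units.val_mk0, smul_smul, mul_inv_cancel₀ hε0', one_smul] at h4
  obtain ⟨C, hC⟩ := hunit
  -- Multiplying by the invertible C turns φ into a difference of integrals, so continuity of φ
  -- yields differentiability.
  have hint : ∀ t, φ t * C = (∫ s in (0 : ℝ)..(t + ε), φ s) - ∫ s in (0 : ℝ)..t, φ s := by
    intro t
    rw [intervalIntegral.integral_interval_sub_left (hφ.intervalIntegrable _ _)
      (hφ.intervalIntegrable _ _), hC]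
    have h1 := ((ContinuousLinearMap.mul ℝ 𝔸 (φ t)).intervalIntegral_comp_comm
      (hφ.intervalIntegrable (μ := MeasureTheory.volume) 0 ε)).symm
    simp only [ContinuousLinearMap.mul_apply', ← hadd] at h1
    rw [h1, intervalIntegral.integral_comp_add_left, add_zero]
  set D : 𝔸 := (φ ε - 1) * ((C⁻¹ : 𝔸ˣ) : 𝔸) with hD
  have hderiv : ∀ t, HasDerivAt φ (φ t * D) t := by
    intro t
    have h1 : HasDerivAt (fun t => φ t * (C : 𝔸)) (φ (t + ε) - φ t) t := by
      have h2 := ((hF (t + ε)).comp_add_const t ε).sub (hF t)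
      refine h2.congr_of_eventuallyEq (Eventually.of_forall fun s => ?_)
      exact hint s
    have h3 := h1.mul_const ((C⁻¹ : 𝔸ˣ) : 𝔸)
    simp only [mul_assoc, Units.mul_inv, mul_one] at h3
    rwa [hadd, ← mul_sub_one, mul_assoc] at h3
  refine ⟨D, fun t => ?_⟩
  have hconst : ∀ s, HasDerivAt (fun s => φ s * NormedSpace.exp (s • (-D))) 0 s := by
    intro s
    have h1 := (hderiv s).mul (hasDerivAt_exp_smul_const' (𝕂 := ℝ) (-D) s)
    have h2 : φ s * D * NormedSpace.exp (s • (-D)) + φ s * (-D * NormedSpace.exp (s • (-D))) = 0 := by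
      noncomm_ring
    rwa [h2] at h1
  have h1 := is_const_of_deriv_eq_zero (fun s => (hconst s).differentiableAt)
    (fun s => (hconst s).deriv) t 0
  rw [h0, zero_smul, NormedSpace.exp_zero, one_mul, smul_neg] at h1
  have h2 : NormedSpace.exp (-(t • D)) * NormedSpace.exp (t • D) = 1 := by
    rw [← NormedSpace.exp_add_of_commute (Commute.neg_left (Commute.refl (t • D))),
      neg_add_cancel, NormedSpace.exp_zero]
  calc φ t = φ t * (NormedSpace.exp (-(t • D)) * NormedSpace.exp (t • D)) := by rw [h2, mul_one]
    _ = NormedSpace.exp (t • D) := by rw [← mul_assoc, h1, one_mul]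

theorem exists_eq_matrix_exp_of_continuous {φ : ℝ → Mat n} (hφ : Continuous φ) (h0 : φ 0 = 1)
    (hadd : ∀ s t, φ (s + t) = φ s * φ t) : ∃ D : Mat n, ∀ t, φ t = NormedSpace.exp (t • D) := by
  let _ : NormedRing (Mat n) := Matrix.linftyOpNormedRing
  let _ : NormedAlgebra ℝ (Mat n) := Matrix.linftyOpNormedAlgebra
  exact exists_eq_exp_of_continuous hφ h0 hadd

theorem hasDerivAt_exp_smul_mulVec (X : Mat n) (x : V n) :
    HasDerivAt (fun t : ℝ => NormedSpace.exp (t • X) *ᵥ x) (X *ᵥ x) 0 := by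
  rw [hasDerivAt_pi]
  intro i
  simp only [Matrix.mulVec, dotProduct]
  refine HasDerivAt.fun_sum fun j _ => ?_
  have h := (hasDerivAt_exp_smul X i j 0).mul_const (x j)
  rwa [zero_smul, NormedSpace.exp_zero, one_mul] at h

theorem hasDerivAt_eta_exp (X : Mat n) (x y : V n) :
    HasDerivAt (fun t : ℝ => eta n (NormedSpace.exp (t • X) *ᵥ x) y) (eta n (X *ᵥ x) y) 0 := by
  have h := (LinearMap.toContinuousLinearMap (eta n y)).hasFDerivAt.comp_hasDerivAt 0
    (hasDerivAt_exp_smul_mulVec X x)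
  simp only [eta_comm _ y]
  exact h

theorem eq_zero_of_exp_smul_mulVec {X : Mat n} {x : V n}
    (h : ∀ t : ℝ, NormedSpace.exp (t • X) *ᵥ x = x) : X *ᵥ x = 0 := by
  have h1 := hasDerivAt_exp_smul_mulVec X x
  simp only [h] at h1
  exact h1.unique (hasDerivAt_const 0 x)

namespace NullBasis

variable (b : NullBasis n)

theorem expA_add (s t : ℝ) : b.expA (s + t) = b.expA s * b.expA t :=
  mat_injective (exp_add_smul _ s t)

theorem expA_zero : b.expA 0 = 1 :=
  mat_injective (by rw [expA, mat_expSO, zero_smul, NormedSpace.exp_zero, mat_one])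

end NullBasis

/-- Every continuous homomorphism `A → K` is of the form `a ↦ exp (log a • B)`. -/
theorem exists_eq_phiHom (b : NullBasis n) {Φ : groupA b →* groupK b} (hΦ : Continuous Φ) :
    ∃ (B : Mat n) (hB : IsRotGen b B), Φ = phiHom b B hB := by
  set α : ℝ → groupA b := fun t => ⟨b.expA t, b.expA_mem t⟩ with hα
  have hαadd : ∀ s t, α (s + t) = α s * α t := fun s t => Subtype.ext (b.expA_add s t)
  have hα0 : α 0 = 1 := Subtype.ext b.expA_zero
  have hαc : Continuous α := Continuous.subtype_mk (continuous_expSO (wedge_isSkew _ _)) _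
  set φ : ℝ → Mat n := fun t => mat (Φ (α t) : SO n) with hφ
  obtain ⟨B, hB⟩ := exists_eq_matrix_exp_of_continuous (φ := φ)
    ((isEmbedding_mat.continuous.comp continuous_subtype_val).comp (hΦ.comp hαc))
    (by rw [hφ]; simp only [hα0, map_one]; rfl)
    (fun s t => by rw [hφ]; simp only [hαadd, map_mul]; rfl)
  have hexp : ∀ t x, NormedSpace.exp (t • B) *ᵥ x = act (Φ (α t) : SO n) x := fun t x => by
    rw [← hB]
    rfl
  have hinv : ∀ t, (Φ (α t) : SO n)⁻¹ = Φ (α (-t)) := by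
    intro t
    rw [← Subgroup.coe_inv, ← map_inv]
    congr 2
    rw [inv_eq_iff_mul_eq_one, ← hαadd, add_neg_cancel, hα0]
  -- exp(-tB) is the η-adjoint of exp(tB); differentiating this at 0 gives skewness.
  have hskew : IsSkew B := by
    intro x y
    have h1 := hasDerivAt_eta_exp B x y
    have h2 := hasDerivAt_eta_exp (-B) y x
    have h3 : (fun t : ℝ => eta n (NormedSpace.exp (t • B) *ᵥ x) y)
        = fun t : ℝ => eta n (NormedSpace.exp (t • (-B)) *ᵥ y) x := by
      funext t
      rw [smul_neg, ← neg_smul, hexp, hexp, ← hinv, eta_act_left]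
      exact eta_comm _ _
    rw [h3] at h1
    have h4 := h1.unique h2
    rw [h4, Matrix.neg_mulVec, map_neg, LinearMap.neg_apply, eta_comm x]
    ring
  have hrot : IsRotGen b B :=
    ⟨hskew, eq_zero_of_exp_smul_mulVec fun t => by
      rw [hexp]; exact b.act_p_of_mem_groupK (Φ (α t)).2,
    eq_zero_of_exp_smul_mulVec fun t => by
      rw [hexp]; exact b.act_q_of_mem_groupK (Φ (α t)).2⟩
  refine ⟨B, hrot, MonoidHom.ext fun a => Subtype.ext (mat_injective ?_)⟩
  rw [mat_phiHom, ← hB]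
  have : a = α (Real.log (b.stretch a)) := Subtype.ext (b.eq_expA a.2)
  conv_lhs => rw [this]

/-! ### Simply transitive groups -/

theorem exists_mul_of_mem_sup {S : Type*} [Group S] {P N : Subgroup S}
    (h : ∀ m ∈ P, ∀ x ∈ N, m * x * m⁻¹ ∈ N) {g : S} (hg : g ∈ P ⊔ N) :
    ∃ m ∈ P, ∃ x ∈ N, g = m * x := by
  let Q : Subgroup S :=
    { carrier := {g | ∃ m ∈ P, ∃ x ∈ N, g = m * x}
      one_mem' := ⟨1, one_mem _, 1, one_mem _, by simp⟩
      mul_mem' := by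
        rintro _ _ ⟨m, hm, x, hx, rfl⟩ ⟨m', hm', x', hx', rfl⟩
        refine ⟨m * m', mul_mem hm hm', m'⁻¹ * x * m' * x', mul_mem ?_ hx', by group⟩
        simpa using h m'⁻¹ (inv_mem hm') x hx
      inv_mem' := by
        rintro _ ⟨m, hm, x, hx, rfl⟩
        exact ⟨m⁻¹, inv_mem hm, m * x⁻¹ * m⁻¹, h m hm _ (inv_mem hx), by group⟩ }
  have : P ⊔ N ≤ Q := sup_le (fun m hm => ⟨m, hm, 1, one_mem _, by simp⟩)
    (fun x hx => ⟨1, one_mem _, x, hx, by simp⟩)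
  exact this hg

/-- By Cauchy–Schwarz the spatial part of η(p, x) is smaller than |p₀ x₀|, so the time term decides
the sign. Hence the sign of η(p, ·) tells the two sheets of the hyperboloid apart. -/
theorem eta_mul_neg {p x : V n} (hp : p ≠ 0) (hpp : eta n p p = 0) (hx : eta n x x = -1) :
    eta n p x * (p 0 * x 0) < 0 := by
  have hp0 : p 0 ≠ 0 := fun h => hp (eq_zero_of_eta_self h hpp.le)
  rw [eta_apply] at hpp hx ⊢
  have hcs := Finset.sum_mul_sq_le_sq_mul_sq Finset.univ (fun i : Fin (n + 1) => p i.succ)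
    (fun i => x i.succ)
  simp only [pow_two (p _), pow_two (x _)] at hcs
  set S := ∑ i : Fin (n + 1), p i.succ * x i.succ
  have h1 : ∑ i : Fin (n + 1), p i.succ * p i.succ = p 0 * p 0 := by linarith
  have h2 : ∑ i : Fin (n + 1), x i.succ * x i.succ = x 0 * x 0 - 1 := by linarith
  rw [h1, h2] at hcs
  have h3 : S ^ 2 < (p 0 * x 0) ^ 2 := by
    have : 0 < p 0 * p 0 := mul_self_pos.2 hp0
    nlinarith
  have h4 : |S| < |p 0 * x 0| := sq_lt_sq.1 h3
  have h5 : S * (p 0 * x 0) ≤ |S| * |p 0 * x 0| := by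
    rw [← abs_mul]
    exact le_abs_self _
  have h6 : |p 0 * x 0| * |p 0 * x 0| = (p 0 * x 0) * (p 0 * x 0) := abs_mul_abs_self _
  nlinarith [abs_nonneg S]

theorem eta_ne_zero_of_mem_lobSpace {p x : V n} (hp : p ≠ 0) (hpp : eta n p p = 0)
    (hx : x ∈ lobSpace n) : eta n p x ≠ 0 := fun h => by
  have := eta_mul_neg hp hpp hx.1
  rw [h, zero_mul] at this
  exact lt_irrefl _ this

theorem eta_mul_eta_pos {p x y : V n} (hp : p ≠ 0) (hpp : eta n p p = 0) (hx : x ∈ lobSpace n)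
    (hy : y ∈ lobSpace n) : 0 < eta n p x * eta n p y := by
  have h1 := eta_mul_neg hp hpp hx.1
  have h2 := eta_mul_neg hp hpp hy.1
  have h3 := mul_pos_of_neg_of_neg h1 h2
  have h4 : 0 ≤ (p 0 * x 0) * (p 0 * y 0) := by
    have := mul_nonneg (mul_self_nonneg (p 0)) (mul_pos hx.2 hy.2).le
    linarith
  by_contra! h5
  nlinarith [mul_nonneg h4 (neg_nonneg.2 h5)]

theorem mem_lobSpace_of_eta {p x y : V n} (hp : p ≠ 0) (hpp : eta n p p = 0) (hx : x ∈ lobSpace n)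
    (hy : eta n y y = -1) (hxy : 0 < eta n p x * eta n p y) : y ∈ lobSpace n := by
  refine ⟨hy, ?_⟩
  have h1 := eta_mul_neg hp hpp hx.1
  have h2 := eta_mul_neg hp hpp hy
  have h3 := mul_pos_of_neg_of_neg h1 h2
  by_contra! h4
  have h5 : 0 ≤ (p 0 * x 0) * (p 0 * -y 0) := by
    have := mul_nonneg (mul_self_nonneg (p 0)) (mul_nonneg hx.2.le (neg_nonneg.2 h4))
    linarith
  nlinarith [mul_nonneg hxy.le h5]

namespace NullBasis

variable (b : NullBasis n)

/-- On a level set of η(p, ·), N acts by translations of the coordinates η(e_i, ·). -/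
theorem eta_e_act_of_mem_groupN {u x : V n} (hu : eta n b.p u = 0) (i : Fin n) :
    eta n (b.e i) (act (expSO (wedge b.p u) (wedge_isSkew _ _)) x)
      = eta n (b.e i) x + eta n b.p x * eta n (b.e i) u := by
  rw [act_expSO, exp_wedge_mulVec b.eta_pp hu]
  simp [wedge_mulVec, Matrix.mulVec_sub, Matrix.mulVec_smul, b.eta_ep, hu, b.eta_pp, eta_comm u b.p]

theorem expSO_wedge_mem_groupN {u : V n} (hu : eta n b.p u = 0) :
    expSO (wedge b.p u) (wedge_isSkew _ _) ∈ groupN b := by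
  have h := inv_mul_exp_mem_groupN b (wedge_isSkew b.p u) IsSkew.zero (c := 0) hu
    (by simp) (by rw [zero_add])
  have h1 : expSO (0 : Mat n) IsSkew.zero = 1 :=
    mat_injective (by rw [mat_expSO, NormedSpace.exp_zero, mat_one])
  rwa [h1, inv_one, one_mul] at h

theorem act_p_of_mem_groupAPhi {Φ : groupA b →* groupK b} {m : SO n} (hm : m ∈ groupAPhi b Φ) :
    ∃ a : groupA b, m = (Φ a : SO n) * (a : SO n) ∧ act m b.p = b.stretch a • b.p := by
  obtain ⟨a, rfl⟩ := hm
  obtain ⟨c, -, hc, -⟩ := a.2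
  refine ⟨a, rfl, ?_⟩
  rw [act_mul, b.stretch_of_act hc, hc, act_smul, b.act_p_of_mem_groupK (Φ a).2]

end NullBasis

/-- A point of L is determined by η(p, ·), which is never zero on L, and the η(e_i, ·). A^Φ acts
simply transitively on the possible values of the first, and N on the others once the first is
fixed. -/
theorem actsSimplyTransitively_of_isSemidirectProduct {b : NullBasis n} {Φ : groupA b →* groupK b}
    {G : Subgroup (SO n)} (hG : IsSemidirectProduct G (groupAPhi b Φ) (groupN b)) :
    ActsSimplyTransitively G := by
  have hp0 := b.isNullPair.left_ne_zero
  have hPG : groupAPhi b Φ ≤ G := hG.generate ▸ le_sup_left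
  have hNG : groupN b ≤ G := hG.generate ▸ le_sup_right
  have hdec : ∀ g ∈ G, ∃ a : groupA b, ∃ x ∈ groupN b, g = (Φ a : SO n) * (a : SO n) * x ∧
      act g b.p = b.stretch a • b.p := by
    intro g hg
    rw [← hG.generate] at hg
    obtain ⟨m, hm, x, hx, rfl⟩ := exists_mul_of_mem_sup (fun m hm x hx =>
      hG.normal m (hPG hm) x hx) hg
    obtain ⟨a, rfl, ha⟩ := b.act_p_of_mem_groupAPhi hm
    exact ⟨a, x, hx, rfl, by rw [act_mul, b.act_p_of_mem_groupN hx, ha]⟩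
  have heta : ∀ {g : SO n} {a : ℝ} (x : V n), act g b.p = a • b.p →
      eta n b.p x = a * eta n b.p (act g x) := by
    intro g a x hg
    rw [← eta_act g, hg, map_smul, LinearMap.smul_apply, smul_eq_mul]
  have hfree : ∀ g ∈ G, ∀ x ∈ lobSpace n, act g x = x → g = 1 := by
    intro g hg x hx hgx
    obtain ⟨a, y, hy, rfl, hgp⟩ := hdec g hg
    have hx0 := eta_ne_zero_of_mem_lobSpace hp0 b.eta_pp hx
    have h1 := heta x hgp
    rw [hgx] at h1
    have h2 : b.stretch a = 1 := by
      refine mul_right_cancel₀ hx0 ?_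
      rw [← h1, one_mul]
    have h3 : a = 1 := by
      refine Subtype.ext ?_
      rw [b.eq_expA a.2, h2, Real.log_one, b.expA_zero]
      rfl
    subst h3
    simp only [map_one, Subgroup.coe_one, one_mul] at hgx ⊢
    obtain ⟨u, hu, hu', rfl⟩ := b.exists_eq_exp_of_mem_groupN hy
    have h4 : u = 0 := by
      rw [b.expand_of_orthogonal hu hu']
      refine Finset.sum_eq_zero fun i _ => ?_
      have h5 := b.eta_e_act_of_mem_groupN (x := x) hu i
      rw [hgx] at h5
      have h6 : eta n (b.e i) u = 0 := by
        refine (mul_eq_zero.1 (?_ : eta n b.p x * eta n (b.e i) u = 0)).resolve_left hx0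
        linarith
      rw [h6, zero_smul]
    refine mat_injective ?_
    rw [mat_expSO, h4, wedge_zero_right, NormedSpace.exp_zero, mat_one]
  refine ⟨fun g hg x hx => ?_, fun x hx y hy => ?_⟩
  · obtain ⟨a, -, -, -, hgp⟩ := hdec g hg
    have hapos := b.stretch_pos a.2
    refine mem_lobSpace_of_eta hp0 b.eta_pp hx (by rw [eta_act]; exact hx.1) ?_
    have h1 := heta x hgp
    have h2 := eta_mul_eta_pos hp0 b.eta_pp hx hx
    have h3 : 0 < b.stretch a * (eta n b.p x * eta n b.p (act g x)) := by
      calc 0 < eta n b.p x * eta n b.p x := h2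
        _ = _ := by
          conv_lhs => enter [2]; rw [h1]
          ring
    exact (mul_pos_iff_of_pos_left hapos).1 h3
  · have hx0 := eta_ne_zero_of_mem_lobSpace hp0 b.eta_pp hx
    have hy0 := eta_ne_zero_of_mem_lobSpace hp0 b.eta_pp hy
    have hxy := eta_mul_eta_pos hp0 b.eta_pp hx hy
    have hr : 0 < eta n b.p x / eta n b.p y := by
      have : eta n b.p x / eta n b.p y = eta n b.p x * eta n b.p y / (eta n b.p y) ^ 2 := by
        field_simp
      rw [this]
      positivity
    -- Scaling p by s divides η(p, x) by s, so this factor brings η(p, x) to η(p, y).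
    set a : groupA b := ⟨b.expA (Real.log (eta n b.p x / eta n b.p y)), b.expA_mem _⟩ with ha
    set m : SO n := (Φ a : SO n) * (a : SO n) with hm
    have hmp : act m b.p = (eta n b.p x / eta n b.p y) • b.p := by
      rw [hm, act_mul, ha]
      simp only
      rw [b.act_expA_p, Real.exp_log hr, act_smul, b.act_p_of_mem_groupK (Φ _).2]
    have hpx' : eta n b.p (act m x) = eta n b.p y := by
      have h1 := heta x hmp
      field_simp at h1
      exact h1.symm
    set x' := act m x
    have hx'x' : eta n x' x' = -1 := by
      rw [eta_act]
      exact hx.1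
    set u : V n := ∑ i, ((eta n (b.e i) y - eta n (b.e i) x') / eta n b.p y) • b.e i with hu
    have hpu : eta n b.p u = 0 := by simp [hu, b.eta_pe]
    have heu : ∀ i, eta n (b.e i) u = (eta n (b.e i) y - eta n (b.e i) x') / eta n b.p y := by
      intro i
      simp [hu, b.eta_ee]
    set ν := expSO (wedge b.p u) (wedge_isSkew _ _) with hν
    have hνN : ν ∈ groupN b := b.expSO_wedge_mem_groupN hpu
    have hνx : act ν x' = y := by
      have k1 : eta n b.p (act ν x') = eta n b.p y := by
        have := eta_act ν b.p x'
        rw [b.act_p_of_mem_groupN hνN] at this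
        rw [this, hpx']
      have k2 : ∀ i, eta n (b.e i) (act ν x') = eta n (b.e i) y := by
        intro i
        rw [hν, b.eta_e_act_of_mem_groupN hpu, heu, hpx']
        field_simp
        ring
      -- The last coordinate follows from η = -1 on both sides, since η(p, y) ≠ 0.
      have k3 : eta n b.q (act ν x') = eta n b.q y := by
        have h1 := b.eta_self (act ν x')
        have h2 := b.eta_self y
        rw [eta_act, hx'x', k1] at h1
        simp only [k2] at h1
        rw [hy.1] at h2
        have h3 : eta n b.p y * eta n b.q (act ν x') = eta n b.p y * eta n b.q y := by linarith
        exact mul_left_cancel₀ hy0 h3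
      exact b.eta_ext k1 k3 k2
    have hgG : ν * m ∈ G := mul_mem (hNG hνN) (hPG ⟨a, rfl⟩)
    refine ⟨ν * m, ⟨hgG, by rw [act_mul, hνx]⟩, ?_⟩
    rintro g ⟨hg, hgx⟩
    have h1 : act ((ν * m)⁻¹ * g) x = x := by
      rw [act_mul, hgx]
      exact act_inv_of _ (by rw [act_mul, hνx])
    have h2 := hfree _ (mul_mem (inv_mem hgG) hg) x hx h1
    rw [inv_mul_eq_one] at h2
    exact h2.symm

theorem ActsSimplyTransitively.actsTransitively {G : Subgroup (SO n)}
    (hG : ActsSimplyTransitively G) : ActsTransitively G :=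
  ⟨hG.1, fun x hx y hy => (hG.2 x hx y hy).exists⟩

theorem ActsSimplyTransitively.eq_one {G : Subgroup (SO n)} (hG : ActsSimplyTransitively G)
    {x : V n} (hx : eta n x x < 0) {g : SO n} (hg : g ∈ G) (hgx : act g x = x) : g = 1 := by
  obtain ⟨c, hc⟩ := exists_smul_mem_lobSpace hx
  exact (hG.2 _ hc _ hc).unique ⟨hg, by rw [act_smul, hgx]⟩ ⟨one_mem _, act_one _⟩

theorem expClosure_bot : expClosure (⊥ : Submodule ℝ (Mat n)) = ⊥ := by
  rw [eq_bot_iff]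
  refine expClosure_induction (fun X hX => ?_) fun X hX => ?_
  · rw [(Submodule.mem_bot ℝ).1 hX]
    exact IsSkew.zero
  · refine Subgroup.mem_bot.2 (mat_injective ?_)
    rw [mat_expSO, (Submodule.mem_bot ℝ).1 hX, NormedSpace.exp_zero, mat_one]

/-- The Lie algebra is ℝZ + p ∧ E with Z = q ∧ p + B: p ∧ E is abelian and normalized by Z.
`isProductForm_expClosure` with 𝔥 = 0 identifies the group that it generates. -/
theorem isConnectedLieSubgroup_of_isSemidirectProduct {b : NullBasis n}
    {Φ : groupA b →* groupK b} (hΦ : Continuous Φ) {G : Subgroup (SO n)}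
    (hG : IsSemidirectProduct G (groupAPhi b Φ) (groupN b)) : IsConnectedLieSubgroup G := by
  obtain ⟨B, hB, rfl⟩ := exists_eq_phiHom b hΦ
  set Z := wedge b.q b.p + B with hZ
  have hZs : IsSkew Z := (wedge_isSkew _ _).add hB.skew
  have hZp : Z *ᵥ b.p = b.p := by rw [hZ, Matrix.add_mulVec, b.wedge_qp_p, hB.p, add_zero]
  have hZE : ∀ u, eta n b.p u = 0 → eta n b.q u = 0 →
      eta n b.p (Z *ᵥ u) = 0 ∧ eta n b.q (Z *ᵥ u) = 0 := by
    intro u h1 h2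
    have hw : wedge b.q b.p *ᵥ u = 0 := by simp [wedge_mulVec, h1, h2]
    rw [hZ, Matrix.add_mulVec, hw, zero_add]
    have h3 := hB.skew b.p u
    have h4 := hB.skew b.q u
    rw [hB.p, map_zero, LinearMap.zero_apply, zero_add] at h3
    rw [hB.q, map_zero, LinearMap.zero_apply, zero_add] at h4
    exact ⟨h3, h4⟩
  let 𝔤 : Submodule ℝ (Mat n) := Submodule.span ℝ {Z} ⊔
    (LinearMap.ker (eta n b.p) ⊓ LinearMap.ker (eta n b.q)).map (wedgeRight b.p)
  have h𝔤 : ∀ X, X ∈ 𝔤 ↔ ∃ (s : ℝ) (Y : Mat n) (u : V n), Y ∈ (⊥ : Submodule ℝ (Mat n)) ∧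
      eta n b.p u = 0 ∧ eta n b.q u = 0 ∧ X = s • Z + Y + wedge b.p u := by
    intro X
    constructor
    · intro hX
      obtain ⟨y, hy, z, ⟨u, ⟨hu, hu'⟩, rfl⟩, rfl⟩ := Submodule.mem_sup.1 hX
      obtain ⟨s, rfl⟩ := Submodule.mem_span_singleton.1 hy
      exact ⟨s, 0, u, zero_mem _, hu, hu', by rw [add_zero]; rfl⟩
    · rintro ⟨s, Y, u, hY, hu, hu', rfl⟩
      rw [(Submodule.mem_bot ℝ).1 hY, add_zero]
      exact Submodule.add_mem_sup (Submodule.mem_span_singleton.2 ⟨s, rfl⟩) ⟨u, ⟨hu, hu'⟩, rfl⟩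
  have h𝔤s : ∀ X ∈ 𝔤, IsSkew X := by
    intro X hX
    obtain ⟨s, Y, u, hY, -, -, rfl⟩ := (h𝔤 X).1 hX
    rw [(Submodule.mem_bot ℝ).1 hY, add_zero]
    exact (hZs.smul s).add (wedge_isSkew _ _)
  have hbr : ∀ u, Z * wedge b.p u - wedge b.p u * Z = wedge b.p (u + Z *ᵥ u) := by
    intro u
    rw [hZs.commutator_wedge, hZp, wedge_add_right]
  have hbrN : ∀ u v, eta n b.p u = 0 → eta n b.p v = 0 →
      wedge b.p u * wedge b.p v - wedge b.p v * wedge b.p u = 0 := by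
    intro u v hu hv
    rw [(wedge_isSkew b.p u).commutator_wedge, wedge_mulVec, wedge_mulVec, b.eta_pp,
      eta_comm u b.p, hu, hv]
    simp [wedge, Matrix.mulVec_smul, Matrix.mulVec_neg]
  have hlie : ∀ X ∈ 𝔤, ∀ Y ∈ 𝔤, X * Y - Y * X ∈ 𝔤 := by
    intro X hX X' hX'
    obtain ⟨s, Y, u, hY, hu, hu', rfl⟩ := (h𝔤 X).1 hX
    obtain ⟨s', Y', v, hY', hv, hv', rfl⟩ := (h𝔤 X').1 hX'
    rw [(Submodule.mem_bot ℝ).1 hY, (Submodule.mem_bot ℝ).1 hY', add_zero, add_zero]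
    have h1 := hbrN u v hu hv
    have h2 : (s • Z + wedge b.p u) * (s' • Z + wedge b.p v)
        - (s' • Z + wedge b.p v) * (s • Z + wedge b.p u)
        = wedge b.p (s • (v + Z *ᵥ v) - s' • (u + Z *ᵥ u)) := by
      rw [sub_eq_add_neg (s • _), ← neg_smul, wedge_add_right, wedge_smul_right, wedge_smul_right,
        ← hbr, ← hbr]
      simp only [mul_add, add_mul, smul_mul_assoc, mul_smul_comm]
      rw [sub_eq_zero] at h1
      rw [h1]
      module
    rw [h2]
    have hk : ∀ w, eta n b.p w = 0 → eta n b.q w = 0 →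
        eta n b.p (w + Z *ᵥ w) = 0 ∧ eta n b.q (w + Z *ᵥ w) = 0 := fun w k1 k2 => by
      rw [map_add, map_add, k1, k2, (hZE w k1 k2).1, (hZE w k1 k2).2, add_zero]
      exact ⟨rfl, rfl⟩
    refine (h𝔤 _).2 ⟨0, 0, _, zero_mem _, ?_, ?_, by rw [zero_smul, zero_add, zero_add]⟩
    · rw [map_sub, map_smul, map_smul, (hk v hv hv').1, (hk u hu hu').1]
      simp
    · rw [map_sub, map_smul, map_smul, (hk v hv hv').2, (hk u hu hu').2]
      simp
  obtain ⟨-, M, hM, hMN⟩ := isProductForm_expClosure b hB (𝔥 := ⊥)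
    (fun Y hY => by
      rw [(Submodule.mem_bot ℝ).1 hY]
      exact ⟨IsSkew.zero, Matrix.zero_mulVec _, Matrix.zero_mulVec _⟩)
    (fun Y hY => by rw [(Submodule.mem_bot ℝ).1 hY, mul_zero, zero_mul]) h𝔤s h𝔤
  refine ⟨𝔤, h𝔤s, hlie, ?_⟩
  have h1 := hM.generate
  rw [expClosure_bot, sup_bot_eq] at h1
  rw [← hG.generate, h1, hMN.generate]
  rfl

/-- The structure of a transitive connected group. -/
theorem transitive_classification {𝔤 : Submodule ℝ (Mat n)} (h𝔤 : ∀ X ∈ 𝔤, IsSkew X)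
    (hlie : ∀ X ∈ 𝔤, ∀ Y ∈ 𝔤, X * Y - Y * X ∈ 𝔤) (htrans : ActsTransitively (expClosure 𝔤)) :
    (∃ p q : V n, IsNullPair p q ∧ (∃ e, e ≠ 0 ∧ eta n p e = 0 ∧ eta n q e = 0) ∧
      ∀ X, IsSkew X → X ∈ 𝔤) ∨
    ∃ b : NullBasis n, Preserves (expClosure 𝔤) (Submodule.span ℝ {b.p}) ∧
      ∃ Φ : groupA b →* groupK b, Continuous Φ ∧ ∃ H : Subgroup (SO n), H ≤ groupK b ∧
        IsProductForm (expClosure 𝔤) (groupAPhi b Φ) H (groupN b) := by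
  rcases lie_algebra_of_transitive h𝔤 hlie htrans with h | ⟨b, hN, hpar⟩
  · exact Or.inl h
  · obtain ⟨B, 𝔥, hB, h𝔥, hB𝔥, hdec⟩ := exists_rotGen_of_parabolic h𝔤 hlie htrans hN hpar
    refine Or.inr ⟨b, preserves_expClosure h𝔤 fun X hX x hx => ?_, phiHom b B hB,
      continuous_phiHom hB, expClosure 𝔥, isProductForm_expClosure b hB h𝔥 hB𝔥 h𝔤 hdec⟩
    obtain ⟨c, rfl⟩ := Submodule.mem_span_singleton.1 hx
    obtain ⟨d, hd⟩ := hpar X hX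
    rw [Matrix.mulVec_smul, hd]
    exact Submodule.smul_mem _ _ (Submodule.smul_mem _ _ (Submodule.mem_span_singleton_self _))

theorem eq_SO0_or_isProductForm {G : Subgroup (SO n)} (hconn : IsConnectedLieSubgroup G)
    (hG : ActsTransitively G) : G = SO0 n ∨
      ∃ l : Submodule ℝ (V n), IsIsotropicLine l ∧ Preserves G l ∧
        ∃ b : NullBasis n, l = Submodule.span ℝ {b.p} ∧
          ((∃ H : Subgroup (SO n), H ≤ groupK b ∧
              IsProductForm G (groupA b) H (groupN b)) ∨
            (∃ Φ : groupA b →* groupK b, Continuous Φ ∧ Φ ≠ 1 ∧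
              ∃ H : Subgroup (SO n), H ≤ groupK b ∧
                IsProductForm G (groupAPhi b Φ) H (groupN b))) := by
  obtain ⟨𝔤, h𝔤, hlie, rfl⟩ := hconn
  rcases transitive_classification h𝔤 hlie hG with ⟨-, -, -, -, hall⟩ | ⟨b, hb, Φ, hΦ, H, hH, hform⟩
  · exact Or.inl (SO0_eq_expClosure h𝔤 hall)
  · refine Or.inr ⟨_, ⟨b.p, b.isNullPair.left_ne_zero, b.eta_pp, rfl⟩, hb, b, rfl, ?_⟩
    by_cases h1 : Φ = 1
    · subst h1
      rw [groupAPhi_one] at hform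
      exact Or.inl ⟨H, hH, hform⟩
    · exact Or.inr ⟨Φ, hΦ, h1, H, hH, hform⟩

/-- No nontrivial element may fix a timelike vector, and p - q is the one tested in both cases of
the classification. -/
theorem ActsSimplyTransitively.isSemidirectProduct {G : Subgroup (SO n)}
    (hconn : IsConnectedLieSubgroup G) (hG : ActsSimplyTransitively G) :
    ∃ b : NullBasis n, IsSemidirectProduct G (groupA b) (groupN b) ∨
      ∃ Φ : groupA b →* groupK b, Continuous Φ ∧ Φ ≠ 1 ∧
        IsSemidirectProduct G (groupAPhi b Φ) (groupN b) := by
  obtain ⟨𝔤, h𝔤, hlie, rfl⟩ := hconn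
  have htime : ∀ {p q : V n}, IsNullPair p q → eta n (p - q) (p - q) < 0 := fun h => by
    simp [h.pp, h.qq, h.pq, h.qp]
  rcases transitive_classification h𝔤 hlie hG.actsTransitively with
    ⟨p, q, h, ⟨e, he, hpe, hqe⟩, hall⟩ | ⟨b, hb, Φ, hΦ, H, hH, M, hM, hMN⟩
  -- The rotations exp(t (p + q) ∧ e) fix p - q, hence are trivial; differentiating at p would give
  -- e = 0.
  · exfalso
    have hXs : IsSkew (wedge (p + q) e) := wedge_isSkew _ _
    have hX0 : wedge (p + q) e *ᵥ (p - q) = 0 := by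
      simp [wedge_mulVec, h.pp, h.qq, h.pq, h.qp, eta_comm e, hpe, hqe]
    have h1 : ∀ t : ℝ, expSO (t • wedge (p + q) e) (hXs.smul t) = 1 := fun t =>
      hG.eq_one (htime h) (expSO_mem_expClosure _ (hall _ (hXs.smul t)))
        (exp_mulVec_of_kernel (by rw [Matrix.smul_mulVec, hX0, smul_zero]))
    have h2 : wedge (p + q) e *ᵥ p = 0 := eq_zero_of_exp_smul_mulVec fun t => by
      rw [← act_expSO _ (hXs.smul t), h1, act_one]
    simp [wedge_mulVec, h.pp, h.qp, eta_comm e, hpe, he] at h2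
  · have hHM : H ≤ M := hM.generate ▸ le_sup_right
    have hMG : M ≤ expClosure 𝔤 := hMN.generate ▸ le_sup_left
    -- Elements of H fix both p and q, hence p - q.
    have hH1 : H = ⊥ := by
      rw [eq_bot_iff]
      intro g hg
      refine Subgroup.mem_bot.2 (hG.eq_one (htime b.isNullPair) (hMG (hHM hg)) ?_)
      rw [act_sub, b.act_p_of_mem_groupK (hH hg), b.act_q_of_mem_groupK (hH hg)]
    have h1 := hM.generate
    rw [hH1, sup_bot_eq] at h1
    rw [← h1] at hMN
    refine ⟨b, ?_⟩
    by_cases hΦ1 : Φ = 1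
    · subst hΦ1
      rw [groupAPhi_one] at hMN
      exact Or.inl hMN
    · exact Or.inr ⟨Φ, hΦ, hΦ1, hMN⟩

end Lobachevsky
end

open Lobachevsky
theorem theorem6 (n : ℕ) :
    (∀ G : Subgroup (SO n), IsConnectedLieSubgroup G → ActsTransitively G →
      G = SO0 n ∨
      ∃ l : Submodule ℝ (V n), IsIsotropicLine l ∧ Preserves G l ∧
        ∃ b : NullBasis n, l = Submodule.span ℝ {b.p} ∧
          ((∃ H : Subgroup (SO n), H ≤ groupK b ∧
              IsProductForm G (groupA b) H (groupN b)) ∨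
            (∃ Φ : groupA b →* groupK b, Continuous Φ ∧ Φ ≠ 1 ∧
              ∃ H : Subgroup (SO n), H ≤ groupK b ∧
                IsProductForm G (groupAPhi b Φ) H (groupN b)))) ∧
    (∀ G : Subgroup (SO n),
      (IsConnectedLieSubgroup G ∧ ActsSimplyTransitively G) ↔
        ∃ b : NullBasis n,
          IsSemidirectProduct G (groupA b) (groupN b) ∨
            ∃ Φ : groupA b →* groupK b, Continuous Φ ∧ Φ ≠ 1 ∧
              IsSemidirectProduct G (groupAPhi b Φ) (groupN b)) := by
  refine ⟨fun G hconn hG => eq_SO0_or_isProductForm hconn hG, fun G => ⟨fun ⟨hconn, hG⟩ =>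
    hG.isSemidirectProduct hconn, ?_⟩⟩
  rintro ⟨b, h | ⟨Φ, hΦ, -, h⟩⟩
  · rw [← groupAPhi_one] at h
    exact ⟨isConnectedLieSubgroup_of_isSemidirectProduct continuous_const h,
      actsSimplyTransitively_of_isSemidirectProduct h⟩
  · exact ⟨isConnectedLieSubgroup_of_isSemidirectProduct hΦ h,
      actsSimplyTransitively_of_isSemidirectProduct h⟩
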